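/- Setting. Let $\Gamma$ be a finite connected metric graph with vertex set $V$, edge set $E$ (loops and multiple edges allowed) and edge lengths $l_e>0$, with Neumann conditions at the vertices, except that Dirichlet conditions are allowed at some vertices of degree one; assume that $\Gamma$ is not a circle or a polygon (i.e. not all degrees are $2$). A directed edge $e$ has a reversal $\hat e$. The bond scattering matrix $S$ is indexed by directed edges: if $e$ terminates at $v$, then $S_{\hat e,e}=\frac{2}{\deg v}-1$ (or $-1$ if $v$ is Dirichlet), $S_{e',e}=\frac2{\deg v}$ if $e'\neq\hat e$ originates at $v$, and $S_{e',e}=0$ otherwise. Let $\mathcal C\subset E$ be the complement of the edge set of a spanning tree. For $x\in\mathbb T^{E}=(\mathbb R/2\pi\mathbb Z)^{E}$ and $\alpha\in\mathbb R^{\mathcal C}$ put $F(x;\alpha)=\det\bigl(1-e^{i\alpha}e^{ix}S\bigr)$, where the diagonal matrix $e^{ix}$ has entry $e^{ix_e}$ at both orientations of $e$, and the diagonal matrix $e^{i\alpha}$ has entries $e^{\pm i\alpha_e}$ at the two orientations of $e\in\mathcal C$ and $1$ elsewhere. Let $\Sigma^{g}$ be the set of all $x\in\mathbb T^E$ with $F(x;0)=0$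 and $\nabla_xF(x;0)\ne0$ for which the canonical eigenfunction does not vanish at any non-Dirichlet vertex; the canonical eigenfunction is given by the solution $a\neq0$ of $e^{ix}Sa=a$, unique up to a factor, and is $f(y)=a_e e^{-i(x_e-y)}+a_{\hat e}e^{-iy}$ at distance $y$ from the origin of the directed edge $e$. Let $\mu$ be the Barra–Gaspard measure on $\Sigma^g$: the normalization of $|\hat n\cdot l|\,d\sigma$, where $d\sigma$ is the Euclidean surface measure and $\hat n$ the unit normal of $\Sigma^g$. An edge separation of $\Gamma$ is a sequence $[\Gamma_1,\dots,\Gamma_n]$ of connected subgraphs with union $\Gamma$ such that, for each $j\ge2$, $\Gamma_j$ has exactly one vertex in common with $\Gamma_1\cup\dots\cup\Gamma_{j-1}$, and this vertex has degree one in $\Gamma_j$; the edge of $\Gamma_j$ at this vertex is the bridge of $\Gamma_j$. The local surplus of $\Gamma_b$ at $x\in\Sigma^g$ is the number $\sigma^{(b)}(x)$ of negative eigenvalues of the real symmetric matrix $$-\frac{1}{\nabla_x F(x;0)\cdot l}\left[\frac{\partial^2F}{\partial\alpha_i\,\partial\alpha_j}(x;0)\right]_{i,j},$$ where $i,j$ run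 over the edges of $\mathcal C$ that lie in $\Gamma_b$; let $\beta^{(b)}$ be the number of independent cycles of $\Gamma_b$. (1) Let $[\Gamma_1,\Gamma_2]$ be an edge separation with bridge $e_0$, and write $x=(x_1,x_0,x_2)$ for the coordinates on the edges of $\Gamma_1$, on $e_0$, and on the other edges of $\Gamma_2$. There is a real function $\theta_0$ of $x_1$ such that for every $x\in\Sigma^g$ the canonical eigenfunction, suitably scaled, equals $c\cos(y-\theta_0(x_1))$ with $c>0$ on $e_0$, where $y$ is the distance from the vertex shared with $\Gamma_1$. For every such $\theta_0$ the map $$R(x_1,x_0,x_2)=(x_1,\,-x_0+2\theta_0(x_1),\,-x_2)$$ is a measure-preserving homeomorphism of $(\Sigma^g,\mu)$ onto itself, and for every choice of $\mathcal C$ $$\sigma^{(1)}\circ R=\sigma^{(1)},\qquad \sigma^{(2)}\circ R=\beta^{(2)}-\sigma^{(2)}.$$ (2) Let $[\Gamma_1,\dots,\Gamma_n]$ be an edge separation and $1\le b\le n$. Then there is a measure-preserving homeomorphism $\mathcal R$ of $(\Sigma^g,\mu)$ onto itself, which is the composition of the inversion $x\mapsto-x$ with finitely many maps $R$ as in (1)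 (for edge separations of $\Gamma$ into two blocks), such that for every choice of $\mathcal C$ $$\sigma^{(b)}\circ\mathcal R=\beta^{(b)}-\sigma^{(b)},\qquad \sigma^{(j)}\circ\mathcal R=\sigma^{(j)}\quad\text{for all } j\neq b.$$ -/

import Mathlib

open MeasureTheory
open scoped Real

noncomputable section

/-- A finite metric graph with vertex set `V` and edge set `E`. Loops and multiple edges are
allowed; `src` and `tgt` record an arbitrary orientation of each edge. `dirichlet` is the set of
vertices carrying the Dirichlet condition, all other vertices carry the Neumann condition. -/
structure MetricGraph (V E : Type*) where
  src : E → V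
  tgt : E → V
  length : E → ℝ
  length_pos : ∀ e, 0 < length e
  dirichlet : Finset V

/-- The flat torus `(ℝ / 2πℤ)^E` with the Euclidean metric. -/
abbrev Torus (E : Type*) : Type _ := PiLp 2 (fun _ : E => AddCircle (2 * π))

/-- `t` times the `e`-th coordinate vector, reduced modulo `2π`. -/
def Torus.single {E : Type*} [DecidableEq E] (e : E) (t : ℝ) : Torus E :=
  WithLp.toLp 2 (Pi.single e ((t : ℝ) : AddCircle (2 * π)))

/-- `e^{iθ}` for `θ ∈ ℝ / 2πℤ`. -/
def phase (θ : AddCircle (2 * π)) : ℂ := (AddCircle.toCircle θ : ℂ)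

/-- The number of negative eigenvalues, with multiplicity. It is applied to matrices which are
real and symmetric. -/
def morseIndex {ι : Type*} [Fintype ι] [DecidableEq ι] (A : Matrix ι ι ℂ) : ℕ :=
  (A.charpoly.roots.filter (fun z => z.re < 0 ∧ z.im = 0)).card

namespace MetricGraph

variable {V E : Type*} [Fintype V] [Fintype E] [DecidableEq V] [DecidableEq E]

section Graph

variable (G : MetricGraph V E)

/-- The initial vertex of a directed edge; `(e, true)` is `e` with its chosen orientation and
`(e, false)` is the reversed edge. -/
def origin (d : E × Bool) : V := if d.2 then G.src d.1 else G.tgt d.1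

/-- The reversal of a directed edge. -/
def rev (d : E × Bool) : E × Bool := (d.1, !d.2)

/-- The vertex at which a directed edge terminates. -/
def terminus (d : E × Bool) : V := G.origin (rev d)

/-- The degree of a vertex; a loop contributes two. -/
def degree (v : V) : ℕ := (Finset.univ.filter fun d : E × Bool => G.origin d = v).card

/-- A set of vertices together with a set of edges all of whose endpoints are in it. -/
structure Subgraph where
  verts : Finset V
  edges : Finset E
  src_mem : ∀ e ∈ edges, G.src e ∈ verts
  tgt_mem : ∀ e ∈ edges, G.tgt e ∈ verts

end Graph

section Subgraphs

variable {G : MetricGraph V E}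

/-- A subgraph is connected if it has a vertex and any two of its vertices are joined by a path
of edges of the subgraph. -/
def Subgraph.Connected (H : G.Subgraph) : Prop :=
  H.verts.Nonempty ∧ ∀ u ∈ H.verts, ∀ v ∈ H.verts,
    Relation.ReflTransGen
      (fun a b => ∃ d : E × Bool, d.1 ∈ H.edges ∧ G.origin d = a ∧ G.terminus d = b) u v

/-- The degree of a vertex in a subgraph. -/
def Subgraph.degree (H : G.Subgraph) (v : V) : ℕ :=
  (Finset.univ.filter fun d : E × Bool => d.1 ∈ H.edges ∧ G.origin d = v).card

/-- The number of independent cycles of a connected subgraph. -/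
def Subgraph.betti (H : G.Subgraph) : ℤ := (H.edges.card : ℤ) - H.verts.card + 1

/-- The vertices which the `j`-th subgraph shares with the union of the previous ones. -/
def commonVerts {n : ℕ} (Γ : Fin n → G.Subgraph) (j : Fin n) : Set V :=
  {v | v ∈ (Γ j).verts ∧ ∃ i, i < j ∧ v ∈ (Γ i).verts}

/-- Vertex separations of a graph. -/
structure IsVertexSeparation {n : ℕ} (Γ : Fin n → G.Subgraph) : Prop where
  connected : ∀ j, (Γ j).Connected
  one_common : ∀ j : Fin n, 0 < (j : ℕ) → ∃ v, commonVerts Γ j = {v}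
  verts_union : ∀ v, ∃ j, v ∈ (Γ j).verts
  edges_union : ∀ e, ∃ j, e ∈ (Γ j).edges

/-- Edge separations of a graph. -/
structure IsEdgeSeparation {n : ℕ} (Γ : Fin n → G.Subgraph) : Prop
    extends IsVertexSeparation Γ where
  degree_one : ∀ j : Fin n, 0 < (j : ℕ) → ∀ v ∈ commonVerts Γ j, (Γ j).degree v = 1

/-- `d` is the bridge of the `j`-th block, directed away from the vertex which this block shares
with the union of the previous ones. -/
def IsBridge {n : ℕ} (Γ : Fin n → G.Subgraph) (j : Fin n) (d : E × Bool) : Prop :=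
  d.1 ∈ (Γ j).edges ∧ G.origin d ∈ commonVerts Γ j

end Subgraphs

section Secular

variable (G : MetricGraph V E)

/-- The spanning subgraph with a given set of edges. -/
def spanning (S : Finset E) : G.Subgraph where
  verts := Finset.univ
  edges := S
  src_mem := fun _ _ => Finset.mem_univ _
  tgt_mem := fun _ _ => Finset.mem_univ _

/-- Nontrivial standard graphs: connected, Dirichlet conditions only at vertices of degree one,
and not a circle or a polygon (the connected graphs with all degrees equal to two). -/
structure IsNontrivialStandard : Prop where
  connected : (G.spanning Finset.univ).Connected
  dirichlet_degree : ∀ v ∈ G.dirichlet, G.degree v = 1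
  not_cycle : ∃ v, G.degree v ≠ 2

/-- A set of `β = |E| - |V| + 1` edges whose removal does not disconnect the graph (the complement
of a spanning tree); the magnetic fluxes are placed on these edges. -/
def IsCut (C : Finset E) : Prop :=
  (G.spanning (Finset.univ \ C)).Connected ∧
    (C.card : ℤ) = (Fintype.card E : ℤ) - Fintype.card V + 1

/-- The bond scattering matrix. -/
def bondScattering : Matrix (E × Bool) (E × Bool) ℂ := Matrix.of fun d' d =>
  if d' = rev d then
    if G.terminus d ∈ G.dirichlet then -1 else 2 / (G.degree (G.terminus d) : ℂ) - 1
  else if G.origin d' = G.terminus d then 2 / (G.degree (G.terminus d) : ℂ)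
  else 0

/-- The diagonal matrix of the phases `e^{i x_e}`. -/
def torusPhase (x : Torus E) : Matrix (E × Bool) (E × Bool) ℂ :=
  Matrix.diagonal fun d => phase (x d.1)

/-- The diagonal matrix of the magnetic phases: `e^{i α_e}` along the edge `e` and `e^{-i α_e}`
against it. -/
def fluxPhase (α : E → ℝ) : Matrix (E × Bool) (E × Bool) ℂ :=
  Matrix.diagonal fun d => Complex.exp (Complex.I * (if d.2 then (α d.1 : ℂ) else -(α d.1 : ℂ)))

/-- The secular function `F(x; α) = det (1 - e^{iα} e^{ix} S)`. The potential `α` is a function on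
all edges here; it is only used with support in a set of edges as in `IsCut`. -/
def secular (x : Torus E) (α : E → ℝ) : ℂ :=
  (1 - fluxPhase α * torusPhase x * G.bondScattering).det

/-- The gradient of `F(·; 0)`. -/
def secularGrad (x : Torus E) (e : E) : ℂ :=
  deriv (fun t : ℝ => G.secular (x + Torus.single e t) 0) 0

/-- The second derivative of `F(x; ·)` at `α = 0` with respect to the fluxes on `i` and `j`. -/
def fluxHessian (x : Torus E) (i j : E) : ℂ :=
  deriv (fun s : ℝ => deriv (fun t : ℝ => G.secular x (Pi.single i s + Pi.single j t)) 0) 0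

/-- The real secular function `e^{-i ∑ x_e} F(x; 0) / √(det S)` (its values are real). -/
def realSecular (x : Torus E) : ℝ :=
  (phase (-∑ e, x e) / G.bondScattering.det ^ (1 / 2 : ℂ) * G.secular x 0).re

/-- The unit normal vector to the secular manifold at its regular points. -/
def unitNormal (x : Torus E) : EuclideanSpace ℝ E :=
  let g : EuclideanSpace ℝ E :=
    WithLp.toLp 2 fun e => deriv (fun t : ℝ => G.realSecular (x + Torus.single e t)) 0
  ‖g‖⁻¹ • g

/-- The secular manifold. -/
def secularSet : Set (Torus E) := {x | G.secular x 0 = 0}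

/-- The regular part of the secular manifold. -/
def regularSet : Set (Torus E) := {x ∈ G.secularSet | ∃ e, G.secularGrad x e ≠ 0}

/-- `a` is the vector of amplitudes of a canonical eigenfunction at `x`: a nonzero solution of
`e^{ix} S a = a`. -/
def IsCanonical (x : Torus E) (a : E × Bool → ℂ) : Prop :=
  a ≠ 0 ∧ (torusPhase x * G.bondScattering).mulVec a = a

/-- The canonical eigenfunction with amplitudes `a` on the directed edge `d`, as a function of the
distance `y` from the origin of `d`. -/
def edgeFunction (x : Torus E) (a : E × Bool → ℂ) (d : E × Bool) (y : ℝ) : ℂ :=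
  a d * phase (-(x d.1)) * Complex.exp (Complex.I * y) +
    a (rev d) * Complex.exp (-(Complex.I * y))

/-- The generic part of the secular manifold: the regular points at which the canonical
eigenfunction does not vanish at any vertex (other than those with the Dirichlet condition). -/
def genericSet : Set (Torus E) :=
  {x ∈ G.regularSet | ∃ a, G.IsCanonical x a ∧
    ∀ d, G.origin d ∉ G.dirichlet → edgeFunction x a d 0 ≠ 0}

/-- The measure `|n · l| dσ` on the generic part of the secular manifold, where `dσ` is the
Euclidean surface measure, that is, the Hausdorff measure of dimension `|E| - 1`. -/
def fluxMeasure : Measure G.genericSet :=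
  (Measure.euclideanHausdorffMeasure (Fintype.card E - 1)).withDensity fun x =>
    ENNReal.ofReal |∑ e, G.unitNormal x e * G.length e|

/-- The Barra-Gaspard measure: the normalization of `|n · l| dσ`. -/
def barraGaspard : Measure G.genericSet :=
  (G.fluxMeasure Set.univ)⁻¹ • G.fluxMeasure

variable {G}

/-- The local surplus of the block `H`, computed with the fluxes on the edges of `C` in `H`: the
Morse index of the matrix `-H_α(F) / (∇F · l)`, which is real and symmetric at regular points. -/
def localSurplus (C : Finset E) (H : G.Subgraph) (x : Torus E) : ℕ :=
  morseIndex (Matrix.of fun i j : ↥(C ∩ H.edges) =>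
    -G.fluxHessian x i j / ∑ e, G.secularGrad x e * (G.length e : ℂ))

/-- `θ` is a phase function for the bridge `d` attached to the block `H`: at every generic point
`x`, the canonical eigenfunction, suitably scaled, has the form `c cos (y - θ(x₁))` with `c > 0` on
the bridge, where `y` is the distance from `H` and `x₁` consists of the coordinates of `x` on the
edges of `H`. -/
def IsBridgePhase (H : G.Subgraph) (d : E × Bool)
    (θ : (H.edges → AddCircle (2 * π)) → ℝ) : Prop :=
  ∀ x ∈ G.genericSet, ∃ a, G.IsCanonical x a ∧ ∃ c : ℝ, 0 < c ∧
    ∀ y : ℝ, edgeFunction x a d y = ((c * Real.cos (y - θ fun e => x e) : ℝ) : ℂ)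

/-- The map `(x₁, x₀, x₂) ↦ (x₁, -x₀ + 2θ(x₁), -x₂)`, where `x₁` consists of the coordinates on the
edges of `H` and `x₀` is the coordinate on `e₀`. -/
def bridgeMap (H : G.Subgraph) (e₀ : E) (θ : (H.edges → AddCircle (2 * π)) → ℝ)
    (x : Torus E) : Torus E :=
  WithLp.toLp 2 fun e =>
    if e ∈ H.edges then x e
    else if e = e₀ then -x e + ((2 * θ (fun e => x e) : ℝ) : AddCircle (2 * π))
    else -x e

/-- `R` is the bridge map of an edge separation of `G` into two blocks. -/
def IsBridgeSymmetry (R : G.genericSet ≃ₜ G.genericSet) : Prop :=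
  ∃ (Γ : Fin 2 → G.Subgraph) (d : E × Bool) (θ : ((Γ 0).edges → AddCircle (2 * π)) → ℝ),
    IsEdgeSeparation Γ ∧ IsBridge Γ 1 d ∧ IsBridgePhase (Γ 0) d θ ∧
    ∀ x : G.genericSet, (R x : Torus E) = bridgeMap (Γ 0) d.1 θ x

end Secular

end MetricGraph

end

set_option linter.unusedSectionVars false


noncomputable section

namespace MetricGraph

variable {V E : Type*} [Fintype V] [Fintype E] [DecidableEq V] [DecidableEq E]

/-! ### Vertex scattering: unitarity, reality and time reversal -/

section Scattering

open Matrix ComplexConjugate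

/-! Write U = e^{ix}S. Each vertex scatters by a real reflection, so U is unitary and the antilinear
time reversal a_d ↦ e^{ix_d}·conj(a_{rev d}) conjugates U into its inverse. At a regular point the
eigenvalue 1 of U is simple, its eigenvector a can be chosen invariant under time reversal
(`IsRealSimple`), and the adjugate of 1 − U is c·a·a* with an unknown c ≠ 0
(`Matrix.exists_adjugate_eq`). Expanding determinants against the adjugate shows that the gradient
of F is −ic times the vector of edge weights (`secularGrad_eq`), and that the flux Hessian is c
times a form in the first order responses of a to the fluxes (`fluxHessian_eq`). The surplus matrix
is a quotient of the two, so c cancels.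

A bridge map is complex conjugation of the amplitudes on one side of a cut edge. Conservation of
current makes all solutions on one side proportional on the cut edge, so the phase there depends
only on the coordinates of that side, and conjugating the far amplitudes gives an eigenvector at the
reflected point (`IsMirror.isGenericVec`). The response to a flux on one side is supported on that
side. Hence, for the edges of a cut set, near entries are unchanged, mixed entries vanish, and far
entries change sign because the purely imaginary form is conjugated. Inversion is the same with the
whole graph on the far side.

A sign change complements the number of negative eigenvalues only if the block is nondegenerate. A
kernel vector is a flux whose response has no current on the cut set. This current is a flow, so it
vanishes everywhere; as the eigenfunction does not vanish at the vertices, the flux must be a gauge,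
and being supported on the complement of a spanning tree it is zero (`IsGenericVec.flux_eq_zero`).
The size of a block equals its Betti number by a count of tree edges
(`IsEdgeSeparation.card_cut_inter`).

For the measure, conjugation preserves the edge weights, so the tangent hyperplanes at a point and
at its image are parallel and the densities agree. All coordinates except that of the bridge are
only multiplied by signs. Projecting along the bridge coordinate to the tangent hyperplane is almost
isometric near a point and turns the map into a linear involution, so Hausdorff measure is preserved
(`IsSignReflection.hausdorffMeasure_image`). No differentiability of the phase function is needed.

For several blocks, the bridge of block j cuts off j with its descendants in the tree of blocks. The
sets of blocks that can be flipped are closed under symmetric difference, so descending induction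
gives the singletons other than the initial block, then the complement of any {b}, and inversion
turns this into {b}. -/

@[simp] theorem rev_rev (d : E × Bool) : rev (rev d) = d := by
  simp [rev]

@[simp] theorem rev_fst (d : E × Bool) : (rev d).1 = d.1 := rfl

@[simp] theorem rev_snd (d : E × Bool) : (rev d).2 = !d.2 := rfl

theorem rev_ne (d : E × Bool) : rev d ≠ d := by
  intro h
  have := congrArg Prod.snd h
  simp at this

theorem eq_rev_iff {d d' : E × Bool} : d' = rev d ↔ rev d' = d :=
  ⟨fun h => by simp [h], fun h => by simp [← h]⟩

theorem eq_or_eq_rev_of_fst_eq {d d' : E × Bool} (h : d'.1 = d.1) : d' = d ∨ d' = rev d := by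
  obtain ⟨e, s⟩ := d
  obtain ⟨e', s'⟩ := d'
  simp only at h
  subst h
  cases s <;> cases s' <;> simp [rev]

/-- Reversal of directed edges as a permutation. -/
def revEquiv : Equiv.Perm (E × Bool) where
  toFun := rev
  invFun := rev
  left_inv := rev_rev
  right_inv := rev_rev

theorem sum_rev {M : Type*} [AddCommMonoid M] (f : E × Bool → M) :
    ∑ d, f (rev d) = ∑ d, f d :=
  Equiv.sum_comp (revEquiv (E := E)) f

variable (G : MetricGraph V E)

@[simp] theorem origin_rev (d : E × Bool) : G.origin (rev d) = G.terminus d := rfl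

@[simp] theorem terminus_rev (d : E × Bool) : G.terminus (rev d) = G.origin d := by
  simp [terminus]

/-- The coefficient of the scattering at a vertex. -/
def vertexCoeff (v : V) : ℂ := if v ∈ G.dirichlet then 0 else 2 / (G.degree v : ℂ)

/-- The sum of the amplitudes of the directed edges which terminate at a vertex. -/
def inSum (p : E × Bool → ℂ) (v : V) : ℂ := ∑ d, if G.terminus d = v then p d else 0

theorem conj_vertexCoeff (v : V) : conj (G.vertexCoeff v) = G.vertexCoeff v := by
  unfold vertexCoeff
  split_ifs <;> simp [map_ofNat (starRingEnd ℂ) 2]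

theorem degree_eq_sum (v : V) : (G.degree v : ℂ) = ∑ d, if G.origin d = v then (1 : ℂ) else 0 := by
  simp [degree, Finset.sum_boole]

/-- This identity says that k·J − 1, with J the all-ones matrix of size the degree, squares to 1. It
covers k = 2/deg and k = 0 alike, so unitarity and time reversal need no case distinction for
Dirichlet vertices. -/
theorem vertexCoeff_sq_mul_degree (v : V) :
    G.vertexCoeff v * G.vertexCoeff v * G.degree v = 2 * G.vertexCoeff v := by
  unfold vertexCoeff
  split_ifs
  · simp
  · by_cases h : (G.degree v : ℂ) = 0
    · simp [h]
    · field_simp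

theorem eq_of_degree_eq_one {v : V} (hv : G.degree v = 1) {d d' : E × Bool}
    (h : G.origin d = v) (h' : G.origin d' = v) : d' = d := by
  obtain ⟨a, ha⟩ := Finset.card_eq_one.mp hv
  have h1 : d ∈ ({a} : Finset (E × Bool)) := by rw [← ha]; simp [h]
  have h2 : d' ∈ ({a} : Finset (E × Bool)) := by rw [← ha]; simp [h']
  rw [Finset.mem_singleton] at h1 h2
  rw [h1, h2]

variable {G}

/-- The Dirichlet rule fits the Neumann formula with coefficient 0 because a Dirichlet vertex has
degree one and so has no transmission entries. -/
theorem bondScattering_apply (hD : ∀ v ∈ G.dirichlet, G.degree v = 1) (d' d : E × Bool) :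
    G.bondScattering d' d =
      (if G.terminus d = G.origin d' then G.vertexCoeff (G.origin d') else 0) -
        if d' = rev d then 1 else 0 := by
  simp only [bondScattering, Matrix.of_apply, vertexCoeff]
  by_cases h : d' = rev d
  · have h2 : G.terminus d = G.origin d' := by rw [h]; rfl
    rw [if_pos h, if_pos h, if_pos h2, h2]
    split_ifs <;> simp
  · rw [if_neg h, if_neg h, sub_zero]
    by_cases h2 : G.origin d' = G.terminus d
    · rw [if_pos h2, if_pos h2.symm, ← h2]
      rw [if_neg]
      intro h3
      exact h (G.eq_of_degree_eq_one (hD _ h3) (d := rev d) (by simp [h2]) rfl)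
    · rw [if_neg h2, if_neg (Ne.symm h2)]

theorem bondScattering_mulVec (hD : ∀ v ∈ G.dirichlet, G.degree v = 1) (p : E × Bool → ℂ)
    (d' : E × Bool) :
    (G.bondScattering *ᵥ p) d' =
      G.vertexCoeff (G.origin d') * G.inSum p (G.origin d') - p (rev d') := by
  simp only [Matrix.mulVec, dotProduct, bondScattering_apply hD, sub_mul, Finset.sum_sub_distrib,
    inSum, Finset.mul_sum]
  congr 1
  · exact Finset.sum_congr rfl fun d _ => by split_ifs <;> simp
  · simp [eq_rev_iff]

theorem sum_origin_eq_inSum (p : E × Bool → ℂ) (v : V) :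
    (∑ d, if G.origin d = v then p (rev d) else 0) = G.inSum p v := by
  rw [inSum, ← sum_rev]
  simp

/-- Scattering is unitary at each vertex. -/
theorem sum_conj_mul_bondScattering (hD : ∀ v ∈ G.dirichlet, G.degree v = 1)
    (p q : E × Bool → ℂ) (v : V) :
    (∑ d, if G.origin d = v then
        conj ((G.bondScattering *ᵥ p) d) * (G.bondScattering *ᵥ q) d else 0) =
      ∑ d, if G.terminus d = v then conj (p d) * q d else 0 := by
  set k := G.vertexCoeff v with hk
  have hk' : conj k = k := G.conj_vertexCoeff v
  have h1 : ∀ d, (if G.origin d = v then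
      conj ((G.bondScattering *ᵥ p) d) * (G.bondScattering *ᵥ q) d else 0) =
      k * k * conj (G.inSum p v) * G.inSum q v * (if G.origin d = v then 1 else 0) -
      k * G.inSum q v * conj (if G.origin d = v then p (rev d) else 0) -
      k * conj (G.inSum p v) * (if G.origin d = v then q (rev d) else 0) +
      (if G.origin d = v then conj (p (rev d)) * q (rev d) else 0) := by
    intro d
    split_ifs with h
    · rw [bondScattering_mulVec hD, bondScattering_mulVec hD, h, ← hk, map_sub, map_mul, hk']
      ring
    · simp
  simp only [h1, Finset.sum_add_distrib, Finset.sum_sub_distrib, ← Finset.mul_sum, ← map_sum,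
    ← degree_eq_sum, sum_origin_eq_inSum]
  have h2 := sum_origin_eq_inSum (G := G) (fun d => conj (p d) * q d) v
  rw [h2]
  change _ = G.inSum (fun d => conj (p d) * q d) v
  have h3 := G.vertexCoeff_sq_mul_degree v
  rw [← hk] at h3
  linear_combination (conj (G.inSum p v) * G.inSum q v) * h3

/-- The sesquilinear form of a scattering process on a set of vertices. -/
theorem sum_conj_mul_bondScattering_mem (hD : ∀ v ∈ G.dirichlet, G.degree v = 1)
    (p q : E × Bool → ℂ) (W : Finset V) :
    (∑ d, if G.origin d ∈ W then
        conj ((G.bondScattering *ᵥ p) d) * (G.bondScattering *ᵥ q) d else 0) =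
      ∑ d, if G.terminus d ∈ W then conj (p d) * q d else 0 := by
  have h := Finset.sum_congr (rfl : W = W) fun v _ => sum_conj_mul_bondScattering hD p q v
  rw [Finset.sum_comm, Finset.sum_comm (s := W)] at h
  simpa using h

/-- Scattering at each vertex is an involution: sending the scattered waves back recovers the
incoming ones. -/
theorem bondScattering_mulVec_rev (hD : ∀ v ∈ G.dirichlet, G.degree v = 1) (p : E × Bool → ℂ) :
    (G.bondScattering *ᵥ fun d => (G.bondScattering *ᵥ p) (rev d)) = fun d => p (rev d) := by
  funext d
  rw [bondScattering_mulVec hD]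
  have h1 : G.inSum (fun d => (G.bondScattering *ᵥ p) (rev d)) (G.origin d) =
      (G.degree (G.origin d) * G.vertexCoeff (G.origin d) - 1) * G.inSum p (G.origin d) := by
    rw [← sum_origin_eq_inSum]
    have : ∀ d', (if G.origin d' = G.origin d then (G.bondScattering *ᵥ p) (rev (rev d')) else 0) =
        G.vertexCoeff (G.origin d) * G.inSum p (G.origin d) *
          (if G.origin d' = G.origin d then 1 else 0) -
        (if G.origin d' = G.origin d then p (rev d') else 0) := by
      intro d'
      split_ifs with h
      · rw [rev_rev, bondScattering_mulVec hD, h]; ring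
      · simp
    simp only [this, Finset.sum_sub_distrib, ← Finset.mul_sum, ← degree_eq_sum,
      sum_origin_eq_inSum]
    ring
  rw [h1, rev_rev, bondScattering_mulVec hD]
  linear_combination G.inSum p (G.origin d) * G.vertexCoeff_sq_mul_degree (G.origin d)

theorem conj_bondScattering (d' d : E × Bool) :
    conj (G.bondScattering d' d) = G.bondScattering d' d := by
  simp only [bondScattering, Matrix.of_apply]
  split_ifs <;> simp [map_ofNat (starRingEnd ℂ) 2]

theorem bondScattering_mulVec_conj (p : E × Bool → ℂ) (d : E × Bool) :
    (G.bondScattering *ᵥ fun d => conj (p d)) d = conj ((G.bondScattering *ᵥ p) d) := by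
  simp [Matrix.mulVec, dotProduct, conj_bondScattering]

theorem phase_coe (t : ℝ) : phase (t : AddCircle (2 * π)) = Complex.exp (Complex.I * t) := by
  rw [phase, AddCircle.toCircle_apply_mk, Circle.coe_exp]
  congr 1
  have : (π : ℂ) ≠ 0 := by exact_mod_cast Real.pi_ne_zero
  push_cast
  field_simp

theorem phase_add (s t : AddCircle (2 * π)) : phase (s + t) = phase s * phase t := by
  simp [phase, AddCircle.toCircle_add]

theorem phase_zero : phase 0 = 1 := by
  simp [phase]

theorem phase_ne_zero (s : AddCircle (2 * π)) : phase s ≠ 0 := by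
  simp [phase]

theorem phase_neg_mul_phase (s : AddCircle (2 * π)) : phase (-s) * phase s = 1 := by
  rw [← phase_add, neg_add_cancel, phase_zero]

theorem phase_mul_phase_neg (s : AddCircle (2 * π)) : phase s * phase (-s) = 1 := by
  rw [← phase_add, add_neg_cancel, phase_zero]

theorem conj_phase (s : AddCircle (2 * π)) : conj (phase s) = phase (-s) := by
  rw [phase, phase, AddCircle.toCircle_neg, ← Circle.coe_inv_eq_conj]

theorem conj_phase_mul_phase (s : AddCircle (2 * π)) : conj (phase s) * phase s = 1 := by
  rw [conj_phase, phase_neg_mul_phase]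

theorem phase_injective : Function.Injective phase := by
  intro s t h
  have : Fact ((2 * π) ≠ 0) := ⟨by positivity⟩
  exact AddCircle.injective_toCircle (by positivity) (Subtype.ext h)

/-- The unitary evolution of amplitudes. -/
theorem evolution_apply (x : Torus E) (p : E × Bool → ℂ) (d : E × Bool) :
    ((torusPhase x * G.bondScattering) *ᵥ p) d =
      phase (x d.1) * (G.bondScattering *ᵥ p) d := by
  rw [← Matrix.mulVec_mulVec, torusPhase, Matrix.mulVec_diagonal]

theorem evolution_eq_iff (x : Torus E) (p : E × Bool → ℂ) (d : E × Bool) (z : ℂ) :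
    ((torusPhase x * G.bondScattering) *ᵥ p) d = z ↔
      (G.bondScattering *ᵥ p) d = phase (-(x d.1)) * z := by
  rw [evolution_apply]
  constructor
  · rintro rfl
    rw [← mul_assoc, phase_neg_mul_phase, one_mul]
  · intro h
    rw [h, ← mul_assoc, phase_mul_phase_neg, one_mul]

/-- Time reversal of amplitudes. -/
def timeRev (x : Torus E) (p : E × Bool → ℂ) (d : E × Bool) : ℂ :=
  phase (x d.1) * conj (p (rev d))

/-- Combines the reality of S with the involution property. In particular time reversal maps the
fixed space of the evolution to itself. -/
theorem evolution_timeRev (hD : ∀ v ∈ G.dirichlet, G.degree v = 1) (x : Torus E)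
    (p : E × Bool → ℂ) :
    (torusPhase x * G.bondScattering) *ᵥ
      (timeRev x ((torusPhase x * G.bondScattering) *ᵥ p)) = timeRev x p := by
  have h : timeRev x ((torusPhase x * G.bondScattering) *ᵥ p) =
      fun d => conj ((G.bondScattering *ᵥ p) (rev d)) := by
    funext d
    rw [timeRev, evolution_apply, map_mul, rev_fst, ← mul_assoc, mul_comm (phase _),
      conj_phase_mul_phase, one_mul]
  funext d
  rw [h, evolution_apply, bondScattering_mulVec_conj (fun d => (G.bondScattering *ᵥ p) (rev d)),
    bondScattering_mulVec_rev hD, timeRev]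

/-- The sesquilinear form is preserved by the evolution. -/
theorem star_evolution_dotProduct (hD : ∀ v ∈ G.dirichlet, G.degree v = 1) (x : Torus E)
    (p q : E × Bool → ℂ) :
    star ((torusPhase x * G.bondScattering) *ᵥ p) ⬝ᵥ ((torusPhase x * G.bondScattering) *ᵥ q) =
      star p ⬝ᵥ q := by
  have h := sum_conj_mul_bondScattering_mem hD p q Finset.univ
  simp only [Finset.mem_univ, if_true] at h
  simp only [dotProduct, Pi.star_apply, evolution_apply, star_mul']
  refine Eq.trans (Finset.sum_congr rfl fun d _ => ?_) h
  have := conj_phase_mul_phase (x d.1)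
  simp only [RCLike.star_def]
  linear_combination (conj ((G.bondScattering *ᵥ p) d) * (G.bondScattering *ᵥ q) d) * this

end Scattering

end MetricGraph

end

noncomputable section

/-! ### A unitary matrix with simple eigenvalue one -/

section SimpleKernel

open Matrix ComplexConjugate

variable {n : Type*} [Fintype n] [DecidableEq n]

/-- A nonzero cofactor at coordinate i means that a kernel vector is determined by its i-th
coordinate: if that coordinate vanishes, the matrix with a row replaced by a coordinate row still
kills the vector. -/
theorem Matrix.exists_smul_of_adjugate_ne_zero {K : Type*} [Field K] {D : Matrix n n K}
    (hD : D.adjugate ≠ 0) {a u : n → K} (ha : a ≠ 0) (hDa : D *ᵥ a = 0) (hDu : D *ᵥ u = 0) :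
    ∃ r : K, u = r • a := by
  obtain ⟨i, j, hij⟩ : ∃ i j, D.adjugate i j ≠ 0 := by
    by_contra! h
    exact hD (Matrix.ext h)
  rw [Matrix.adjugate_apply] at hij
  have key : ∀ w : n → K, D *ᵥ w = 0 → w i = 0 → w = 0 := by
    intro w hw hwi
    by_contra hne
    refine hij (Matrix.exists_mulVec_eq_zero_iff.mp ⟨w, hne, ?_⟩)
    funext k
    by_cases hk : k = j
    · subst hk
      simp [Matrix.mulVec, Matrix.updateRow_self, hwi]
    · have := congrFun hw k
      simpa [Matrix.mulVec, Matrix.updateRow_ne hk] using this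
  have hai : a i ≠ 0 := fun h => ha (key a hDa h)
  refine ⟨u i / a i, ?_⟩
  have := key (u - (u i / a i) • a) (by rw [Matrix.mulVec_sub, Matrix.mulVec_smul, hDa, hDu]; simp)
    (by simp [hai])
  exact sub_eq_zero.mp this

variable {U : Matrix n n ℂ}

theorem Matrix.conjTranspose_mul_self_eq_one_of_dotProduct
    (hU : ∀ p q : n → ℂ, star (U *ᵥ p) ⬝ᵥ (U *ᵥ q) = star p ⬝ᵥ q) : Uᴴ * U = 1 := by
  ext i j
  have h := hU (Pi.single i 1) (Pi.single j 1)
  rw [Matrix.mulVec_single_one, Matrix.mulVec_single_one] at h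
  rw [Matrix.mul_apply, Matrix.one_apply]
  simp only [dotProduct, Pi.star_apply, Matrix.col_apply, Matrix.conjTranspose_apply] at h ⊢
  rw [h]
  simp [Pi.single_apply, eq_comm]

theorem Matrix.star_dotProduct_sub_mulVec
    (hU : ∀ p q : n → ℂ, star (U *ᵥ p) ⬝ᵥ (U *ᵥ q) = star p ⬝ᵥ q) {a : n → ℂ}
    (ha : U *ᵥ a = a) (b : n → ℂ) : star a ⬝ᵥ (b - U *ᵥ b) = 0 := by
  have h := hU a b
  rw [ha] at h
  rw [dotProduct_sub, h, sub_self]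

/-- Columns of the adjugate lie in the kernel of 1 − U and rows in the left kernel. By unitarity the
left kernel is the conjugate of the kernel, so both are spanned by a. -/
theorem Matrix.exists_adjugate_eq
    (hU : ∀ p q : n → ℂ, star (U *ᵥ p) ⬝ᵥ (U *ᵥ q) = star p ⬝ᵥ q) {a : n → ℂ} (ha0 : a ≠ 0)
    (ha : U *ᵥ a = a) (hs : ∀ u, U *ᵥ u = u → ∃ r : ℂ, u = r • a) :
    ∃ c : ℂ, c ≠ 0 ∧ ∀ i j, (1 - U).adjugate i j = c * a i * conj (a j) := by
  have hfix : ∀ u : n → ℂ, (1 - U) *ᵥ u = 0 ↔ U *ᵥ u = u := fun u => by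
    rw [Matrix.sub_mulVec, Matrix.one_mulVec, sub_eq_zero, eq_comm]
  have hdet : (1 - U).det = 0 :=
    Matrix.exists_mulVec_eq_zero_iff.mp ⟨a, ha0, (hfix a).mpr ha⟩
  obtain ⟨i₀, hi₀⟩ : ∃ i, a i ≠ 0 := by
    by_contra! h
    exact ha0 (funext h)
  have hcol : ∀ j, ∃ r : ℂ, ∀ i, (1 - U).adjugate i j = r * a i := by
    intro j
    have h1 : (1 - U) *ᵥ ((1 - U).adjugate.col j) = 0 := by
      have h2 : (1 - U) * (1 - U).adjugate = 0 := by rw [Matrix.mul_adjugate, hdet, zero_smul]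
      funext k
      have h3 := congrFun (congrFun h2 k) j
      simpa [Matrix.mul_apply, Matrix.mulVec, dotProduct] using h3
    obtain ⟨r, hr⟩ := hs _ ((hfix _).mp h1)
    exact ⟨r, fun i => by simpa using congrFun hr i⟩
  choose r hr using hcol
  have hUU := Matrix.conjTranspose_mul_self_eq_one_of_dotProduct hU
  have hUU' : U * Uᴴ = 1 := mul_eq_one_comm.mp hUU
  have hrU : r ᵥ* U = r := by
    have h2 : (1 - U).adjugate * (1 - U) = 0 := by rw [Matrix.adjugate_mul, hdet, zero_smul]
    have h4 : r ᵥ* (1 - U) = 0 := by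
      funext k
      have h3 := congrFun (congrFun h2 i₀) k
      rw [Matrix.mul_apply] at h3
      simp only [hr] at h3
      have h5 : a i₀ * ∑ j, r j * (1 - U) j k = 0 := by
        rw [Finset.mul_sum, ← Matrix.zero_apply (α := ℂ) i₀ k, ← h3]
        exact Finset.sum_congr rfl fun j _ => by ring
      simpa [Matrix.vecMul, dotProduct, hi₀] using h5
    rw [Matrix.vecMul_sub, Matrix.vecMul_one, sub_eq_zero] at h4
    exact h4.symm
  have hsr : U *ᵥ star r = star r := by
    have h1 : Uᴴ *ᵥ star r = star r := by
      rw [← Matrix.star_vecMul, hrU]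
    calc U *ᵥ star r = U *ᵥ (Uᴴ *ᵥ star r) := by rw [h1]
      _ = star r := by rw [Matrix.mulVec_mulVec, hUU', Matrix.one_mulVec]
  obtain ⟨s, hs'⟩ := hs _ hsr
  have hr' : ∀ j, r j = conj s * conj (a j) := fun j => by
    have h := congrArg conj (congrFun hs' j)
    simpa using h
  refine ⟨conj s, ?_, fun i j => by rw [hr, hr']; ring⟩
  -- If c = 0, a principal cofactor with a i₀ ≠ 0 vanishes. This yields a nonzero u with u i₀ = 0
  -- and (1 − U)u supported at i₀. The range of 1 − U is orthogonal to a, so (1 − U)u = 0, and u is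
  -- a multiple of a with vanishing i₀-th coordinate.
  intro hs0
  have hadj : (1 - U).adjugate i₀ i₀ = 0 := by rw [hr, hr', hs0]; simp
  rw [Matrix.adjugate_apply] at hadj
  obtain ⟨u, hu0, hu⟩ := Matrix.exists_mulVec_eq_zero_iff.mpr hadj
  have hrow : ∀ k, k ≠ i₀ → ((1 - U) *ᵥ u) k = 0 := fun k hk => by
    have := congrFun hu k
    simpa [Matrix.mulVec, Matrix.updateRow_ne hk] using this
  have hui : u i₀ = 0 := by
    have := congrFun hu i₀
    simpa [Matrix.mulVec, Matrix.updateRow_self] using this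
  have horth := Matrix.star_dotProduct_sub_mulVec hU ha u
  have heq : u - U *ᵥ u = (1 - U) *ᵥ u := by rw [Matrix.sub_mulVec, Matrix.one_mulVec]
  rw [heq, dotProduct, Finset.sum_eq_single i₀ (fun k _ hk => by rw [hrow k hk, mul_zero])
    (by simp)] at horth
  have hrow0 : ((1 - U) *ᵥ u) i₀ = 0 := by
    rcases mul_eq_zero.mp horth with h | h
    · exact absurd (by simpa using h) hi₀
    · exact h
  have hu1 : (1 - U) *ᵥ u = 0 := by
    funext k
    by_cases hk : k = i₀
    · rw [hk, hrow0]; rfl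
    · rw [hrow k hk]; rfl
  obtain ⟨t, ht⟩ := hs u ((hfix u).mp hu1)
  have ht0 : t = 0 := by
    have := congrFun ht i₀
    rw [hui] at this
    simpa [hi₀] using this.symm
  exact hu0 (by rw [ht, ht0, zero_smul])

/-- Fredholm alternative: adding the rank one map b ↦ ⟨a, b⟩a to 1 − U makes it injective, hence
surjective, and on targets orthogonal to a the added term vanishes. -/
theorem Matrix.exists_sub_mulVec_eq
    (hU : ∀ p q : n → ℂ, star (U *ᵥ p) ⬝ᵥ (U *ᵥ q) = star p ⬝ᵥ q) {a : n → ℂ} (ha0 : a ≠ 0)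
    (ha : U *ᵥ a = a) (hs : ∀ u, U *ᵥ u = u → ∃ r : ℂ, u = r • a) {w : n → ℂ}
    (hw : star a ⬝ᵥ w = 0) : ∃ b, b - U *ᵥ b = w := by
  have haa : star a ⬝ᵥ a ≠ 0 := by
    open ComplexOrder in rw [Ne, dotProduct_star_self_eq_zero]
    exact ha0
  let f : (n → ℂ) →ₗ[ℂ] (n → ℂ) := (1 - U).mulVecLin + (LinearMap.toSpanSingleton ℂ _ a).comp
    (dotProductBilin ℂ ℂ (star a))
  have hf : ∀ b, f b = (b - U *ᵥ b) + (star a ⬝ᵥ b) • a := fun b => by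
    simp [f]
  have hort : ∀ b, star a ⬝ᵥ f b = (star a ⬝ᵥ b) * (star a ⬝ᵥ a) := fun b => by
    rw [hf, dotProduct_add, Matrix.star_dotProduct_sub_mulVec hU ha, dotProduct_smul, zero_add,
      smul_eq_mul]
  have hinj : Function.Injective f := by
    rw [← LinearMap.ker_eq_bot, LinearMap.ker_eq_bot']
    intro b hb
    have h1 := hort b
    rw [hb, dotProduct_zero, eq_comm, mul_eq_zero, or_iff_left haa] at h1
    have h2 := hf b
    rw [hb, h1, zero_smul, add_zero, eq_comm, sub_eq_zero] at h2
    obtain ⟨r, hr⟩ := hs b h2.symm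
    rw [hr, dotProduct_smul, smul_eq_mul, mul_eq_zero, or_iff_left haa] at h1
    rw [hr, h1, zero_smul]
  obtain ⟨b, hb⟩ := LinearMap.injective_iff_surjective.mp hinj w
  refine ⟨b, ?_⟩
  have h1 := hort b
  rw [hb, hw, eq_comm, mul_eq_zero, or_iff_left haa] at h1
  have h2 := hf b
  rw [hb, h1, zero_smul, add_zero] at h2
  exact h2.symm

end SimpleKernel

end

noncomputable section

/-! ### Derivatives of a determinant near a matrix with simple kernel -/

section Calculus

open Matrix ComplexConjugate

variable {n : Type*} [Fintype n] [DecidableEq n]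

theorem ContDiff.matrix_det {F : Type*} [NormedAddCommGroup F] [NormedSpace ℝ F] {k : WithTop ℕ∞}
    {M : F → Matrix n n ℂ} (hM : ∀ i j, ContDiff ℝ k fun p => M p i j) :
    ContDiff ℝ k fun p => (M p).det := by
  simp only [Matrix.det_apply]
  refine ContDiff.sum fun σ _ => ?_
  exact (contDiff_prod fun i _ => hM _ _).const_smul _

theorem ContDiff.matrix_adjugate {F : Type*} [NormedAddCommGroup F] [NormedSpace ℝ F]
    {k : WithTop ℕ∞} {M : F → Matrix n n ℂ} (hM : ∀ i j, ContDiff ℝ k fun p => M p i j) (i j : n) :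
    ContDiff ℝ k fun p => (M p).adjugate i j := by
  simp only [Matrix.adjugate_apply]
  refine ContDiff.matrix_det fun a b => ?_
  by_cases h : a = j
  · subst h
    simpa [Matrix.updateRow_self] using contDiff_const
  · simpa [Matrix.updateRow_ne h] using hM a b

theorem Matrix.det_mul_apply_eq_sum {M : Matrix n n ℂ} (v : n → ℂ) (k : n) :
    M.det * v k = ∑ l, M.adjugate k l * (M *ᵥ v) l := by
  have h : M.adjugate *ᵥ (M *ᵥ v) = M.det • v := by
    rw [Matrix.mulVec_mulVec, Matrix.adjugate_mul, Matrix.smul_mulVec, Matrix.one_mulVec]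
  have := congrFun h k
  simpa [Matrix.mulVec, dotProduct] using this.symm

/-- Dividing `Matrix.det_mul_apply_eq_sum` by a nonzero entry of a writes the determinant through
M·a. As M·a vanishes at 0, the adjugate need not be differentiated. -/
theorem Matrix.hasDerivAt_det_of_mulVec_eq_zero {M : ℝ → Matrix n n ℂ}
    (hM : ∀ i j, ContDiff ℝ 1 fun t => M t i j) {a : n → ℂ} (ha : a ≠ 0) (hMa : M 0 *ᵥ a = 0)
    {c : ℂ} (hadj : ∀ i j, (M 0).adjugate i j = c * a i * conj (a j)) {w : n → ℂ}
    (hw : ∀ l, HasDerivAt (fun t => (M t *ᵥ a) l) (w l) 0) :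
    HasDerivAt (fun t => (M t).det) (c * (star a ⬝ᵥ w)) 0 := by
  obtain ⟨k, hk⟩ : ∃ i, a i ≠ 0 := by
    by_contra! h
    exact ha (funext h)
  have h1 : (fun t => (M t).det) = fun t => (∑ l, (M t).adjugate k l * (M t *ᵥ a) l) / a k := by
    funext t
    rw [← Matrix.det_mul_apply_eq_sum, mul_div_cancel_right₀ _ hk]
  rw [h1]
  have h2 : ∀ l, HasDerivAt (fun t => (M t).adjugate k l * (M t *ᵥ a) l)
      (c * a k * conj (a l) * w l) 0 := by
    intro l
    have h3 := ((ContDiff.matrix_adjugate hM k l).differentiable one_ne_zero 0).hasDerivAt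
    have h4 := h3.mul (hw l)
    rw [hMa, Pi.zero_apply, mul_zero, zero_add, hadj] at h4
    exact h4
  have h5 := (HasDerivAt.fun_sum (u := Finset.univ) fun l _ => h2 l).div_const (a k)
  refine h5.congr_deriv (Eq.symm ?_)
  rw [eq_div_iff hk, dotProduct, Finset.mul_sum, Finset.sum_mul]
  exact Finset.sum_congr rfl fun l _ => by simp; ring

/-- The mixed second derivative at the origin. -/
def mixedDeriv (g : ℝ → ℝ → ℂ) : ℂ := deriv (fun s => deriv (fun t => g s t) 0) 0

theorem ContDiff.differentiableAt_slice {g : ℝ → ℝ → ℂ}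
    (hg : ContDiff ℝ 2 fun p : ℝ × ℝ => g p.1 p.2) (s : ℝ) :
    DifferentiableAt ℝ (fun t => g s t) 0 :=
  ((hg.comp (contDiff_const.prodMk contDiff_id : ContDiff ℝ 2 fun t : ℝ => (s, t))).differentiable
    two_ne_zero) 0

theorem ContDiff.differentiableAt_slice_left {g : ℝ → ℝ → ℂ}
    (hg : ContDiff ℝ 2 fun p : ℝ × ℝ => g p.1 p.2) (t : ℝ) :
    DifferentiableAt ℝ (fun s => g s t) 0 :=
  ((hg.comp (contDiff_id.prodMk contDiff_const : ContDiff ℝ 2 fun s : ℝ => (s, t))).differentiable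
    two_ne_zero) 0

theorem ContDiff.differentiableAt_deriv_slice {g : ℝ → ℝ → ℂ}
    (hg : ContDiff ℝ 2 fun p : ℝ × ℝ => g p.1 p.2) :
    DifferentiableAt ℝ (fun s => deriv (fun t => g s t) 0) 0 := by
  have h1 : (fun s => deriv (fun t => g s t) 0) =
      fun s => fderiv ℝ (fun p : ℝ × ℝ => g p.1 p.2) (s, 0) (0, 1) := by
    funext s
    have h2 := (hg.differentiable two_ne_zero (s, 0)).hasFDerivAt
    have h3 : HasDerivAt (fun t : ℝ => ((s, t) : ℝ × ℝ)) (0, 1) 0 :=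
      (hasDerivAt_const (0 : ℝ) s).prodMk (hasDerivAt_id (0 : ℝ))
    exact (h2.comp_hasDerivAt (0 : ℝ) h3).deriv
  rw [h1]
  have h4 : ContDiff ℝ 1 (fderiv ℝ (fun p : ℝ × ℝ => g p.1 p.2)) :=
    hg.fderiv_right (by norm_num)
  have h5 : ContDiff ℝ 1 fun s : ℝ => fderiv ℝ (fun p : ℝ × ℝ => g p.1 p.2) (s, 0) (0, 1) :=
    (h4.comp (contDiff_id.prodMk contDiff_const)).clm_apply contDiff_const
  exact h5.differentiable one_ne_zero 0

/-- If h vanishes at the origin together with both first derivatives, only one Leibniz term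
survives. This removes the derivatives of the adjugate and of the test vector. -/
theorem mixedDeriv_mul {g h : ℝ → ℝ → ℂ} (hg : ContDiff ℝ 2 fun p : ℝ × ℝ => g p.1 p.2)
    (hh : ContDiff ℝ 2 fun p : ℝ × ℝ => h p.1 p.2) (h0 : h 0 0 = 0)
    (hs : deriv (fun s => h s 0) 0 = 0) (ht : deriv (fun t => h 0 t) 0 = 0) :
    mixedDeriv (fun s t => g s t * h s t) = g 0 0 * mixedDeriv h := by
  unfold mixedDeriv
  have h1 : (fun s => deriv (fun t => g s t * h s t) 0) =
      fun s => deriv (fun t => g s t) 0 * h s 0 + g s 0 * deriv (fun t => h s t) 0 := by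
    funext s
    exact deriv_fun_mul (hg.differentiableAt_slice s) (hh.differentiableAt_slice s)
  rw [h1, deriv_fun_add
    (hg.differentiableAt_deriv_slice.fun_mul (hh.differentiableAt_slice_left 0))
    ((hg.differentiableAt_slice_left 0).fun_mul hh.differentiableAt_deriv_slice),
    deriv_fun_mul hg.differentiableAt_deriv_slice (hh.differentiableAt_slice_left 0),
    deriv_fun_mul (hg.differentiableAt_slice_left 0) hh.differentiableAt_deriv_slice,
    h0, hs, ht]
  ring

theorem mixedDeriv_sum {ι : Type*} (s : Finset ι) {g : ι → ℝ → ℝ → ℂ}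
    (hg : ∀ i, ContDiff ℝ 2 fun p : ℝ × ℝ => g i p.1 p.2) :
    mixedDeriv (fun x t => ∑ i ∈ s, g i x t) = ∑ i ∈ s, mixedDeriv (g i) := by
  unfold mixedDeriv
  have h1 : (fun x => deriv (fun t => ∑ i ∈ s, g i x t) 0) =
      fun x => ∑ i ∈ s, deriv (fun t => g i x t) 0 := by
    funext x
    exact deriv_fun_sum fun i _ => (hg i).differentiableAt_slice x
  rw [h1]
  exact deriv_fun_sum fun i _ => (hg i).differentiableAt_deriv_slice

/-- One component of M·v for the corrected vector v = a + sb + tb'. The expressions b − iαa and b' −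
iβa are the values of the evolution on b and b' given by the response equations. -/
theorem mixedDeriv_exp_mul (α β a b b' : ℂ) :
    mixedDeriv (fun s t => (a + s * b + t * b') -
      Complex.exp (Complex.I * (s * α + t * β)) *
        (a + s * (b - Complex.I * α * a) + t * (b' - Complex.I * β * a))) =
      -(α * β * a) - Complex.I * α * b' - Complex.I * β * b := by
  have hof : ∀ x : ℝ, HasDerivAt (fun t : ℝ => (t : ℂ)) 1 x := fun x =>
    Complex.ofRealCLM.hasDerivAt
  have h1 : ∀ s : ℝ, deriv (fun t : ℝ => (a + s * b + t * b') -
      Complex.exp (Complex.I * (s * α + t * β)) *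
        (a + s * (b - Complex.I * α * a) + t * (b' - Complex.I * β * a))) 0 =
      b' - Complex.exp (Complex.I * (s * α)) * (Complex.I * β *
        (a + s * (b - Complex.I * α * a)) + (b' - Complex.I * β * a)) := by
    intro s
    have h2 : HasDerivAt (fun t : ℝ => Complex.exp (Complex.I * (s * α + t * β)))
        (Complex.exp (Complex.I * (s * α + (0 : ℝ) * β)) * (Complex.I * (1 * β))) 0 :=
      ((((hof 0).mul_const β).const_add (s * α)).const_mul Complex.I).cexp
    have h3 : HasDerivAt (fun t : ℝ => a + s * (b - Complex.I * α * a) +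
        t * (b' - Complex.I * β * a)) (1 * (b' - Complex.I * β * a)) 0 :=
      ((hof 0).mul_const _).const_add _
    have h4 : HasDerivAt (fun t : ℝ => a + s * b + t * b') (1 * b') 0 :=
      ((hof 0).mul_const _).const_add _
    refine (h4.fun_sub (h2.fun_mul h3)).deriv.trans ?_
    simp only [Complex.ofReal_zero, zero_mul, add_zero]
    ring
  unfold mixedDeriv
  rw [funext h1]
  have h2 : HasDerivAt (fun s : ℝ => Complex.exp (Complex.I * (s * α)))
      (Complex.exp (Complex.I * ((0 : ℝ) * α)) * (Complex.I * (1 * α))) 0 :=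
    (((hof 0).mul_const α).const_mul Complex.I).cexp
  have h3 : HasDerivAt (fun s : ℝ => Complex.I * β * (a + s * (b - Complex.I * α * a)) +
      (b' - Complex.I * β * a)) (Complex.I * β * (1 * (b - Complex.I * α * a))) 0 :=
    ((((hof 0).mul_const _).const_add _).const_mul _).add_const _
  refine ((h2.fun_mul h3).const_sub b').deriv.trans ?_
  simp only [Complex.ofReal_zero, zero_mul, mul_zero, Complex.exp_zero, add_zero]
  linear_combination (α * β * a) * Complex.I_mul_I

/-- The vector v depends on the parameters so that M·v vanishes to first order. Then second order
perturbation theory reduces to one pairing with a. -/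
theorem Matrix.mixedDeriv_det {M : ℝ → ℝ → Matrix n n ℂ}
    (hM : ∀ i j, ContDiff ℝ 2 fun p : ℝ × ℝ => M p.1 p.2 i j)
    {a : n → ℂ} (ha : a ≠ 0) {v : ℝ → ℝ → n → ℂ}
    (hv : ∀ i, ContDiff ℝ 2 fun p : ℝ × ℝ => v p.1 p.2 i) (hv0 : v 0 0 = a)
    {c : ℂ} (hadj : ∀ i j, (M 0 0).adjugate i j = c * a i * conj (a j))
    (hMv : M 0 0 *ᵥ a = 0) (hs : ∀ l, deriv (fun s => (M s 0 *ᵥ v s 0) l) 0 = 0)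
    (ht : ∀ l, deriv (fun t => (M 0 t *ᵥ v 0 t) l) 0 = 0)
    (hds : deriv (fun s => (M s 0).det) 0 = 0) (hdt : deriv (fun t => (M 0 t).det) 0 = 0) :
    mixedDeriv (fun s t => (M s t).det) =
      c * (star a ⬝ᵥ fun l => mixedDeriv fun s t => (M s t *ᵥ v s t) l) := by
  obtain ⟨k, hk⟩ : ∃ i, a i ≠ 0 := by
    by_contra! h
    exact ha (funext h)
  have hd : (M 0 0).det = 0 := Matrix.exists_mulVec_eq_zero_iff.mp ⟨a, ha, hMv⟩
  have hMvc : ∀ l, ContDiff ℝ 2 fun p : ℝ × ℝ => (M p.1 p.2 *ᵥ v p.1 p.2) l := fun l => by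
    simp only [Matrix.mulVec, dotProduct]
    exact ContDiff.sum fun i _ => (hM l i).mul (hv i)
  have h1 : mixedDeriv (fun s t => v s t k * (M s t).det) =
      mixedDeriv (fun s t => ∑ l, (M s t).adjugate k l * (M s t *ᵥ v s t) l) := by
    congr 1
    funext s t
    rw [← Matrix.det_mul_apply_eq_sum, mul_comm]
  rw [mixedDeriv_mul (hv k) (ContDiff.matrix_det hM) hd hds hdt, hv0,
    mixedDeriv_sum _ fun l => (ContDiff.matrix_adjugate hM k l).mul (hMvc l)] at h1
  have h2 : ∀ l, mixedDeriv (fun s t => (M s t).adjugate k l * (M s t *ᵥ v s t) l) =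
      c * a k * conj (a l) * mixedDeriv (fun s t => (M s t *ᵥ v s t) l) := fun l => by
    rw [mixedDeriv_mul (ContDiff.matrix_adjugate hM k l) (hMvc l) (by rw [hv0, hMv]; rfl) (hs l)
      (ht l), hadj]
  rw [Finset.sum_congr rfl fun l _ => h2 l] at h1
  refine mul_left_cancel₀ hk (h1.trans ?_)
  rw [dotProduct, Finset.mul_sum, Finset.mul_sum]
  exact Finset.sum_congr rfl fun l _ => by simp; ring

end Calculus

end

noncomputable section

namespace MetricGraph

variable {V E : Type*} [Fintype V] [Fintype E] [DecidableEq V] [DecidableEq E]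

/-! ### Gradient and flux Hessian of the secular function -/

section Spectral

open Matrix ComplexConjugate

variable {G : MetricGraph V E}

/-- `a` spans the eigenspace of the evolution for the eigenvalue one, and it is invariant under
time reversal. -/
structure IsRealSimple (G : MetricGraph V E) (x : Torus E) (a : E × Bool → ℂ) : Prop where
  ne_zero : a ≠ 0
  fixed : (torusPhase x * G.bondScattering) *ᵥ a = a
  simple : ∀ u, (torusPhase x * G.bondScattering) *ᵥ u = u → ∃ r : ℂ, u = r • a
  timeRev : timeRev x a = a

/-- The direction of an edge along a directed edge. -/
def fluxSign (j : E) (d : E × Bool) : ℂ := if d.1 = j then (if d.2 then 1 else -1) else 0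

theorem fluxSign_rev (j : E) (d : E × Bool) : fluxSign j (rev d) = -fluxSign j d := by
  obtain ⟨e, s⟩ := d
  by_cases h : e = j <;> cases s <;> simp [fluxSign, rev, h]

theorem conj_fluxSign (j : E) (d : E × Bool) : conj (fluxSign j d) = fluxSign j d := by
  unfold fluxSign
  split_ifs <;> simp

/-- The weight of an edge in an amplitude vector. -/
def edgeWeight (a : E × Bool → ℂ) (e : E) : ℝ :=
  Complex.normSq (a (e, true)) + Complex.normSq (a (e, false))

theorem edgeWeight_nonneg (a : E × Bool → ℂ) (e : E) : 0 ≤ edgeWeight a e :=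
  add_nonneg (Complex.normSq_nonneg _) (Complex.normSq_nonneg _)

theorem edgeWeight_eq_sum (a : E × Bool → ℂ) (e : E) :
    (edgeWeight a e : ℂ) = ∑ d : E × Bool, conj (a d) * (if d.1 = e then a d else 0) := by
  simp only [Fintype.sum_prod_type, Fintype.sum_bool, mul_ite, mul_zero]
  rw [Finset.sum_eq_single e (fun b _ hb => by simp [hb]) (by simp)]
  simp [edgeWeight, Complex.normSq_eq_conj_mul_self]

theorem edgeWeight_pos {a : E × Bool → ℂ} {d : E × Bool} (h : a d ≠ 0) :
    0 < edgeWeight a d.1 := by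
  obtain ⟨e, s⟩ := d
  cases s
  · exact add_pos_of_nonneg_of_pos (Complex.normSq_nonneg _) (Complex.normSq_pos.mpr h)
  · exact add_pos_of_pos_of_nonneg (Complex.normSq_pos.mpr h) (Complex.normSq_nonneg _)

theorem fluxPhase_zero : fluxPhase (0 : E → ℝ) = 1 := by
  simp [fluxPhase]

theorem secular_zero (x : Torus E) :
    G.secular x 0 = (1 - torusPhase x * G.bondScattering).det := by
  rw [secular, fluxPhase_zero, Matrix.one_mul]

theorem bondScattering_mulVec_of_fixed {x : Torus E} {a : E × Bool → ℂ}
    (ha : (torusPhase x * G.bondScattering) *ᵥ a = a) (d : E × Bool) :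
    (G.bondScattering *ᵥ a) d = phase (-(x d.1)) * a d :=
  (evolution_eq_iff x a d (a d)).mp (congrFun ha d)

theorem Torus.single_apply (e e' : E) (t : ℝ) :
    (Torus.single e t) e' = if e' = e then (t : AddCircle (2 * π)) else 0 := by
  simp [Torus.single]

theorem phase_add_single (x : Torus E) (e e' : E) (t : ℝ) :
    phase ((x + Torus.single e t) e') =
      phase (x e') * Complex.exp (Complex.I * (t * if e' = e then 1 else 0)) := by
  rw [PiLp.add_apply, phase_add, Torus.single_apply]
  split_ifs
  · rw [phase_coe, mul_one]
  · simp [phase_zero]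

theorem contDiff_ofReal_mul (z : ℂ) (k : WithTop ℕ∞) : ContDiff ℝ k fun t : ℝ => (t : ℂ) * z :=
  Complex.ofRealCLM.contDiff.mul contDiff_const

/-- Shifting x_e multiplies the components of Ua on both orientations of e by e^{it}, so the pairing
with a picks out the weight of e. The case c = 0 is allowed, and `exists_smul_of_mem_regularSet`
uses it. -/
theorem secularGrad_eq {x : Torus E} {a : E × Bool → ℂ} (ha0 : a ≠ 0)
    (ha : (torusPhase x * G.bondScattering) *ᵥ a = a) {c : ℂ}
    (hadj : ∀ i j, (1 - torusPhase x * G.bondScattering).adjugate i j = c * a i * conj (a j))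
    (e : E) : G.secularGrad x e = -(Complex.I * c) * edgeWeight a e := by
  have h0 : x + Torus.single e 0 = x := by
    ext e'
    simp [Torus.single_apply]
  have h := Matrix.hasDerivAt_det_of_mulVec_eq_zero
    (M := fun t : ℝ => 1 - torusPhase (x + Torus.single e t) * G.bondScattering)
    (a := a) (c := c) (w := fun l => -Complex.I * (if l.1 = e then a l else 0))
    ?_ ha0 ?_ ?_ ?_
  · unfold secularGrad
    simp only [secular_zero]
    rw [h.deriv, edgeWeight_eq_sum, dotProduct, Finset.mul_sum, Finset.mul_sum]
    exact Finset.sum_congr rfl fun d _ => by simp only [Pi.star_apply, RCLike.star_def]; ring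
  · intro i j
    simp only [Matrix.sub_apply, torusPhase, Matrix.diagonal_mul, phase_add_single]
    exact contDiff_const.sub ((contDiff_const.mul
      (contDiff_const.mul (contDiff_ofReal_mul _ _)).cexp).mul contDiff_const)
  · rw [h0, Matrix.sub_mulVec, ha, Matrix.one_mulVec, sub_self]
  · rwa [h0]
  · intro l
    have h1 : (fun t : ℝ => ((1 - torusPhase (x + Torus.single e t) * G.bondScattering) *ᵥ a) l) =
        fun t : ℝ => a l - Complex.exp (Complex.I * (t * if l.1 = e then 1 else 0)) * a l := by
      funext t
      rw [Matrix.sub_mulVec, Pi.sub_apply, Matrix.one_mulVec, evolution_apply, phase_add_single,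
        bondScattering_mulVec_of_fixed ha]
      linear_combination -(Complex.exp (Complex.I * (t * if l.1 = e then 1 else 0)) * a l) *
        phase_mul_phase_neg (x l.1)
    rw [h1]
    have h2 : HasDerivAt (fun t : ℝ => (t : ℂ)) 1 0 := Complex.ofRealCLM.hasDerivAt
    have h3 := ((((h2.mul_const (if l.1 = e then 1 else 0)).const_mul
      Complex.I).cexp).mul_const (a l)).const_sub (a l)
    refine h3.congr_deriv ?_
    split_ifs <;> simp

theorem IsRealSimple.exists_adjugate (hD : ∀ v ∈ G.dirichlet, G.degree v = 1) {x : Torus E}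
    {a : E × Bool → ℂ} (h : G.IsRealSimple x a) :
    ∃ c : ℂ, c ≠ 0 ∧ ∀ i j,
      (1 - torusPhase x * G.bondScattering).adjugate i j = c * a i * conj (a j) :=
  Matrix.exists_adjugate_eq (star_evolution_dotProduct hD x) h.ne_zero h.fixed h.simple

theorem exists_ne_zero {a : E × Bool → ℂ} (ha : a ≠ 0) : ∃ d, a d ≠ 0 := by
  by_contra! h
  exact ha (funext h)

theorem IsRealSimple.mem_regularSet (hD : ∀ v ∈ G.dirichlet, G.degree v = 1) {x : Torus E}
    {a : E × Bool → ℂ} (h : G.IsRealSimple x a) : x ∈ G.regularSet := by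
  obtain ⟨c, hc, hadj⟩ := h.exists_adjugate hD
  obtain ⟨d, hd⟩ := exists_ne_zero h.ne_zero
  refine ⟨?_, d.1, ?_⟩
  · change G.secular x 0 = 0
    rw [secular_zero]
    refine Matrix.exists_mulVec_eq_zero_iff.mp ⟨a, h.ne_zero, ?_⟩
    rw [Matrix.sub_mulVec, h.fixed, Matrix.one_mulVec, sub_self]
  · rw [secularGrad_eq h.ne_zero h.fixed hadj]
    have := (edgeWeight_pos hd).ne'
    simp [hc, this]

/-- Simplicity at regular points: if the adjugate vanished, the gradient formula would hold with c =
0 and the gradient would be zero. -/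
theorem exists_smul_of_mem_regularSet {x : Torus E} (hx : x ∈ G.regularSet) {a : E × Bool → ℂ}
    (ha : G.IsCanonical x a) (u : E × Bool → ℂ)
    (hu : (torusPhase x * G.bondScattering) *ᵥ u = u) : ∃ r : ℂ, u = r • a := by
  obtain ⟨ha0, ha1⟩ := ha
  refine Matrix.exists_smul_of_adjugate_ne_zero
    (D := 1 - torusPhase x * G.bondScattering) ?_ ha0 ?_ ?_
  · intro h
    obtain ⟨e, he⟩ := hx.2
    exact he (by rw [secularGrad_eq ha0 ha1 (c := 0) (by simp [h])]; simp)
  · rw [Matrix.sub_mulVec, ha1, Matrix.one_mulVec, sub_self]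
  · rw [Matrix.sub_mulVec, hu, Matrix.one_mulVec, sub_self]

theorem timeRev_smul (x : Torus E) (r : ℂ) (a : E × Bool → ℂ) :
    MetricGraph.timeRev x (r • a) = conj r • MetricGraph.timeRev x a := by
  funext d
  simp only [MetricGraph.timeRev, Pi.smul_apply, smul_eq_mul, map_mul]
  ring

theorem timeRev_timeRev (x : Torus E) (a : E × Bool → ℂ) :
    MetricGraph.timeRev x (MetricGraph.timeRev x a) = a := by
  funext d
  simp only [MetricGraph.timeRev, map_mul, conj_phase, rev_fst, rev_rev, Complex.conj_conj]
  rw [← mul_assoc, phase_mul_phase_neg, one_mul]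

theorem isCanonical_smul {x : Torus E} {a : E × Bool → ℂ} (ha : G.IsCanonical x a) {r : ℂ}
    (hr : r ≠ 0) : G.IsCanonical x (r • a) :=
  ⟨smul_ne_zero hr ha.1, by rw [Matrix.mulVec_smul, ha.2]⟩

theorem IsRealSimple.isCanonical {x : Torus E} {a : E × Bool → ℂ} (h : G.IsRealSimple x a) :
    G.IsCanonical x a := ⟨h.ne_zero, h.fixed⟩

/-- The eigenvector at a regular point can be rotated to be invariant under time reversal. -/
theorem exists_isRealSimple (hD : ∀ v ∈ G.dirichlet, G.degree v = 1) {x : Torus E}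
    (hx : x ∈ G.regularSet) {a : E × Bool → ℂ} (ha : G.IsCanonical x a) :
    ∃ r : ℂ, r ≠ 0 ∧ G.IsRealSimple x (r • a) := by
  have h1 : (torusPhase x * G.bondScattering) *ᵥ MetricGraph.timeRev x a =
      MetricGraph.timeRev x a := by
    have := evolution_timeRev hD x a
    rwa [ha.2] at this
  obtain ⟨μ, hμ⟩ := exists_smul_of_mem_regularSet hx ha _ h1
  obtain ⟨r, hr, hr'⟩ : ∃ r : ℂ, r ≠ 0 ∧ conj r * μ = r := by
    have h2 : conj μ * μ = 1 := by
      have h3 := congrArg (MetricGraph.timeRev x) hμ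
      rw [timeRev_timeRev, timeRev_smul, hμ, smul_smul] at h3
      obtain ⟨d, hd⟩ := exists_ne_zero ha.1
      have h4 := congrFun h3 d
      rw [Pi.smul_apply, smul_eq_mul] at h4
      exact mul_right_cancel₀ hd (by rw [← h4, one_mul])
    -- Time reversal multiplies a by a unit μ. The factor r must satisfy conj(r)·μ = r, which 1 + μ
    -- does unless it is zero; in that case r = i works.
    by_cases h3 : μ = -1
    · exact ⟨Complex.I, Complex.I_ne_zero, by simp [h3]⟩
    · refine ⟨1 + μ, fun h => h3 (by linear_combination h), ?_⟩
      rw [map_add, map_one]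
      linear_combination h2
  have hc := isCanonical_smul ha hr
  exact ⟨r, hr, hc.1, hc.2, exists_smul_of_mem_regularSet hx hc, by
    rw [timeRev_smul, hμ, smul_smul, hr']⟩

theorem IsRealSimple.apply_eq {x : Torus E} {a : E × Bool → ℂ} (h : G.IsRealSimple x a)
    (d : E × Bool) : a d = phase (x d.1) * conj (a (rev d)) :=
  (congrFun h.timeRev d).symm

theorem IsRealSimple.conj_mul_self {x : Torus E} {a : E × Bool → ℂ} (h : G.IsRealSimple x a)
    (d : E × Bool) : conj (a (rev d)) * a (rev d) = conj (a d) * a d := by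
  rw [h.apply_eq d, map_mul, conj_phase, Complex.conj_conj]
  linear_combination -(a (rev d) * conj (a (rev d))) * phase_neg_mul_phase (x d.1)

/-- Time reversal makes the moduli on the two orientations equal, while the flux sign is odd under
reversal. This zero current gives both the solvability of the response equation and the vanishing of
the first flux derivative. -/
theorem IsRealSimple.sum_fluxSign {x : Torus E} {a : E × Bool → ℂ} (h : G.IsRealSimple x a)
    (j : E) : (∑ d, conj (a d) * (fluxSign j d * a d)) = 0 := by
  have h1 := sum_rev (fun d => conj (a d) * (fluxSign j d * a d))
  have h2 : ∀ d, conj (a (rev d)) * (fluxSign j (rev d) * a (rev d)) =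
      -(conj (a d) * (fluxSign j d * a d)) := fun d => by
    rw [fluxSign_rev]
    linear_combination -fluxSign j d * h.conj_mul_self d
  simp only [h2, Finset.sum_neg_distrib] at h1
  exact self_eq_neg.mp h1.symm

/-- The first order response of the amplitudes to the flux on the edge `j`. -/
def IsResponse (G : MetricGraph V E) (x : Torus E) (a : E × Bool → ℂ) (j : E)
    (b : E × Bool → ℂ) : Prop :=
  ∀ d, b d - ((torusPhase x * G.bondScattering) *ᵥ b) d = Complex.I * fluxSign j d * a d

theorem IsRealSimple.exists_isResponse (hD : ∀ v ∈ G.dirichlet, G.degree v = 1) {x : Torus E}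
    {a : E × Bool → ℂ} (h : G.IsRealSimple x a) (j : E) : ∃ b, G.IsResponse x a j b := by
  obtain ⟨b, hb⟩ := Matrix.exists_sub_mulVec_eq (star_evolution_dotProduct hD x) h.ne_zero h.fixed
    h.simple (w := fun d => Complex.I * fluxSign j d * a d) (by
      have := h.sum_fluxSign j
      have h2 := congrArg (Complex.I * ·) this
      simp only [mul_zero, Finset.mul_sum] at h2
      rw [← h2, dotProduct]
      exact Finset.sum_congr rfl fun d _ => by simp only [Pi.star_apply, RCLike.star_def]; ring)
  exact ⟨b, fun d => congrFun hb d⟩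

/-- The second order response of the secular function to fluxes on the edges `i` and `j`. -/
def fluxForm (a : E × Bool → ℂ) (i j : E) (b b' : E × Bool → ℂ) : ℂ :=
  ∑ d, conj (a d) * (-(fluxSign i d * fluxSign j d * a d) - Complex.I * fluxSign i d * b' d -
    Complex.I * fluxSign j d * b d)

theorem fluxPhase_single_add_apply (i j : E) (s t : ℝ) (d : E × Bool) :
    Complex.exp (Complex.I * (if d.2 then
      (((Pi.single i s + Pi.single j t : E → ℝ) d.1 : ℝ) : ℂ) else
        -(((Pi.single i s + Pi.single j t : E → ℝ) d.1 : ℝ) : ℂ))) =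
      Complex.exp (Complex.I * (s * fluxSign i d + t * fluxSign j d)) := by
  congr 2
  obtain ⟨e, σ⟩ := d
  have hs : ∀ (k : E) (r : ℝ), ((Pi.single k r : E → ℝ) e : ℂ) = r * if e = k then 1 else 0 := by
    intro k r
    rw [Pi.single_apply]
    split_ifs <;> simp
  simp only [Pi.add_apply, Complex.ofReal_add, hs, fluxSign]
  cases σ
  · simp only [Bool.false_eq_true, if_false]
    split_ifs <;> ring
  · simp

theorem deriv_sub_exp_mul (α a₀ β : ℂ) : deriv (fun t : ℝ => a₀ + t * β -
    Complex.exp (Complex.I * (t * α)) * (a₀ + t * (β - Complex.I * α * a₀))) 0 = 0 := by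
  have hof : HasDerivAt (fun t : ℝ => (t : ℂ)) 1 0 := Complex.ofRealCLM.hasDerivAt
  have h1 : HasDerivAt (fun t : ℝ => a₀ + t * β) (1 * β) 0 := (hof.mul_const β).const_add a₀
  have h2 : HasDerivAt (fun t : ℝ => a₀ + t * (β - Complex.I * α * a₀))
      (1 * (β - Complex.I * α * a₀)) 0 := (hof.mul_const _).const_add a₀
  have h3 : HasDerivAt (fun t : ℝ => Complex.exp (Complex.I * (t * α)))
      (Complex.exp (Complex.I * ((0 : ℝ) * α)) * (Complex.I * (1 * α))) 0 :=
    ((hof.mul_const α).const_mul Complex.I).cexp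
  refine (h1.fun_sub (h3.fun_mul h2)).deriv.trans ?_
  simp

/-- First order perturbations by fluxes do not change the secular function. -/
theorem IsRealSimple.deriv_det_eq_zero {x : Torus E} {a : E × Bool → ℂ} (h : G.IsRealSimple x a)
    {c : ℂ}
    (hadj : ∀ i j, (1 - torusPhase x * G.bondScattering).adjugate i j = c * a i * conj (a j))
    (k : E) {M : ℝ → Matrix (E × Bool) (E × Bool) ℂ} (hM1 : ∀ p q, ContDiff ℝ 1 fun t => M t p q)
    (hM2 : M 0 = 1 - torusPhase x * G.bondScattering)
    (hM3 : ∀ t l, (M t *ᵥ a) l = a l - Complex.exp (Complex.I * (t * fluxSign k l)) * a l) :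
    deriv (fun t => (M t).det) 0 = 0 := by
  have hof : HasDerivAt (fun t : ℝ => (t : ℂ)) 1 0 := Complex.ofRealCLM.hasDerivAt
  have h1 := Matrix.hasDerivAt_det_of_mulVec_eq_zero hM1 h.ne_zero
    (by rw [hM2, Matrix.sub_mulVec, h.fixed, Matrix.one_mulVec, sub_self]) (c := c)
    (by rw [hM2]; exact hadj) (w := fun l => -(Complex.I * fluxSign k l * a l)) (fun l => by
      simp only [hM3]
      refine ((((hof.mul_const (fluxSign k l)).const_mul
        Complex.I).cexp).mul_const (a l)).const_sub (a l) |>.congr_deriv ?_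
      simp)
  rw [h1.deriv]
  have h2 := h.sum_fluxSign k
  have h3 : star a ⬝ᵥ (fun l => -(Complex.I * fluxSign k l * a l)) =
      -Complex.I * ∑ d, conj (a d) * (fluxSign k d * a d) := by
    rw [dotProduct, Finset.mul_sum]
    exact Finset.sum_congr rfl fun d _ => by simp only [Pi.star_apply, RCLike.star_def]; ring
  rw [h3, h2, mul_zero, mul_zero]

/-- The matrix whose determinant is the secular function with fluxes on two edges. -/
def fluxMatrix (G : MetricGraph V E) (x : Torus E) (i j : E) (s t : ℝ) :
    Matrix (E × Bool) (E × Bool) ℂ :=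
  1 - fluxPhase (Pi.single i s + Pi.single j t) * torusPhase x * G.bondScattering

theorem fluxMatrix_zero (x : Torus E) (i j : E) :
    G.fluxMatrix x i j 0 0 = 1 - torusPhase x * G.bondScattering := by
  rw [fluxMatrix, Pi.single_zero, Pi.single_zero, add_zero, fluxPhase_zero, Matrix.one_mul]

theorem fluxMatrix_mulVec (x : Torus E) (i j : E) (s t : ℝ) (v : E × Bool → ℂ) (l : E × Bool) :
    (G.fluxMatrix x i j s t *ᵥ v) l =
      v l - Complex.exp (Complex.I * (s * fluxSign i l + t * fluxSign j l)) *
        ((torusPhase x * G.bondScattering) *ᵥ v) l := by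
  rw [fluxMatrix, Matrix.sub_mulVec, Pi.sub_apply, Matrix.one_mulVec, Matrix.mul_assoc,
    ← Matrix.mulVec_mulVec, fluxPhase, Matrix.mulVec_diagonal, fluxPhase_single_add_apply]

theorem contDiff_fluxMatrix (x : Torus E) (i j : E) (k l : E × Bool) :
    ContDiff ℝ 2 fun p : ℝ × ℝ => G.fluxMatrix x i j p.1 p.2 k l := by
  have hofc : ContDiff ℝ 2 (fun t : ℝ => (t : ℂ)) := Complex.ofRealCLM.contDiff
  have h1 : ∀ p : ℝ × ℝ, G.fluxMatrix x i j p.1 p.2 k l =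
      (1 : Matrix (E × Bool) (E × Bool) ℂ) k l -
      Complex.exp (Complex.I * (p.1 * fluxSign i k + p.2 * fluxSign j k)) *
        (phase (x k.1) * G.bondScattering k l) := by
    intro p
    rw [fluxMatrix, Matrix.sub_apply, Matrix.mul_assoc, fluxPhase, Matrix.diagonal_mul, torusPhase,
      Matrix.diagonal_mul, fluxPhase_single_add_apply]
  simp only [h1]
  exact contDiff_const.sub ((contDiff_const.mul (((hofc.comp contDiff_fst).mul contDiff_const).add
    ((hofc.comp contDiff_snd).mul contDiff_const))).cexp.mul contDiff_const)

theorem contDiff_slice {k : WithTop ℕ∞} {g : ℝ → ℝ → ℂ}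
    (hg : ContDiff ℝ k fun p : ℝ × ℝ => g p.1 p.2) (s : ℝ) : ContDiff ℝ k fun t => g s t :=
  hg.comp (contDiff_const.prodMk contDiff_id : ContDiff ℝ k fun t : ℝ => (s, t))

theorem contDiff_slice_left {k : WithTop ℕ∞} {g : ℝ → ℝ → ℂ}
    (hg : ContDiff ℝ k fun p : ℝ × ℝ => g p.1 p.2) (t : ℝ) : ContDiff ℝ k fun s => g s t :=
  hg.comp (contDiff_id.prodMk contDiff_const : ContDiff ℝ k fun s : ℝ => (s, t))

/-- The test vector a + sb + tb' is corrected by the responses so that its image is of second order.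
The result does not depend on the choice of responses, which are only determined modulo a. -/
theorem fluxHessian_eq {x : Torus E} {a : E × Bool → ℂ} (h : G.IsRealSimple x a) {c : ℂ}
    (hadj : ∀ i j, (1 - torusPhase x * G.bondScattering).adjugate i j = c * a i * conj (a j))
    {i j : E} {b b' : E × Bool → ℂ} (hb : G.IsResponse x a i b) (hb' : G.IsResponse x a j b') :
    G.fluxHessian x i j = c * fluxForm a i j b b' := by
  have hofc : ContDiff ℝ 2 (fun t : ℝ => (t : ℂ)) := Complex.ofRealCLM.contDiff
  have hM0 := G.fluxMatrix_zero x i j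
  have hMv : ∀ (s t : ℝ) (l : E × Bool),
      (G.fluxMatrix x i j s t *ᵥ (fun d => a d + s * b d + t * b' d)) l =
      a l + s * b l + t * b' l - Complex.exp (Complex.I * (s * fluxSign i l + t * fluxSign j l)) *
      (a l + s * (b l - Complex.I * fluxSign i l * a l) +
        t * (b' l - Complex.I * fluxSign j l * a l)) := by
    intro s t l
    have h1 : (fun d => a d + s * b d + t * b' d) = a + (s : ℂ) • b + (t : ℂ) • b' := by
      funext d
      simp
    rw [fluxMatrix_mulVec, h1, Matrix.mulVec_add, Matrix.mulVec_add, Matrix.mulVec_smul,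
      Matrix.mulVec_smul, h.fixed]
    simp only [Pi.add_apply, Pi.smul_apply, smul_eq_mul]
    linear_combination Complex.exp (Complex.I * (s * fluxSign i l + t * fluxSign j l)) *
      ((s : ℂ) * hb l + (t : ℂ) * hb' l)
  have hs : ∀ l, deriv (fun s : ℝ =>
      (G.fluxMatrix x i j s 0 *ᵥ (fun d => a d + s * b d + (0 : ℝ) * b' d)) l) 0 = 0 := by
    intro l
    simp only [hMv]
    simpa using deriv_sub_exp_mul (fluxSign i l) (a l) (b l)
  have ht : ∀ l, deriv (fun t : ℝ =>
      (G.fluxMatrix x i j 0 t *ᵥ (fun d => a d + (0 : ℝ) * b d + t * b' d)) l) 0 = 0 := by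
    intro l
    simp only [hMv]
    simpa using deriv_sub_exp_mul (fluxSign j l) (a l) (b' l)
  have hc1 : ∀ p q, ContDiff ℝ 1 fun s : ℝ => G.fluxMatrix x i j s 0 p q := fun p q =>
    contDiff_slice_left (g := fun s t => G.fluxMatrix x i j s t p q)
      ((contDiff_fluxMatrix x i j p q).of_le one_le_two) 0
  have hc2 : ∀ p q, ContDiff ℝ 1 fun t : ℝ => G.fluxMatrix x i j 0 t p q := fun p q =>
    contDiff_slice (g := fun s t => G.fluxMatrix x i j s t p q)
      ((contDiff_fluxMatrix x i j p q).of_le one_le_two) 0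
  have hv : ∀ d, ContDiff ℝ 2 fun p : ℝ × ℝ => a d + p.1 * b d + p.2 * b' d := fun d =>
    (contDiff_const.add ((hofc.comp contDiff_fst).mul contDiff_const)).add
      ((hofc.comp contDiff_snd).mul contDiff_const)
  have hds : deriv (fun s => (G.fluxMatrix x i j s 0).det) 0 = 0 :=
    h.deriv_det_eq_zero hadj i hc1 hM0 (fun t l => by rw [fluxMatrix_mulVec, h.fixed]; simp)
  have hdt : deriv (fun t => (G.fluxMatrix x i j 0 t).det) 0 = 0 :=
    h.deriv_det_eq_zero hadj j hc2 hM0 (fun t l => by rw [fluxMatrix_mulVec, h.fixed]; simp)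
  have key := Matrix.mixedDeriv_det (M := G.fluxMatrix x i j) (contDiff_fluxMatrix x i j) h.ne_zero
    (v := fun s t d => a d + s * b d + t * b' d) hv (by funext d; simp)
    (by rw [hM0]; exact hadj)
    (by rw [hM0, Matrix.sub_mulVec, h.fixed, Matrix.one_mulVec, sub_self])
    hs ht hds hdt
  have h2 : G.fluxHessian x i j = mixedDeriv fun s t => (G.fluxMatrix x i j s t).det := rfl
  rw [h2, key]
  simp only [hMv, mixedDeriv_exp_mul]
  rfl

/-- The entries of the matrix whose Morse index is the local surplus. -/
theorem IsRealSimple.hessian_div_grad (hD : ∀ v ∈ G.dirichlet, G.degree v = 1) {x : Torus E}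
    {a : E × Bool → ℂ} (h : G.IsRealSimple x a) {i j : E} {b b' : E × Bool → ℂ}
    (hb : G.IsResponse x a i b) (hb' : G.IsResponse x a j b') :
    -G.fluxHessian x i j / ∑ e, G.secularGrad x e * (G.length e : ℂ) =
      -Complex.I * fluxForm a i j b b' / ((∑ e, edgeWeight a e * G.length e : ℝ) : ℂ) := by
  obtain ⟨c, hc, hadj⟩ := h.exists_adjugate hD
  have h1 : ∑ e, G.secularGrad x e * (G.length e : ℂ) =
      -(Complex.I * c) * ((∑ e, edgeWeight a e * G.length e : ℝ) : ℂ) := by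
    push_cast
    rw [Finset.mul_sum]
    exact Finset.sum_congr rfl fun e _ => by
      rw [secularGrad_eq h.ne_zero h.fixed hadj]; ring
  have hP : ((∑ e, edgeWeight a e * G.length e : ℝ) : ℂ) ≠ 0 := by
    obtain ⟨d, hd⟩ := exists_ne_zero h.ne_zero
    have : 0 < ∑ e, edgeWeight a e * G.length e :=
      Finset.sum_pos' (fun e _ => mul_nonneg (edgeWeight_nonneg a e) (G.length_pos e).le)
        ⟨d.1, Finset.mem_univ _, mul_pos (edgeWeight_pos hd) (G.length_pos _)⟩
    exact_mod_cast this.ne'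
  rw [h1, fluxHessian_eq h hadj hb hb']
  have hI := Complex.I_ne_zero
  rw [div_eq_div_iff (mul_ne_zero (neg_ne_zero.mpr (mul_ne_zero hI hc)) hP) hP]
  linear_combination -(c * fluxForm a i j b b' * ((∑ e, edgeWeight a e * G.length e : ℝ) : ℂ)) *
    Complex.I_mul_I

end Spectral

end MetricGraph

end

noncomputable section

namespace MetricGraph

variable {V E : Type*} [Fintype V] [Fintype E] [DecidableEq V] [DecidableEq E]

/-! ### Cut edges and conjugation of the amplitudes on one side -/

section Mirror

open Matrix ComplexConjugate

variable {G : MetricGraph V E}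

theorem bondScattering_mulVec_congr (hD : ∀ v ∈ G.dirichlet, G.degree v = 1)
    {p q : E × Bool → ℂ} {d : E × Bool} (h : ∀ d', G.terminus d' = G.origin d → p d' = q d') :
    (G.bondScattering *ᵥ p) d = (G.bondScattering *ᵥ q) d := by
  rw [bondScattering_mulVec hD, bondScattering_mulVec hD, h (rev d) (by simp)]
  congr 2
  refine Finset.sum_congr rfl fun d' _ => ?_
  split_ifs with h1
  · exact h d' h1
  · rfl

theorem bondScattering_mulVec_eq_zero (hD : ∀ v ∈ G.dirichlet, G.degree v = 1)
    {p : E × Bool → ℂ} {d : E × Bool} (h : ∀ d', G.terminus d' = G.origin d → p d' = 0) :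
    (G.bondScattering *ᵥ p) d = 0 := by
  rw [bondScattering_mulVec_congr hD (q := 0) h]
  simp

/-- `d` is the only directed edge which leaves the set of vertices `W`. -/
structure IsCutEdge (G : MetricGraph V E) (W : Finset V) (d : E × Bool) : Prop where
  origin_mem : G.origin d ∈ W
  terminus_notMem : G.terminus d ∉ W
  eq_of_leaves : ∀ d', G.origin d' ∈ W → G.terminus d' ∉ W → d' = d

theorem IsCutEdge.compl {W : Finset V} {d : E × Bool} (h : G.IsCutEdge W d) :
    G.IsCutEdge Wᶜ (rev d) where
  origin_mem := by simpa using h.terminus_notMem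
  terminus_notMem := by simpa using h.origin_mem
  eq_of_leaves d' h1 h2 := by
    rw [Finset.mem_compl] at h1
    rw [Finset.notMem_compl] at h2
    rw [eq_rev_iff]
    exact h.eq_of_leaves _ (by simpa using h2) (by simpa using h1)

theorem IsCutEdge.eq_of_enters {W : Finset V} {d : E × Bool} (h : G.IsCutEdge W d)
    {d' : E × Bool} (h1 : G.origin d' ∉ W) (h2 : G.terminus d' ∈ W) : d' = rev d :=
  h.compl.eq_of_leaves d' (by simpa using h1) (by simpa using h2)

/-- Conservation of the current through a cut edge. -/
theorem IsCutEdge.current (hD : ∀ v ∈ G.dirichlet, G.degree v = 1) {W : Finset V} {d : E × Bool}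
    (hd : G.IsCutEdge W d) {x x' : Torus E}
    (hx : ∀ d', G.origin d' ∈ W → G.terminus d' ∈ W → x d'.1 = x' d'.1) {p q : E × Bool → ℂ}
    (hp : ∀ d', G.origin d' ∈ W → (G.bondScattering *ᵥ p) d' = phase (-(x d'.1)) * p d')
    (hq : ∀ d', G.origin d' ∈ W → (G.bondScattering *ᵥ q) d' = phase (-(x' d'.1)) * q d') :
    conj (phase (-(x d.1)) * p d) * (phase (-(x' d.1)) * q d) = conj (p (rev d)) * q (rev d) := by
  have h := sum_conj_mul_bondScattering_mem hD p q W
  -- Both sides of the conservation law on W contain the same sum over edges inside W. What remains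
  -- is one outgoing and one incoming term, both on the cut edge.
  have h1 : ∀ d', (if G.origin d' ∈ W then
      conj ((G.bondScattering *ᵥ p) d') * (G.bondScattering *ᵥ q) d' else 0) =
      (if G.origin d' ∈ W ∧ G.terminus d' ∈ W then conj (p d') * q d' else 0) +
      if d' = d then conj (phase (-(x d.1)) * p d) * (phase (-(x' d.1)) * q d) else 0 := by
    intro d'
    by_cases ho : G.origin d' ∈ W
    · rw [if_pos ho, hp d' ho, hq d' ho]
      by_cases ht : G.terminus d' ∈ W
      · rw [if_pos ⟨ho, ht⟩, if_neg (fun h : d' = d => hd.terminus_notMem (h ▸ ht)), ← hx d' ho ht, map_mul]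
        linear_combination (conj (p d') * q d') * conj_phase_mul_phase (-(x d'.1))
      · rw [if_neg (fun h => ht h.2), hd.eq_of_leaves d' ho ht, if_pos rfl, zero_add]
    · rw [if_neg ho, if_neg (fun h => ho h.1), if_neg (fun h : d' = d => ho (h ▸ hd.origin_mem)), zero_add]
  have h2 : ∀ d', (if G.terminus d' ∈ W then conj (p d') * q d' else 0) =
      (if G.origin d' ∈ W ∧ G.terminus d' ∈ W then conj (p d') * q d' else 0) +
      if d' = rev d then conj (p (rev d)) * q (rev d) else 0 := by
    intro d'
    by_cases ht : G.terminus d' ∈ W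
    · rw [if_pos ht]
      by_cases ho : G.origin d' ∈ W
      · rw [if_pos ⟨ho, ht⟩, if_neg, add_zero]
        rintro rfl
        exact hd.terminus_notMem (by simpa using ho)
      · rw [if_neg (fun h => ho h.1), hd.eq_of_enters ho ht, if_pos rfl, zero_add]
    · rw [if_neg ht, if_neg (fun h => ht h.2), if_neg, zero_add]
      rintro rfl
      exact ht (by simpa using hd.origin_mem)
  rw [Finset.sum_congr rfl fun d' _ => h1 d', Finset.sum_congr rfl fun d' _ => h2 d',
    Finset.sum_add_distrib, Finset.sum_add_distrib, add_right_inj] at h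
  simpa using h

/-- The restriction of amplitudes to the directed edges which terminate in `W`. -/
def cutoff (G : MetricGraph V E) (W : Finset V) (w : E × Bool → ℂ) (d : E × Bool) : ℂ :=
  if G.terminus d ∈ W then w d else 0

/-- A solution on W that vanishes in both directions on the cut edge can be extended by zero, as
nothing enters or leaves W. -/
theorem IsCutEdge.evolution_cutoff (hD : ∀ v ∈ G.dirichlet, G.degree v = 1) {W : Finset V}
    {d : E × Bool} (hd : G.IsCutEdge W d) {x : Torus E} {w : E × Bool → ℂ}
    (hw : ∀ d', G.origin d' ∈ W → (G.bondScattering *ᵥ w) d' = phase (-(x d'.1)) * w d')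
    (h1 : w d = 0) (h2 : w (rev d) = 0) :
    (torusPhase x * G.bondScattering) *ᵥ G.cutoff W w = G.cutoff W w := by
  funext d'
  rw [evolution_eq_iff]
  by_cases ho : G.origin d' ∈ W
  · rw [bondScattering_mulVec_congr hD (q := w) (fun d'' h => by
      rw [cutoff, if_pos (h ▸ ho)]), hw d' ho, cutoff]
    split_ifs with ht
    · rfl
    · rw [hd.eq_of_leaves d' ho ht, h1]
  · rw [bondScattering_mulVec_eq_zero hD (fun d'' h => by rw [cutoff, if_neg (h ▸ ho)]), cutoff]
    split_ifs with ht
    · rw [hd.eq_of_enters ho ht, h2, mul_zero]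
    · rw [mul_zero]

/-- The truncated solution is a multiple of a by simplicity, and the factor is zero because a does
not vanish on the cut edge. Only the equations on W are used, so this applies to data that live at
different points of the torus on the two sides. -/
theorem IsCutEdge.eq_zero_of_terminus_mem (hD : ∀ v ∈ G.dirichlet, G.degree v = 1) {W : Finset V}
    {d : E × Bool} (hd : G.IsCutEdge W d) {x : Torus E} {a : E × Bool → ℂ}
    (ha : G.IsRealSimple x a) (had : a (rev d) ≠ 0) {w : E × Bool → ℂ}
    (hw : ∀ d', G.origin d' ∈ W → (G.bondScattering *ᵥ w) d' = phase (-(x d'.1)) * w d')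
    (h1 : w d = 0) (h2 : w (rev d) = 0) (d' : E × Bool) (hd' : G.terminus d' ∈ W) : w d' = 0 := by
  obtain ⟨s, hs⟩ := ha.simple _ (hd.evolution_cutoff hD hw h1 h2)
  have h3 := congrFun hs (rev d)
  have h4 : G.cutoff W w (rev d) = 0 := by
    rw [cutoff, if_pos (by simpa using hd.origin_mem), h2]
  rw [h4, Pi.smul_apply, smul_eq_mul, eq_comm, mul_eq_zero, or_iff_left had] at h3
  have h5 := congrFun hs d'
  rwa [cutoff, if_pos hd', h3, zero_smul] at h5

theorem IsRealSimple.phase_neg_mul {x : Torus E} {a : E × Bool → ℂ} (h : G.IsRealSimple x a)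
    (d : E × Bool) : phase (-(x d.1)) * a d = conj (a (rev d)) := by
  rw [h.apply_eq d, ← mul_assoc, phase_neg_mul_phase, one_mul]

theorem IsRealSimple.bondScattering_mulVec {x : Torus E} {a : E × Bool → ℂ}
    (h : G.IsRealSimple x a) (d : E × Bool) : (G.bondScattering *ᵥ a) d = conj (a (rev d)) := by
  rw [bondScattering_mulVec_of_fixed h.fixed, h.phase_neg_mul]

/-- On a cut edge all solutions on one of its sides are proportional. -/
theorem IsCutEdge.proportional (hD : ∀ v ∈ G.dirichlet, G.degree v = 1) {W : Finset V}
    {d : E × Bool} (hd : G.IsCutEdge W d) {x x' : Torus E}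
    (hx : ∀ d', G.origin d' ∈ W → G.terminus d' ∈ W → x d'.1 = x' d'.1) {a : E × Bool → ℂ}
    (ha : ∀ d', G.origin d' ∈ W → (G.bondScattering *ᵥ a) d' = phase (-(x d'.1)) * a d')
    (had : a (rev d) ≠ 0) (hc : phase (-(x d.1)) * a d = conj (a (rev d)))
    {u : E × Bool → ℂ}
    (hu : ∀ d', G.origin d' ∈ W → (G.bondScattering *ᵥ u) d' = phase (-(x' d'.1)) * u d') :
    phase (-(x' d.1)) * u d = u (rev d) / a (rev d) * (phase (-(x d.1)) * a d) := by
  have h := hd.current hD hx ha hu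
  rw [hc, Complex.conj_conj] at h
  rw [hc, div_mul_eq_mul_div, eq_div_iff had]
  linear_combination h

/-- Reflection of a point of the torus: the coordinates on the edges outside of `W` change sign,
and those on the edges which leave `W` are reflected with the phase of the amplitudes. -/
structure IsMirror (G : MetricGraph V E) (W : Finset V) (a : E × Bool → ℂ) (x x' : Torus E) :
    Prop where
  near : ∀ d, G.origin d ∈ W → G.terminus d ∈ W → x' d.1 = x d.1
  far : ∀ d, G.origin d ∉ W → G.terminus d ∉ W → x' d.1 = -x d.1
  cross : ∀ d, G.origin d ∈ W → G.terminus d ∉ W →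
    phase (x' d.1) * conj (a (rev d)) = phase (-(x d.1)) * a (rev d)

/-- Reflected amplitudes. -/
def mirrorVec (G : MetricGraph V E) (W : Finset V) (a : E × Bool → ℂ) (d : E × Bool) : ℂ :=
  if G.terminus d ∈ W then a d else conj (a d)

theorem mirrorVec_ne_zero_iff {W : Finset V} {a : E × Bool → ℂ} {d : E × Bool} :
    G.mirrorVec W a d ≠ 0 ↔ a d ≠ 0 := by
  unfold mirrorVec
  split_ifs <;> simp

theorem edgeWeight_mirrorVec (W : Finset V) (a : E × Bool → ℂ) (e : E) :
    edgeWeight (G.mirrorVec W a) e = edgeWeight a e := by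
  have h : ∀ d, Complex.normSq (G.mirrorVec W a d) = Complex.normSq (a d) := fun d => by
    unfold mirrorVec
    split_ifs <;> simp [Complex.normSq_conj]
  simp [edgeWeight, h]

/-- Scattering is local at vertices and real, so it commutes with conjugation of everything that
arrives at a given set of vertices. -/
theorem bondScattering_mirrorVec (hD : ∀ v ∈ G.dirichlet, G.degree v = 1) (W : Finset V)
    (a : E × Bool → ℂ) (d : E × Bool) :
    (G.bondScattering *ᵥ G.mirrorVec W a) d =
      if G.origin d ∈ W then (G.bondScattering *ᵥ a) d else conj ((G.bondScattering *ᵥ a) d) := by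
  split_ifs with ho
  · exact bondScattering_mulVec_congr hD fun d' h => by rw [mirrorVec, if_pos (h ▸ ho)]
  · rw [← bondScattering_mulVec_conj]
    exact bondScattering_mulVec_congr hD fun d' h => by rw [mirrorVec, if_neg (h ▸ ho)]

section

variable {W : Finset V} {x x' : Torus E} {a : E × Bool → ℂ}

/-- The one relation behind both the fixed point equation and the time reversal invariance of the
mirrored vector. The phase condition in `cross` is what it requires on the cut edge. -/
theorem IsMirror.apply_eq (hm : G.IsMirror W a x x') (ha : G.IsRealSimple x a) (d : E × Bool) :
    phase (-(x' d.1)) * G.mirrorVec W a d = conj (G.mirrorVec W a (rev d)) := by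
  simp only [mirrorVec, terminus_rev]
  have h1 := ha.phase_neg_mul d
  have h2 := ha.phase_neg_mul (rev d)
  rw [rev_fst, rev_rev] at h2
  have hp := phase_neg_mul_phase (x' d.1)
  by_cases ho : G.origin d ∈ W <;> by_cases ht : G.terminus d ∈ W
  · rw [if_pos ho, if_pos ht, hm.near d ho ht, h1]
  · rw [if_pos ho, if_neg ht]
    have h3 := hm.cross d ho ht
    linear_combination -phase (-(x' d.1)) * h2 - phase (-(x' d.1)) * h3 + conj (a (rev d)) * hp
  · rw [if_neg ho, if_pos ht, Complex.conj_conj]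
    have h3 := congrArg conj (hm.cross (rev d) (by simpa using ht) (by simpa using ho))
    simp only [rev_fst, rev_rev, map_mul, conj_phase, neg_neg, Complex.conj_conj] at h3
    have h4 := ha.apply_eq (rev d)
    rw [rev_rev, rev_fst] at h4
    rw [h3, h4]
  · rw [if_neg ho, if_neg ht, hm.far d ho ht, neg_neg, Complex.conj_conj]
    have h4 := ha.apply_eq (rev d)
    rw [rev_rev, rev_fst] at h4
    rw [← h4]

theorem IsMirror.fixed (hD : ∀ v ∈ G.dirichlet, G.degree v = 1) (hm : G.IsMirror W a x x')
    (ha : G.IsRealSimple x a) :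
    (torusPhase x' * G.bondScattering) *ᵥ G.mirrorVec W a = G.mirrorVec W a := by
  funext d
  rw [evolution_eq_iff, bondScattering_mirrorVec hD, hm.apply_eq ha, ha.bondScattering_mulVec,
    mirrorVec, terminus_rev]
  split_ifs <;> rfl

theorem IsMirror.timeRev_eq (hm : G.IsMirror W a x x') (ha : G.IsRealSimple x a) :
    timeRev x' (G.mirrorVec W a) = G.mirrorVec W a := by
  funext d
  rw [timeRev, ← hm.apply_eq ha, ← mul_assoc, phase_mul_phase_neg, one_mul]

theorem mirrorVec_ne_zero (ha : a ≠ 0) : G.mirrorVec W a ≠ 0 := by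
  obtain ⟨d, hd⟩ := exists_ne_zero ha
  exact fun h => (mirrorVec_ne_zero_iff.mpr hd) (congrFun h d)

/-- Simplicity is transferred side by side: after subtracting a multiple of the mirrored vector, a
solution vanishes on the cut edge. On W it then solves the equations at x, and its conjugate does so
off W; both parts vanish by simplicity at x. -/
theorem IsMirror.isRealSimple (hD : ∀ v ∈ G.dirichlet, G.degree v = 1)
    (hm : G.IsMirror W a x x') (ha : G.IsRealSimple x a) {d : E × Bool} (hd : G.IsCutEdge W d)
    (had : ∀ d, a d ≠ 0) : G.IsRealSimple x' (G.mirrorVec W a) := by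
  refine ⟨mirrorVec_ne_zero ha.ne_zero, hm.fixed hD ha, fun u hu => ?_, hm.timeRev_eq ha⟩
  have hfix := hm.fixed hD ha
  have h1 := hd.proportional hD (x := x') (x' := x') (fun _ _ _ => rfl)
    (fun d' _ => bondScattering_mulVec_of_fixed hfix d') (mirrorVec_ne_zero_iff.mpr (had _))
    (hm.apply_eq ha d) (fun d' _ => bondScattering_mulVec_of_fixed hu d')
  set r := u (rev d) / G.mirrorVec W a (rev d) with hr
  refine ⟨r, ?_⟩
  have hw : (torusPhase x' * G.bondScattering) *ᵥ (u - r • G.mirrorVec W a) =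
      u - r • G.mirrorVec W a := by
    rw [Matrix.mulVec_sub, Matrix.mulVec_smul, hu, hfix]
  have hw1 : (u - r • G.mirrorVec W a) d = 0 := by
    rw [Pi.sub_apply, Pi.smul_apply, smul_eq_mul, sub_eq_zero]
    exact mul_left_cancel₀ (phase_ne_zero (-(x' d.1))) (by rw [h1]; ring)
  have hw2 : (u - r • G.mirrorVec W a) (rev d) = 0 := by
    rw [Pi.sub_apply, Pi.smul_apply, smul_eq_mul, hr,
      div_mul_cancel₀ _ (mirrorVec_ne_zero_iff.mpr (had _)), sub_self]
  set w := u - r • G.mirrorVec W a with hwdef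
  have hrow := bondScattering_mulVec_of_fixed hw
  have hzero : w = 0 := by
    funext d'
    by_cases ht : G.terminus d' ∈ W
    · refine hd.eq_zero_of_terminus_mem hD ha (had _) (fun d'' ho => ?_) hw1 hw2 d' ht
      rw [hrow d'']
      by_cases ht' : G.terminus d'' ∈ W
      · rw [hm.near d'' ho ht']
      · rw [hd.eq_of_leaves d'' ho ht', hw1, mul_zero, mul_zero]
    · have := hd.compl.eq_zero_of_terminus_mem hD ha (by simpa using had _)
        (w := fun d => conj (w d)) (fun d'' ho => ?_) (by simp [hw2]) (by simp [hw1]) d'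
        (by simpa using ht)
      · simpa using this
      · rw [Finset.mem_compl] at ho
        rw [bondScattering_mulVec_conj, hrow d'', map_mul, conj_phase, neg_neg]
        by_cases ht' : G.terminus d'' ∈ W
        · rw [hd.eq_of_enters ho ht', hw2, map_zero, mul_zero, mul_zero]
        · rw [hm.far d'' ho ht']
  exact sub_eq_zero.mp hzero

theorem isMirror_neg (x : Torus E) (a : E × Bool → ℂ) : G.IsMirror ∅ a x (-x) where
  near d h := absurd h (by simp)
  far d _ _ := rfl
  cross d h := absurd h (by simp)

/-- With empty W no cut edge is needed, since conjugation is a bijection between the fixed spaces at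
x and −x. -/
theorem IsRealSimple.neg (hD : ∀ v ∈ G.dirichlet, G.degree v = 1) (ha : G.IsRealSimple x a) :
    G.IsRealSimple (-x) (G.mirrorVec ∅ a) := by
  have hm := G.isMirror_neg x a
  refine ⟨mirrorVec_ne_zero ha.ne_zero, hm.fixed hD ha, fun u hu => ?_, hm.timeRev_eq ha⟩
  obtain ⟨r, hr⟩ := ha.simple (fun d => conj (u d)) (by
    funext d
    rw [evolution_eq_iff, bondScattering_mulVec_conj, bondScattering_mulVec_of_fixed hu, map_mul,
      conj_phase, PiLp.neg_apply, neg_neg])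
  refine ⟨conj r, funext fun d => ?_⟩
  have := congrArg conj (congrFun hr d)
  simpa [mirrorVec] using this

/-- The amplitudes `b` are supported on the edges inside of `W`. -/
def SupportedIn (G : MetricGraph V E) (W : Finset V) (b : E × Bool → ℂ) : Prop :=
  ∀ d, ¬(G.origin d ∈ W ∧ G.terminus d ∈ W) → b d = 0

/-- The edge `e` has both of its ends in `W`. -/
def EdgeIn (G : MetricGraph V E) (W : Finset V) (e : E) : Prop :=
  ∀ d : E × Bool, d.1 = e → G.origin d ∈ W ∧ G.terminus d ∈ W

theorem fluxSign_eq_zero {j : E} (hj : G.EdgeIn W j) {d : E × Bool}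
    (h : ¬(G.origin d ∈ W ∧ G.terminus d ∈ W)) : fluxSign j d = 0 := by
  rw [fluxSign, if_neg]
  exact fun h' => h (hj d h')

theorem IsResponse.bondScattering_mulVec {j : E} {b : E × Bool → ℂ} (hb : G.IsResponse x a j b)
    (d : E × Bool) : (G.bondScattering *ᵥ b) d =
      phase (-(x d.1)) * (b d - Complex.I * fluxSign j d * a d) := by
  rw [← evolution_eq_iff]
  linear_combination -hb d

theorem isResponse_of_bondScattering_mulVec {j : E} {b : E × Bool → ℂ}
    (hb : ∀ d, (G.bondScattering *ᵥ b) d =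
      phase (-(x d.1)) * (b d - Complex.I * fluxSign j d * a d)) : G.IsResponse x a j b := by
  intro d
  rw [(evolution_eq_iff x b d _).mpr (hb d)]
  ring

/-- The response to a flux on one side of a cut edge is supported on this side. -/
theorem IsRealSimple.exists_isResponse_supportedIn (hD : ∀ v ∈ G.dirichlet, G.degree v = 1)
    (ha : G.IsRealSimple x a) {d : E × Bool} (hd : G.IsCutEdge W d) (had : ∀ d, a d ≠ 0) {j : E}
    (hj : G.EdgeIn W j) : ∃ b, G.IsResponse x a j b ∧ G.SupportedIn W b := by
  obtain ⟨b, hb⟩ := ha.exists_isResponse hD j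
  have hfar : ∀ d', G.origin d' ∈ Wᶜ →
      (G.bondScattering *ᵥ b) d' = phase (-(x d'.1)) * b d' := fun d' ho => by
    rw [hb.bondScattering_mulVec, fluxSign_eq_zero hj (fun h => Finset.mem_compl.mp ho h.1)]
    ring
  have hafar := fun d' (_ : G.origin d' ∈ Wᶜ) => bondScattering_mulVec_of_fixed ha.fixed d'
  have h1 := hd.compl.proportional hD (x := x) (x' := x) (fun _ _ _ => rfl) hafar (had _)
    (ha.phase_neg_mul _) hfar
  rw [rev_rev] at h1
  -- Off W the response solves the homogeneous equation, so on the cut edge it is proportional to a.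
  -- Subtracting this multiple of a keeps the response equation and clears the cut edge, after which
  -- simplicity clears the far side.
  set r := b d / a d with hr
  have hw1 : (b - r • a) (rev d) = 0 := by
    rw [Pi.sub_apply, Pi.smul_apply, smul_eq_mul, sub_eq_zero]
    exact mul_left_cancel₀ (phase_ne_zero (-(x (rev d).1))) (by rw [h1]; ring)
  have hw2 : (b - r • a) d = 0 := by
    rw [Pi.sub_apply, Pi.smul_apply, smul_eq_mul, hr, div_mul_cancel₀ _ (had _), sub_self]
  refine ⟨b - r • a, isResponse_of_bondScattering_mulVec fun d' => ?_, ?_⟩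
  · rw [Matrix.mulVec_sub, Matrix.mulVec_smul, Pi.sub_apply, Pi.smul_apply,
      hb.bondScattering_mulVec, bondScattering_mulVec_of_fixed ha.fixed]
    simp only [Pi.sub_apply, Pi.smul_apply, smul_eq_mul]
    ring
  · intro d' hd'
    by_cases ht : G.terminus d' ∈ W
    · rw [hd.eq_of_enters (fun ho => hd' ⟨ho, ht⟩) ht, hw1]
    · refine hd.compl.eq_zero_of_terminus_mem hD ha (by simpa using had _)
        (w := b - r • a) (fun d'' ho => ?_) hw1 (by simpa using hw2) d' (by simpa using ht)
      rw [Matrix.mulVec_sub, Matrix.mulVec_smul, Pi.sub_apply, Pi.smul_apply, hfar d'' ho,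
        hafar d'' ho]
      simp only [Pi.sub_apply, Pi.smul_apply, smul_eq_mul]
      ring

theorem IsMirror.isResponse_near (hD : ∀ v ∈ G.dirichlet, G.degree v = 1)
    (hm : G.IsMirror W a x x') {j : E} (hj : G.EdgeIn W j) {b : E × Bool → ℂ}
    (hb : G.IsResponse x a j b) (hbs : G.SupportedIn W b) :
    G.IsResponse x' (G.mirrorVec W a) j b := by
  refine isResponse_of_bondScattering_mulVec fun d => ?_
  by_cases h : G.origin d ∈ W ∧ G.terminus d ∈ W
  · rw [hb.bondScattering_mulVec, hm.near d h.1 h.2, mirrorVec, if_pos h.2]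
  · rw [hbs d h, fluxSign_eq_zero hj h]
    by_cases ho : G.origin d ∈ W
    · rw [hb.bondScattering_mulVec, hbs d h, fluxSign_eq_zero hj h]
      simp
    · rw [bondScattering_mulVec_eq_zero hD fun d' hd' => hbs d' fun h' => ho (hd' ▸ h'.2)]
      simp

/-- Conjugating the response equation inverts the phases as required but also turns i into −i; the
sign in −b compensates for this. -/
theorem IsMirror.isResponse_far (hD : ∀ v ∈ G.dirichlet, G.degree v = 1)
    (hm : G.IsMirror W a x x') {j : E} (hj : G.EdgeIn Wᶜ j) {b : E × Bool → ℂ}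
    (hb : G.IsResponse x a j b) (hbs : G.SupportedIn Wᶜ b) :
    G.IsResponse x' (G.mirrorVec W a) j (fun d => conj (-b d)) := by
  refine isResponse_of_bondScattering_mulVec fun d => ?_
  rw [bondScattering_mulVec_conj (fun d => -b d)]
  have hneg : (G.bondScattering *ᵥ fun d => -b d) d = -(G.bondScattering *ᵥ b) d := by
    have : (fun d => -b d) = -b := rfl
    rw [this, Matrix.mulVec_neg, Pi.neg_apply]
  rw [hneg]
  by_cases h : G.origin d ∈ Wᶜ ∧ G.terminus d ∈ Wᶜ
  · have h' := h
    simp only [Finset.mem_compl] at h'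
    rw [hb.bondScattering_mulVec, hm.far d h'.1 h'.2, mirrorVec, if_neg h'.2]
    simp only [map_neg, map_mul, map_sub, conj_phase, conj_fluxSign, Complex.conj_I, neg_neg]
    ring
  · rw [hbs d h, fluxSign_eq_zero hj h]
    by_cases ho : G.origin d ∈ Wᶜ
    · rw [hb.bondScattering_mulVec, hbs d h, fluxSign_eq_zero hj h]
      simp
    · rw [bondScattering_mulVec_eq_zero hD fun d' hd' => hbs d' fun h' => ho (hd' ▸ h'.2)]
      simp

theorem fluxForm_mirrorVec_near {i j : E} (hi : G.EdgeIn W i) (hj : G.EdgeIn W j)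
    (b b' : E × Bool → ℂ) : fluxForm (G.mirrorVec W a) i j b b' = fluxForm a i j b b' := by
  refine Finset.sum_congr rfl fun d _ => ?_
  by_cases h : G.origin d ∈ W ∧ G.terminus d ∈ W
  · rw [mirrorVec, if_pos h.2]
  · simp [fluxSign_eq_zero hi h, fluxSign_eq_zero hj h]

theorem fluxForm_mirrorVec_far {i j : E} (hi : G.EdgeIn Wᶜ i) (hj : G.EdgeIn Wᶜ j)
    (b b' : E × Bool → ℂ) :
    fluxForm (G.mirrorVec W a) i j (fun d => conj (-b d)) (fun d => conj (-b' d)) =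
      conj (fluxForm a i j b b') := by
  unfold fluxForm
  rw [map_sum]
  refine Finset.sum_congr rfl fun d _ => ?_
  by_cases h : G.origin d ∈ Wᶜ ∧ G.terminus d ∈ Wᶜ
  · rw [mirrorVec, if_neg (Finset.mem_compl.mp h.2)]
    simp only [map_neg, map_mul, map_sub, conj_fluxSign, Complex.conj_I, Complex.conj_conj]
    ring
  · simp [fluxSign_eq_zero hi h, fluxSign_eq_zero hj h]

theorem fluxForm_eq_zero {i j : E} (hi : G.EdgeIn W i) (hj : G.EdgeIn Wᶜ j)
    {b b' : E × Bool → ℂ} (hb : G.SupportedIn W b) (hb' : G.SupportedIn Wᶜ b') :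
    fluxForm a i j b b' = 0 := by
  refine Finset.sum_eq_zero fun d _ => ?_
  by_cases h : G.origin d ∈ W ∧ G.terminus d ∈ W
  · have h' : ¬(G.origin d ∈ Wᶜ ∧ G.terminus d ∈ Wᶜ) := fun h' => Finset.mem_compl.mp h'.1 h.1
    simp [fluxSign_eq_zero hj h', hb' d h']
  · simp [fluxSign_eq_zero hi h, hb d h]

theorem fluxForm_comm (i j : E) (b b' : E × Bool → ℂ) :
    fluxForm a i j b b' = fluxForm a j i b' b :=
  Finset.sum_congr rfl fun d _ => by ring

/-- Unitarity applied to the two responses relates the two mixed terms and the diagonal term. The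
form is thereby −2i times the real part of the change of current on edge i caused by the flux on j.
-/
theorem fluxForm_eq (hD : ∀ v ∈ G.dirichlet, G.degree v = 1) {i j : E} {b b' : E × Bool → ℂ}
    (hb : G.IsResponse x a i b) (hb' : G.IsResponse x a j b') :
    fluxForm a i j b b' =
      -Complex.I * ((2 * (∑ d, conj (a d) * (fluxSign i d * b' d)).re : ℝ) : ℂ) := by
  have h := star_evolution_dotProduct hD x b b'
  simp only [dotProduct, Pi.star_apply, RCLike.star_def] at h
  have h0 : ∀ d, conj (((torusPhase x * G.bondScattering) *ᵥ b) d) *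
      ((torusPhase x * G.bondScattering) *ᵥ b') d - conj (b d) * b' d =
      -Complex.I * conj (conj (a d) * (fluxSign j d * b d)) +
        Complex.I * (conj (a d) * (fluxSign i d * b' d)) +
        fluxSign i d * fluxSign j d * conj (a d) * a d := fun d => by
    have h1 : ((torusPhase x * G.bondScattering) *ᵥ b) d = b d - Complex.I * fluxSign i d * a d := by
      linear_combination -hb d
    have h2 : ((torusPhase x * G.bondScattering) *ᵥ b') d =
        b' d - Complex.I * fluxSign j d * a d := by
      linear_combination -hb' d
    rw [h1, h2]
    simp only [map_mul, map_sub, conj_fluxSign, Complex.conj_I, Complex.conj_conj]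
    linear_combination -(fluxSign i d * fluxSign j d * conj (a d) * a d) * Complex.I_mul_I
  have h1 := sub_eq_zero.mpr h
  rw [← Finset.sum_sub_distrib, Finset.sum_congr rfl fun d _ => h0 d, Finset.sum_add_distrib,
    Finset.sum_add_distrib, ← Finset.mul_sum, ← Finset.mul_sum, ← map_sum] at h1
  have h2 : fluxForm a i j b b' = -(∑ d, fluxSign i d * fluxSign j d * conj (a d) * a d) -
      Complex.I * (∑ d, conj (a d) * (fluxSign i d * b' d)) -
      Complex.I * (∑ d, conj (a d) * (fluxSign j d * b d)) := by
    rw [fluxForm, Finset.mul_sum, Finset.mul_sum, ← Finset.sum_neg_distrib,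
      ← Finset.sum_sub_distrib, ← Finset.sum_sub_distrib]
    exact Finset.sum_congr rfl fun d _ => by ring
  have h3 : conj (∑ d, fluxSign i d * fluxSign j d * conj (a d) * a d) =
      ∑ d, fluxSign i d * fluxSign j d * conj (a d) * a d := by
    rw [map_sum]
    exact Finset.sum_congr rfl fun d _ => by
      simp only [map_mul, conj_fluxSign, Complex.conj_conj]; ring
  have h4 := congrArg conj h1
  simp only [map_add, map_mul, map_neg, Complex.conj_I, h3, Complex.conj_conj, map_zero] at h4
  have h5 := Complex.add_conj (∑ d, conj (a d) * (fluxSign i d * b' d))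
  rw [h2, ← h5]
  linear_combination -h4

/-- The matrix of second derivatives is real. -/
theorem conj_fluxForm (hD : ∀ v ∈ G.dirichlet, G.degree v = 1) {i j : E} {b b' : E × Bool → ℂ}
    (hb : G.IsResponse x a i b) (hb' : G.IsResponse x a j b') :
    conj (fluxForm a i j b b') = -fluxForm a i j b b' := by
  rw [fluxForm_eq hD hb hb', map_mul, map_neg, Complex.conj_I, Complex.conj_ofReal]
  ring

end

end Mirror

end MetricGraph

end

noncomputable section

/-! ### Negative eigenvalues of a matrix and of its negative -/

section MorseIndex

open Matrix

variable {ι : Type*} [Fintype ι] [DecidableEq ι]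

theorem Matrix.IsHermitian.charpoly_neg_roots {A : Matrix ι ι ℂ} (hA : A.IsHermitian) :
    (-A).charpoly.roots = A.charpoly.roots.map fun z => -z := by
  have h1 : (-A).charpoly = ∏ i, (Polynomial.X - Polynomial.C (-(hA.eigenvalues i : ℂ))) := by
    refine Polynomial.funext fun z => ?_
    have h2 : A.charpoly.eval (-z) = ∏ i, (-z - (hA.eigenvalues i : ℂ)) := by
      rw [hA.charpoly_eq, Polynomial.eval_prod]
      simp
    rw [Matrix.eval_charpoly] at h2 ⊢
    have h3 : Matrix.scalar ι z - -A = -(Matrix.scalar ι (-z) - A) := by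
      rw [map_neg]; abel
    rw [h3, Matrix.det_neg, h2, Polynomial.eval_prod, ← Finset.card_univ, ← Finset.prod_const,
      ← Finset.prod_mul_distrib]
    exact Finset.prod_congr rfl fun i _ => by simp; ring
  have h2 : ∏ i, (Polynomial.X - Polynomial.C (-(hA.eigenvalues i : ℂ))) =
      (((Finset.univ.val.map fun i => -(hA.eigenvalues i : ℂ)).map fun z =>
        Polynomial.X - Polynomial.C z)).prod := by
    rw [Multiset.map_map]
    rfl
  rw [h1, h2, Polynomial.roots_multiset_prod_X_sub_C, hA.roots_charpoly_eq_eigenvalues,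
    Multiset.map_map]
  rfl

/-- All eigenvalues are real and nonzero, so each is negative for exactly one of the two matrices.
-/
theorem morseIndex_add_morseIndex_neg {A : Matrix ι ι ℂ} (hA : A.IsHermitian) (hdet : A.det ≠ 0) :
    morseIndex A + morseIndex (-A) = Fintype.card ι := by
  have hne : ∀ i, hA.eigenvalues i ≠ 0 := by
    intro i hi
    rw [hA.det_eq_prod_eigenvalues] at hdet
    exact hdet (Finset.prod_eq_zero (Finset.mem_univ i) (by simp [hi]))
  unfold morseIndex
  rw [hA.charpoly_neg_roots, hA.roots_charpoly_eq_eigenvalues]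
  rw [Multiset.map_map, Multiset.filter_map, Multiset.filter_map, Multiset.card_map,
    Multiset.card_map, add_comm,
    Multiset.filter_congr (q := fun i => ¬((fun z : ℂ => z.re < 0 ∧ z.im = 0) ∘
      (RCLike.ofReal ∘ hA.eigenvalues)) i), add_comm, ← Multiset.card_add, Multiset.filter_add_not]
  · rfl
  · intro i _
    have := hne i
    simp only [Function.comp_apply, Complex.neg_re, Complex.neg_im, Complex.coe_algebraMap,
      Complex.ofReal_re, Complex.ofReal_im, neg_zero, and_true, not_lt, neg_lt_zero]
    exact ⟨le_of_lt, fun h => lt_of_le_of_ne h this.symm⟩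

end MorseIndex
namespace MetricGraph

variable {V E : Type*} [Fintype V] [Fintype E] [DecidableEq V] [DecidableEq E]

/-! ### Potentials and flows on a spanning tree -/

section Coboundary

variable {G : MetricGraph V E}

theorem IsCut.card_compl {C : Finset E} (hC : G.IsCut C) :
    ((Finset.univ \ C).card : ℤ) + 1 = Fintype.card V := by
  have h1 := Finset.card_sdiff_add_card_eq_card (Finset.subset_univ C)
  rw [Finset.card_univ] at h1
  have := hC.2
  omega

/-- The differences of a function on the vertices along a set of edges. -/
def coboundary (G : MetricGraph V E) (T : Finset E) : (V → ℝ) →ₗ[ℝ] (T → ℝ) where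
  toFun f e := f (G.tgt e) - f (G.src e)
  map_add' f g := by
    funext e
    simp only [Pi.add_apply]
    ring
  map_smul' r f := by
    funext e
    simp only [Pi.smul_apply, smul_eq_mul, RingHom.id_apply]
    ring

/-- On a connected spanning subgraph only constants have zero differences, and the count of edges
and vertices then makes the rank equal to the number of edges. -/
theorem coboundary_surjective {T : Finset E} (hT : (G.spanning T).Connected)
    (hcard : (T.card : ℤ) + 1 = Fintype.card V) : Function.Surjective (G.coboundary T) := by
  have hker : Module.finrank ℝ (LinearMap.ker (G.coboundary T)) ≤ 1 := by
    refine finrank_le_one ⟨fun _ => (1 : ℝ), ?_⟩ ?_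
    · rw [LinearMap.mem_ker]
      funext e
      simp [coboundary]
    · rintro ⟨f, hf⟩
      obtain ⟨v₀, hv₀⟩ := hT.1
      refine ⟨f v₀, Subtype.ext (funext fun v => ?_)⟩
      have h1 := hT.2 v₀ hv₀ v (Finset.mem_univ v)
      rw [LinearMap.mem_ker] at hf
      have h2 : f v = f v₀ := by
        induction h1 with
        | refl => rfl
        | tail _ hstep ih =>
          obtain ⟨⟨e, s⟩, he, ho, ht⟩ := hstep
          have h3 := congrFun hf ⟨e, he⟩
          simp only [coboundary, LinearMap.coe_mk, AddHom.coe_mk, Pi.zero_apply] at h3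
          rw [← ih, ← ho, ← ht]
          cases s <;> simp [terminus, origin, rev] <;> linarith
      simp [h2]
  rw [← LinearMap.range_eq_top]
  apply Submodule.eq_top_of_finrank_eq
  have h := LinearMap.finrank_range_add_finrank_ker (G.coboundary T)
  have h2 := Submodule.finrank_le (LinearMap.range (G.coboundary T))
  simp only [Module.finrank_fintype_fun_eq_card, Fintype.card_coe] at h h2 ⊢
  omega

theorem sum_directed {M : Type*} [AddCommMonoid M] (f : E × Bool → M) :
    ∑ d, f d = ∑ e, (f (e, true) + f (e, false)) := by
  rw [Fintype.sum_prod_type]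
  simp

/-- A flow which vanishes on the complement of a spanning tree vanishes. -/
theorem flow_eq_zero {C : Finset E} (hC : G.IsCut C) {J : E × Bool → ℝ}
    (hrev : ∀ d, J (rev d) = -J d) (hflow : ∀ v, (∑ d, if G.origin d = v then J d else 0) = 0)
    (hJC : ∀ d, d.1 ∈ C → J d = 0) (d : E × Bool) : J d = 0 := by
  -- The flow is integrated along the tree to a potential f. Pairing f with the zero divergence of J
  -- gives −∑ J², because J vanishes off the tree.
  obtain ⟨f, hf⟩ := coboundary_surjective hC.1 hC.card_compl
    (fun e : ↥(Finset.univ \ C) => J ((e : E), true))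
  have h1 : ∑ d, f (G.origin d) * J d = 0 := by
    have h2 : ∀ v, f v * (∑ d, if G.origin d = v then J d else 0) = 0 := fun v => by
      rw [hflow, mul_zero]
    have h3 := Finset.sum_eq_zero (s := Finset.univ) fun v _ => h2 v
    simp only [Finset.mul_sum] at h3
    rw [Finset.sum_comm] at h3
    simpa using h3
  rw [sum_directed] at h1
  have h4 : ∀ e, f (G.origin (e, true)) * J (e, true) + f (G.origin (e, false)) * J (e, false) =
      -(J (e, true) ^ 2) := by
    intro e
    have h5 : J (e, false) = -J (e, true) := hrev (e, true)
    rw [h5]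
    by_cases he : e ∈ C
    · rw [hJC (e, true) he]; ring
    · have h6 := congrFun hf ⟨e, by simpa using he⟩
      simp only [coboundary, LinearMap.coe_mk, AddHom.coe_mk] at h6
      simp only [origin, if_true, Bool.false_eq_true, if_false]
      rw [← h6]
      ring
  simp only [h4, Finset.sum_neg_distrib, neg_eq_zero] at h1
  have h7 : ∀ e, J (e, true) = 0 := fun e => by
    have := (Finset.sum_eq_zero_iff_of_nonneg fun e _ => sq_nonneg (J (e, true))).mp h1 e
      (Finset.mem_univ e)
    exact pow_eq_zero_iff two_ne_zero |>.mp this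
  obtain ⟨e, s⟩ := d
  cases s
  · have h5 : J (e, false) = -J (e, true) := hrev (e, true)
    rw [h5, h7, neg_zero]
  · exact h7 e

end Coboundary

/-! ### Generic eigenfunctions and rigidity of fluxes without current -/

section Generic

open Matrix ComplexConjugate

variable {G : MetricGraph V E}

theorem edgeFunction_zero (x : Torus E) (a : E × Bool → ℂ) (d : E × Bool) :
    edgeFunction x a d 0 = phase (-(x d.1)) * a d + a (rev d) := by
  simp [edgeFunction, mul_comm]

/-- The real amplitudes of a generic eigenfunction. -/
structure IsGenericVec (G : MetricGraph V E) (x : Torus E) (a : E × Bool → ℂ) : Prop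
    extends G.IsRealSimple x a where
  nonvanishing : ∀ d, G.origin d ∉ G.dirichlet → edgeFunction x a d 0 ≠ 0

theorem IsGenericVec.mem_genericSet (hD : ∀ v ∈ G.dirichlet, G.degree v = 1) {x : Torus E}
    {a : E × Bool → ℂ} (h : G.IsGenericVec x a) : x ∈ G.genericSet :=
  ⟨h.mem_regularSet hD, a, h.isCanonical, h.nonvanishing⟩

theorem exists_isGenericVec_smul (hD : ∀ v ∈ G.dirichlet, G.degree v = 1) {x : Torus E}
    (hx : x ∈ G.genericSet) {a : E × Bool → ℂ} (ha : G.IsCanonical x a) :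
    ∃ r : ℂ, r ≠ 0 ∧ G.IsGenericVec x (r • a) := by
  obtain ⟨r, hr, h⟩ := exists_isRealSimple hD hx.1 ha
  obtain ⟨b, hb, hbv⟩ := hx.2
  obtain ⟨s, hs⟩ := exists_smul_of_mem_regularSet hx.1 h.isCanonical b hb.2
  refine ⟨r, hr, h, fun d hd h0 => hbv d hd ?_⟩
  rw [edgeFunction_zero] at h0 ⊢
  rw [hs, Pi.smul_apply s, Pi.smul_apply s, smul_eq_mul, smul_eq_mul]
  linear_combination s * h0

theorem exists_isGenericVec (hD : ∀ v ∈ G.dirichlet, G.degree v = 1) {x : Torus E}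
    (hx : x ∈ G.genericSet) : ∃ a, G.IsGenericVec x a := by
  obtain ⟨b, hb, _⟩ := hx.2
  obtain ⟨r, _, h⟩ := exists_isGenericVec_smul hD hx hb
  exact ⟨_, h⟩

/-- A zero amplitude makes the eigenfunction vanish on the whole edge, so both ends are Dirichlet
vertices of degree one. By connectedness this edge is the whole graph, and a = 0. -/
theorem IsGenericVec.apply_ne_zero (hG : G.IsNontrivialStandard) {x : Torus E}
    {a : E × Bool → ℂ} (h : G.IsGenericVec x a) (d : E × Bool) : a d ≠ 0 := by
  intro hd
  have hd' : a (rev d) = 0 := by rw [h.apply_eq (rev d), rev_rev, hd]; simp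
  have ho : G.origin d ∈ G.dirichlet := by
    by_contra hn
    exact h.nonvanishing d hn (by rw [edgeFunction_zero, hd, hd']; simp)
  have ht : G.terminus d ∈ G.dirichlet := by
    by_contra hn
    exact h.nonvanishing (rev d) hn (by rw [edgeFunction_zero, rev_rev, hd, hd']; simp)
  have hclosed : ∀ d', (G.origin d' = G.origin d ∨ G.origin d' = G.terminus d) →
      d' = d ∨ d' = rev d := by
    rintro d' (h1 | h1)
    · exact Or.inl (G.eq_of_degree_eq_one (hG.dirichlet_degree _ ho) rfl h1)
    · exact Or.inr (G.eq_of_degree_eq_one (hG.dirichlet_degree _ ht) rfl h1)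
  have hall : ∀ v, v = G.origin d ∨ v = G.terminus d := by
    intro v
    have h1 := hG.connected.2 (G.origin d) (Finset.mem_univ _) v (Finset.mem_univ _)
    induction h1 with
    | refl => exact Or.inl rfl
    | tail _ hstep ih =>
      obtain ⟨d', _, ho', ht'⟩ := hstep
      rw [← ho'] at ih
      rcases hclosed d' ih with rfl | rfl
      · exact Or.inr ht'.symm
      · exact Or.inl (by rw [← ht']; simp)
  refine h.ne_zero (funext fun d' => ?_)
  rcases hclosed d' (hall _) with rfl | rfl
  · exact hd
  · exact hd'

theorem IsMirror.isGenericVec (hG : G.IsNontrivialStandard) {W : Finset V} {x x' : Torus E}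
    {a : E × Bool → ℂ} (ha : G.IsGenericVec x a) (hm : G.IsMirror W a x x') {d : E × Bool}
    (hd : G.IsCutEdge W d) : G.IsGenericVec x' (G.mirrorVec W a) := by
  refine ⟨hm.isRealSimple hG.dirichlet_degree ha.toIsRealSimple hd (ha.apply_ne_zero hG),
    fun d' hd' h0 => ha.nonvanishing d' hd' ?_⟩
  rw [edgeFunction_zero] at h0 ⊢
  rw [hm.apply_eq ha.toIsRealSimple, mirrorVec] at h0
  rw [ha.phase_neg_mul]
  split_ifs at h0
  · exact h0
  · rw [Complex.conj_conj] at h0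
    rw [add_comm, h0]

theorem IsGenericVec.neg (hG : G.IsNontrivialStandard) {x : Torus E} {a : E × Bool → ℂ}
    (ha : G.IsGenericVec x a) : G.IsGenericVec (-x) (G.mirrorVec ∅ a) := by
  refine ⟨ha.toIsRealSimple.neg hG.dirichlet_degree, fun d' hd' h0 => ha.nonvanishing d' hd' ?_⟩
  rw [edgeFunction_zero] at h0 ⊢
  rw [(G.isMirror_neg x a).apply_eq ha.toIsRealSimple, mirrorVec] at h0
  rw [ha.phase_neg_mul]
  split_ifs at h0
  · exact h0
  · rw [Complex.conj_conj] at h0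
    rw [add_comm, h0]

/-- A total flux response without current comes from a trivial flux. -/
theorem IsGenericVec.flux_eq_zero (hG : G.IsNontrivialStandard) {x : Torus E}
    {a : E × Bool → ℂ} (ha : G.IsGenericVec x a) {C : Finset E} (hC : G.IsCut C)
    {A : E × Bool → ℝ} (hA : ∀ d, A (rev d) = -A d) (hAC : ∀ d, d.1 ∉ C → A d = 0)
    {b : E × Bool → ℂ}
    (hb : ∀ d, b d - ((torusPhase x * G.bondScattering) *ᵥ b) d = Complex.I * A d * a d)
    (hcur : ∀ d, d.1 ∈ C → (conj (a d) * b d).re = (conj (a (rev d)) * b (rev d)).re)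
    (d : E × Bool) : A d = 0 := by
  have hD := hG.dirichlet_degree
  have hane := ha.apply_ne_zero hG
  have hSb : ∀ d, (G.bondScattering *ᵥ b) d = phase (-(x d.1)) * (b d - Complex.I * A d * a d) := by
    intro d
    rw [← evolution_eq_iff]
    linear_combination -hb d
  -- The difference of these real parts is a flow: vertex unitarity pairs a with b, and the flux
  -- term it produces is purely imaginary. Since it vanishes on C, it vanishes everywhere.
  have hcur' : ∀ d, (conj (a d) * b d).re = (conj (a (rev d)) * b (rev d)).re := by
    intro d
    have := flow_eq_zero hC
      (J := fun d => (conj (a d) * b d).re - (conj (a (rev d)) * b (rev d)).re)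
      (fun d => by simp only [rev_rev]; ring) (fun v => ?_)
      (fun d hd => by simp only [hcur d hd, sub_self]) d
    · linarith
    · have h1 := sum_conj_mul_bondScattering hD a b v
      have h2 : ∀ d, (if G.origin d = v then
          conj ((G.bondScattering *ᵥ a) d) * (G.bondScattering *ᵥ b) d else 0) =
          if G.origin d = v then conj (a d) * b d - Complex.I * A d * (conj (a d) * a d) else 0 := by
        intro d
        split_ifs
        · rw [bondScattering_mulVec_of_fixed ha.fixed, hSb, map_mul]
          linear_combination (conj (a d) * (b d - Complex.I * A d * a d)) *
            conj_phase_mul_phase (-(x d.1))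
        · rfl
      have h3 := sum_origin_eq_inSum (G := G) (fun d => conj (a d) * b d) v
      rw [Finset.sum_congr rfl fun d _ => h2 d] at h1
      have h4 := h1.trans h3.symm
      have h5 := congrArg Complex.re h4
      rw [Complex.re_sum, Complex.re_sum, ← sub_eq_zero, ← Finset.sum_sub_distrib] at h5
      refine Eq.trans (Finset.sum_congr rfl fun d _ => ?_) h5
      split_ifs
      · rw [Complex.sub_re, ← Complex.normSq_eq_conj_mul_self]
        simp
      · simp
  -- the response is symmetrised with respect to time reversal
  set n : E × Bool → ℂ := fun d => b d / a d with hn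
  have hbn : ∀ d, b d = n d * a d := fun d => (div_mul_cancel₀ _ (hane d)).symm
  have hre : ∀ d, (n d).re = (n (rev d)).re := by
    intro d
    have h1 := hcur' d
    have h2 := ha.conj_mul_self d
    have h3 : conj (a d) * b d = n d * (Complex.normSq (a d) : ℂ) := by
      rw [hbn, Complex.normSq_eq_conj_mul_self]; ring
    have h4 : conj (a (rev d)) * b (rev d) = n (rev d) * (Complex.normSq (a d) : ℂ) := by
      rw [Complex.normSq_eq_conj_mul_self, ← h2, hbn]; ring
    rw [h3, h4, Complex.re_mul_ofReal, Complex.re_mul_ofReal] at h1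
    exact mul_right_cancel₀ (Complex.normSq_pos.mpr (hane d)).ne' h1
  set g : E × Bool → ℝ := fun d => (n d).im + (n (rev d)).im with hg
  have hgrev : ∀ d, g (rev d) = g d := fun d => by simp only [hg, rev_rev]; ring
  have hgn : ∀ d, n d - conj (n (rev d)) = Complex.I * g d := fun d => by
    apply Complex.ext
    · simp [hre d]
    · simp [hg]
  -- The choice is such that i·q·a is b minus the time reversal of Ub. The equality of real parts
  -- obtained above makes q real.
  set q : E × Bool → ℝ := fun d => g d + A d with hq
  have hqrev : ∀ d, q (rev d) = g d - A d := fun d => by simp only [hq, hgrev, hA]; ring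
  have hKb : ∀ d, (G.bondScattering *ᵥ fun d => (conj (n (rev d)) - Complex.I * A d) * a d) d =
      phase (-(x d.1)) * (conj (n (rev d)) * a d) := by
    intro d
    have h1 := congrFun (evolution_timeRev hD x b) d
    rw [evolution_eq_iff] at h1
    have h2 : timeRev x ((torusPhase x * G.bondScattering) *ᵥ b) =
        fun d => (conj (n (rev d)) - Complex.I * A d) * a d := by
      funext d
      have h3 : ((torusPhase x * G.bondScattering) *ᵥ b) (rev d) =
          (n (rev d) + Complex.I * A d) * a (rev d) := by
        have h4 := hb (rev d)
        rw [hA] at h4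
        push_cast at h4
        rw [hbn (rev d)] at h4
        linear_combination -h4
      rw [timeRev, h3, ha.apply_eq d]
      simp only [map_mul, map_add, Complex.conj_I, Complex.conj_ofReal]
      ring
    rw [h2] at h1
    rw [h1, timeRev, hbn, map_mul]
    linear_combination -(phase (-(x d.1)) * conj (n (rev d))) * ha.apply_eq d
  have hqrow : ∀ d, (G.bondScattering *ᵥ fun d => (q d : ℂ) * a d) d =
      phase (-(x d.1)) * (q (rev d) * a d) := by
    intro d
    have h1 : Complex.I • (fun d => (q d : ℂ) * a d) =
        b - fun d => (conj (n (rev d)) - Complex.I * A d) * a d := by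
      funext d
      simp only [Pi.smul_apply, Pi.sub_apply, smul_eq_mul, hq]
      push_cast
      rw [hbn d]
      linear_combination -a d * hgn d
    have h2 := congrFun (congrArg (G.bondScattering *ᵥ ·) h1) d
    simp only [Matrix.mulVec_smul, Matrix.mulVec_sub, Pi.smul_apply, Pi.sub_apply, smul_eq_mul,
      hKb, hSb] at h2
    refine mul_left_cancel₀ Complex.I_ne_zero (h2.trans ?_)
    rw [hqrev, hbn d]
    push_cast
    linear_combination phase (-(x d.1)) * a d * hgn d
  -- At a Dirichlet vertex only one directed edge terminates. Elsewhere the rows of two edges at the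
  -- vertex differ by (q d₁ − q d₂) times the value of the eigenfunction there, which is nonzero.
  have hconst : ∀ d₁ d₂, G.terminus d₁ = G.terminus d₂ → q d₁ = q d₂ := by
    intro d₁ d₂ h12
    by_cases hv : G.terminus d₁ ∈ G.dirichlet
    · have h1 := G.eq_of_degree_eq_one (hD _ hv) (d := rev d₁) (d' := rev d₂) (by simp)
        (by simp [h12])
      have h2 := congrArg rev h1
      rw [rev_rev, rev_rev] at h2
      rw [h2]
    · have h1 := hqrow (rev d₁)
      have h2 := hqrow (rev d₂)
      have h3 := bondScattering_mulVec_of_fixed ha.fixed (rev d₁)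
      have h4 := bondScattering_mulVec_of_fixed ha.fixed (rev d₂)
      have hf := ha.nonvanishing (rev d₁) (by simpa using hv)
      rw [edgeFunction_zero] at hf
      rw [bondScattering_mulVec hD] at h1 h2 h3 h4
      simp only [origin_rev, rev_rev, ← h12] at h1 h2 h3 h4 hf
      have h5 : ((q d₁ - q d₂ : ℝ) : ℂ) *
          (phase (-(x (rev d₁).1)) * a (rev d₁) + a d₁) = 0 := by
        push_cast
        linear_combination -h1 + h2 + (q d₂ : ℂ) * h3 - (q d₂ : ℂ) * h4
      rcases mul_eq_zero.mp h5 with h6 | h6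
      · exact sub_eq_zero.mp (by exact_mod_cast h6)
      · exact absurd h6 hf
  -- So q is a function on the vertices. Off C there is no flux and q agrees on both orientations,
  -- hence q is constant along the spanning tree. In general q d − q (rev d) = 2·A d, which must be
  -- zero.
  have hall : ∀ v, ∀ d', G.terminus d' = v → q d' = q d := by
    intro v
    have h1 := hC.1.2 (G.terminus d) (Finset.mem_univ _) v (Finset.mem_univ _)
    induction h1 with
    | refl => exact fun d' hd' => hconst d' d hd'
    | tail _ hstep ih =>
      obtain ⟨d₁, hd₁, ho, ht⟩ := hstep
      intro d' hd'
      have h2 := ih (rev d₁) (by simpa using ho)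
      rw [hqrev] at h2
      rw [hconst d' d₁ (hd'.trans ht.symm), ← h2]
      have h3 : d₁.1 ∉ C := by
        have : d₁.1 ∈ Finset.univ \ C := hd₁
        simpa using this
      simp [hq, hAC d₁ h3]
  have h1 := hall _ (rev d) rfl
  rw [hqrev] at h1
  simp only [hq] at h1
  linarith

end Generic

end MetricGraph

end

noncomputable section

namespace MetricGraph

variable {V E : Type*} [Fintype V] [Fintype E] [DecidableEq V] [DecidableEq E]

/-! ### The surplus matrix under mirror maps and its nondegeneracy -/

section Surplus

open Matrix ComplexConjugate

variable {G : MetricGraph V E}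

/-- The entries of the matrix whose Morse index is the local surplus. -/
def surplusEntry (G : MetricGraph V E) (x : Torus E) (i j : E) : ℂ :=
  -G.fluxHessian x i j / ∑ e, G.secularGrad x e * (G.length e : ℂ)

/-- The part of the surplus matrix which belongs to a set of edges. -/
def surplusMatrix (G : MetricGraph V E) (x : Torus E) (s : Finset E) : Matrix s s ℂ :=
  Matrix.of fun i j => G.surplusEntry x i j

theorem localSurplus_eq (C : Finset E) (H : G.Subgraph) (x : Torus E) :
    localSurplus C H x = morseIndex (G.surplusMatrix x (C ∩ H.edges)) := rfl

/-- The weighted length. -/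
def totalWeight (G : MetricGraph V E) (a : E × Bool → ℂ) : ℝ := ∑ e, edgeWeight a e * G.length e

theorem totalWeight_pos {a : E × Bool → ℂ} (ha : a ≠ 0) : 0 < G.totalWeight a := by
  obtain ⟨d, hd⟩ := exists_ne_zero ha
  exact Finset.sum_pos' (fun e _ => mul_nonneg (edgeWeight_nonneg a e) (G.length_pos e).le)
    ⟨d.1, Finset.mem_univ _, mul_pos (edgeWeight_pos hd) (G.length_pos _)⟩

theorem totalWeight_mirrorVec (W : Finset V) (a : E × Bool → ℂ) :
    G.totalWeight (G.mirrorVec W a) = G.totalWeight a := by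
  simp only [totalWeight, edgeWeight_mirrorVec]

section

variable {x x' : Torus E} {a : E × Bool → ℂ} {W : Finset V}

theorem IsRealSimple.surplusEntry_eq (hD : ∀ v ∈ G.dirichlet, G.degree v = 1)
    (ha : G.IsRealSimple x a) {i j : E} {b b' : E × Bool → ℂ} (hb : G.IsResponse x a i b)
    (hb' : G.IsResponse x a j b') :
    G.surplusEntry x i j = -Complex.I * fluxForm a i j b b' / (G.totalWeight a : ℂ) :=
  ha.hessian_div_grad hD hb hb'

theorem IsRealSimple.conj_surplusEntry (hD : ∀ v ∈ G.dirichlet, G.degree v = 1)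
    (ha : G.IsRealSimple x a) (i j : E) :
    conj (G.surplusEntry x i j) = G.surplusEntry x i j := by
  obtain ⟨b, hb⟩ := ha.exists_isResponse hD i
  obtain ⟨b', hb'⟩ := ha.exists_isResponse hD j
  rw [ha.surplusEntry_eq hD hb hb', map_div₀, map_mul, conj_fluxForm hD hb hb', map_neg,
    Complex.conj_I, Complex.conj_ofReal]
  ring

theorem IsRealSimple.surplusEntry_comm (hD : ∀ v ∈ G.dirichlet, G.degree v = 1)
    (ha : G.IsRealSimple x a) (i j : E) : G.surplusEntry x i j = G.surplusEntry x j i := by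
  obtain ⟨b, hb⟩ := ha.exists_isResponse hD i
  obtain ⟨b', hb'⟩ := ha.exists_isResponse hD j
  rw [ha.surplusEntry_eq hD hb hb', ha.surplusEntry_eq hD hb' hb, fluxForm_comm]

theorem IsMirror.surplusEntry_near (hG : G.IsNontrivialStandard) (hm : G.IsMirror W a x x')
    (ha : G.IsGenericVec x a) {d : E × Bool} (hd : G.IsCutEdge W d) {i j : E} (hi : G.EdgeIn W i)
    (hj : G.EdgeIn W j) : G.surplusEntry x' i j = G.surplusEntry x i j := by
  have hD := hG.dirichlet_degree
  have ha' := hm.isGenericVec hG ha hd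
  obtain ⟨b, hb, hbs⟩ := ha.exists_isResponse_supportedIn hD hd (ha.apply_ne_zero hG) hi
  obtain ⟨b', hb', hbs'⟩ := ha.exists_isResponse_supportedIn hD hd (ha.apply_ne_zero hG) hj
  rw [ha.surplusEntry_eq hD hb hb', ha'.surplusEntry_eq hD (hm.isResponse_near hD hi hb hbs)
    (hm.isResponse_near hD hj hb' hbs'), fluxForm_mirrorVec_near hi hj, totalWeight_mirrorVec]

/-- The weighted length is unchanged, while the form is conjugated and is purely imaginary. Stated
without a cut edge so that it serves inversion as well. -/
theorem IsMirror.surplusEntry_of_supportedIn (hD : ∀ v ∈ G.dirichlet, G.degree v = 1)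
    (hm : G.IsMirror W a x x') (ha : G.IsRealSimple x a)
    (ha' : G.IsRealSimple x' (G.mirrorVec W a)) {i j : E} (hi : G.EdgeIn Wᶜ i)
    (hj : G.EdgeIn Wᶜ j) {b b' : E × Bool → ℂ} (hb : G.IsResponse x a i b)
    (hb' : G.IsResponse x a j b') (hbs : G.SupportedIn Wᶜ b) (hbs' : G.SupportedIn Wᶜ b') :
    G.surplusEntry x' i j = -G.surplusEntry x i j := by
  rw [ha.surplusEntry_eq hD hb hb', ha'.surplusEntry_eq hD (hm.isResponse_far hD hi hb hbs)
    (hm.isResponse_far hD hj hb' hbs'), fluxForm_mirrorVec_far hi hj, totalWeight_mirrorVec,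
    conj_fluxForm hD hb hb']
  ring

theorem IsMirror.surplusEntry_far (hG : G.IsNontrivialStandard) (hm : G.IsMirror W a x x')
    (ha : G.IsGenericVec x a) {d : E × Bool} (hd : G.IsCutEdge W d) {i j : E}
    (hi : G.EdgeIn Wᶜ i) (hj : G.EdgeIn Wᶜ j) :
    G.surplusEntry x' i j = -G.surplusEntry x i j := by
  have hD := hG.dirichlet_degree
  obtain ⟨b, hb, hbs⟩ := ha.exists_isResponse_supportedIn hD hd.compl (ha.apply_ne_zero hG) hi
  obtain ⟨b', hb', hbs'⟩ := ha.exists_isResponse_supportedIn hD hd.compl (ha.apply_ne_zero hG) hj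
  exact hm.surplusEntry_of_supportedIn hD ha.toIsRealSimple
    (hm.isGenericVec hG ha hd).toIsRealSimple hi hj hb hb' hbs hbs'

theorem IsGenericVec.surplusEntry_neg (hG : G.IsNontrivialStandard) (ha : G.IsGenericVec x a)
    (i j : E) : G.surplusEntry (-x) i j = -G.surplusEntry x i j := by
  have hD := hG.dirichlet_degree
  obtain ⟨b, hb⟩ := ha.exists_isResponse hD i
  obtain ⟨b', hb'⟩ := ha.exists_isResponse hD j
  have h1 : ∀ e, G.EdgeIn (∅ᶜ : Finset V) e := fun e d _ => by simp
  have h2 : ∀ b, G.SupportedIn (∅ᶜ : Finset V) b := fun b d h => absurd h (by simp)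
  exact (G.isMirror_neg x a).surplusEntry_of_supportedIn hD ha.toIsRealSimple
    (ha.neg hG).toIsRealSimple (h1 i) (h1 j) hb hb' (h2 b) (h2 b')

/-- The two responses and the two flux signs live on disjoint sets of edges, so every term of the
form vanishes. -/
theorem IsGenericVec.surplusEntry_eq_zero (hG : G.IsNontrivialStandard) (ha : G.IsGenericVec x a)
    {d : E × Bool} (hd : G.IsCutEdge W d) {i j : E} (hi : G.EdgeIn W i) (hj : G.EdgeIn Wᶜ j) :
    G.surplusEntry x i j = 0 := by
  have hD := hG.dirichlet_degree
  obtain ⟨b, hb, hbs⟩ := ha.exists_isResponse_supportedIn hD hd (ha.apply_ne_zero hG) hi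
  obtain ⟨b', hb', hbs'⟩ := ha.exists_isResponse_supportedIn hD hd.compl (ha.apply_ne_zero hG) hj
  rw [ha.surplusEntry_eq hD hb hb', fluxForm_eq_zero hi hj hbs hbs']
  simp

theorem IsRealSimple.isHermitian (hD : ∀ v ∈ G.dirichlet, G.degree v = 1)
    (ha : G.IsRealSimple x a) (s : Finset E) : (G.surplusMatrix x s).IsHermitian := by
  ext i j
  simp only [Matrix.conjTranspose_apply, surplusMatrix, Matrix.of_apply, RCLike.star_def]
  rw [ha.conj_surplusEntry hD, ha.surplusEntry_comm hD]

/-- The surplus matrix is nondegenerate at generic points. -/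
theorem IsGenericVec.det_surplusMatrix_ne_zero (hG : G.IsNontrivialStandard)
    (ha : G.IsGenericVec x a) {C : Finset E} (hC : G.IsCut C) {s : Finset E} (hs : s ⊆ C)
    (hblock : ∀ i ∈ C, i ∉ s → ∀ j ∈ s, G.surplusEntry x i j = 0) :
    (G.surplusMatrix x s).det ≠ 0 := by
  have hD := hG.dirichlet_degree
  intro hdet
  have hreal : ∀ i j, ((G.surplusEntry x i j).re : ℂ) = G.surplusEntry x i j := fun i j =>
    Complex.conj_eq_iff_re.mp (ha.conj_surplusEntry hD i j)
  -- A real kernel vector is needed, because only real fluxes can be compared with currents.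
  let Mr : Matrix s s ℝ := Matrix.of fun i j => (G.surplusEntry x i j).re
  have hMr : Complex.ofRealHom.mapMatrix Mr = G.surplusMatrix x s := by
    ext i j
    simp [Mr, surplusMatrix, hreal]
  rw [← hMr, ← RingHom.map_det, map_eq_zero] at hdet
  obtain ⟨ξ, hξ0, hξ⟩ := Matrix.exists_mulVec_eq_zero_iff.mpr hdet
  choose b hb using fun j => ha.exists_isResponse hD j
  set ζ : E → ℝ := fun e => if h : e ∈ s then ξ ⟨e, h⟩ else 0 with hζ
  have hζs : ∀ e : s, ζ e = ξ e := fun e => by simp [hζ]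
  -- The kernel equations only concern rows in s; the vanishing off-diagonal block supplies those in
  -- the rest of C.
  have hker : ∀ i ∈ C, ∑ e, (G.surplusEntry x i e).re * ζ e = 0 := by
    intro i hi
    by_cases his : i ∈ s
    · have h1 := congrFun hξ ⟨i, his⟩
      simp only [Matrix.mulVec, dotProduct, Mr, Matrix.of_apply, Pi.zero_apply] at h1
      rw [← h1, ← Finset.sum_subset (Finset.subset_univ s)
        (fun e _ he => by simp [hζ, he]), ← Finset.sum_coe_sort s]
      exact Finset.sum_congr rfl fun e _ => by rw [hζs]
    · refine Finset.sum_eq_zero fun e _ => ?_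
      by_cases he : e ∈ s
      · rw [hblock i hi his e he]; simp
      · simp [hζ, he]
  set A : E × Bool → ℝ := fun d => if d.2 then ζ d.1 else -ζ d.1 with hA
  have hAsum : ∀ d, (A d : ℂ) = ∑ e, (ζ e : ℂ) * fluxSign e d := by
    rintro ⟨e, σ⟩
    cases σ <;> simp [hA, fluxSign]
  set B : E × Bool → ℂ := fun d => ∑ e, (ζ e : ℂ) * b e d with hB
  have hBeq : ∀ d, B d - ((torusPhase x * G.bondScattering) *ᵥ B) d = Complex.I * A d * a d := by
    intro d
    have h1 : B = ∑ e, (ζ e : ℂ) • b e := by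
      funext d
      simp [hB]
    have h2 : ((torusPhase x * G.bondScattering) *ᵥ B) d =
        ∑ e, (ζ e : ℂ) * ((torusPhase x * G.bondScattering) *ᵥ b e) d := by
      rw [h1, Matrix.mulVec_sum, Finset.sum_apply]
      exact Finset.sum_congr rfl fun e _ => by rw [Matrix.mulVec_smul]; rfl
    rw [h2, hB, ← Finset.sum_sub_distrib, hAsum, Finset.mul_sum, Finset.sum_mul]
    refine Finset.sum_congr rfl fun e _ => ?_
    rw [← mul_sub, hb e d]
    ring
  have hP := totalWeight_pos (G := G) ha.ne_zero
  -- Up to a nonzero constant, row i applied to ζ is the change of current on edge i under the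
  -- combined response B.
  have hcur : ∀ i ∈ C, (conj (a (i, true)) * B (i, true)).re =
      (conj (a (i, false)) * B (i, false)).re := by
    intro i hi
    have h1 : ∀ e, (G.surplusEntry x i e).re =
        -(2 / G.totalWeight a) * (∑ d, conj (a d) * (fluxSign i d * b e d)).re := by
      intro e
      have h2 : G.surplusEntry x i e = ((-(2 / G.totalWeight a) *
          (∑ d, conj (a d) * (fluxSign i d * b e d)).re : ℝ) : ℂ) := by
        rw [ha.surplusEntry_eq hD (hb i) (hb e), fluxForm_eq hD (hb i) (hb e)]
        push_cast
        have h3 : (G.totalWeight a : ℂ) ≠ 0 := by exact_mod_cast hP.ne'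
        field_simp
        rw [Complex.I_sq]
        ring
      rw [h2, Complex.ofReal_re]
    have h4 := hker i hi
    simp only [h1, mul_assoc] at h4
    rw [← Finset.mul_sum, mul_eq_zero] at h4
    rcases h4 with h4 | h4
    · exact absurd h4 (neg_ne_zero.mpr (div_ne_zero two_ne_zero hP.ne'))
    have h5 : (∑ d, conj (a d) * (fluxSign i d * B d)).re = 0 := by
      rw [← h4]
      have h6 : ∑ d, conj (a d) * (fluxSign i d * B d) =
          ∑ e, (∑ d, conj (a d) * (fluxSign i d * b e d)) * (ζ e : ℂ) := by
        simp only [hB, Finset.mul_sum, Finset.sum_mul]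
        rw [Finset.sum_comm]
        exact Finset.sum_congr rfl fun e _ => Finset.sum_congr rfl fun d _ => by ring
      rw [h6, Complex.re_sum]
      exact Finset.sum_congr rfl fun e _ => by rw [Complex.re_mul_ofReal]
    rw [sum_directed, Finset.sum_eq_single i (fun e _ he => by simp [fluxSign, he])
      (by simp)] at h5
    simp only [fluxSign, if_true, Bool.false_eq_true, if_false, one_mul, neg_mul, mul_neg,
      Complex.add_re, Complex.neg_re] at h5
    linarith
  have hAz := ha.flux_eq_zero hG hC (A := A) (b := B)
    (fun d => by obtain ⟨e, σ⟩ := d; cases σ <;> simp [hA, rev])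
    (fun d hd => by
      have : d.1 ∉ s := fun h => hd (hs h)
      simp [hA, hζ, this])
    hBeq (by
      rintro ⟨i, σ⟩ hi
      cases σ
      · exact (hcur i hi).symm
      · exact hcur i hi)
  refine hξ0 (funext fun e => ?_)
  rw [← hζs]
  simpa [hA] using hAz ((e : E), true)

end

/-- Opposite surplus matrices have complementary Morse indices. -/
theorem localSurplus_add_of_neg {C : Finset E} {H : G.Subgraph} {x x' : Torus E}
    (hherm : (G.surplusMatrix x (C ∩ H.edges)).IsHermitian)
    (hdet : (G.surplusMatrix x (C ∩ H.edges)).det ≠ 0)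
    (h : ∀ i ∈ C ∩ H.edges, ∀ j ∈ C ∩ H.edges, G.surplusEntry x' i j = -G.surplusEntry x i j) :
    localSurplus C H x + localSurplus C H x' = (C ∩ H.edges).card := by
  have h1 : G.surplusMatrix x' (C ∩ H.edges) = -G.surplusMatrix x (C ∩ H.edges) := by
    ext i j
    exact h i i.2 j j.2
  rw [localSurplus_eq, localSurplus_eq, h1, morseIndex_add_morseIndex_neg hherm hdet,
    Fintype.card_coe]

theorem localSurplus_congr {C : Finset E} {H : G.Subgraph} {x x' : Torus E}
    (h : ∀ i ∈ C ∩ H.edges, ∀ j ∈ C ∩ H.edges, G.surplusEntry x' i j = G.surplusEntry x i j) :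
    localSurplus C H x' = localSurplus C H x := by
  rw [localSurplus_eq, localSurplus_eq]
  congr 1
  ext i j
  exact h i i.2 j j.2

end Surplus

end MetricGraph

end

noncomputable section

namespace MetricGraph

variable {V E : Type*} [Fintype V] [Fintype E] [DecidableEq V] [DecidableEq E]

/-! ### Phase functions and the bridge homeomorphism -/

section Bridge

open Matrix ComplexConjugate

variable {G : MetricGraph V E}

theorem edgeIn_of_mem {W : Finset V} {d : E × Bool} (ho : G.origin d ∈ W)
    (ht : G.terminus d ∈ W) : G.EdgeIn W d.1 := by
  intro d' hd'
  rcases eq_or_eq_rev_of_fst_eq hd' with rfl | rfl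
  · exact ⟨ho, ht⟩
  · exact ⟨by simpa using ht, by simpa using ho⟩

/-- The edges of the subgraph `H` are the edges inside of `W`. -/
def EdgesIn (H : G.Subgraph) (W : Finset V) : Prop := ∀ e, e ∈ H.edges ↔ G.EdgeIn W e

theorem IsCutEdge.not_edgeIn {W : Finset V} {d : E × Bool} (hd : G.IsCutEdge W d) :
    ¬G.EdgeIn W d.1 := fun h => hd.terminus_notMem (h d rfl).2

theorem ofReal_cos_eq (c s : ℝ) : ((c * Real.cos s : ℝ) : ℂ) =
    c / 2 * (Complex.exp (Complex.I * s) + Complex.exp (-(Complex.I * s))) := by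
  push_cast
  rw [Complex.cos]
  ring_nf

theorem edgeFunction_eq_cos {x : Torus E} {a : E × Bool → ℂ} {d : E × Bool} {c θ : ℝ}
    (h1 : a (rev d) = c / 2 * Complex.exp (Complex.I * θ))
    (h2 : phase (-(x d.1)) * a d = c / 2 * Complex.exp (-(Complex.I * θ))) (y : ℝ) :
    edgeFunction x a d y = ((c * Real.cos (y - θ) : ℝ) : ℂ) := by
  have h3 : edgeFunction x a d y = (phase (-(x d.1)) * a d) * Complex.exp (Complex.I * y) +
      a (rev d) * Complex.exp (-(Complex.I * y)) := by
    rw [edgeFunction]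
    ring
  rw [h3, h1, h2, ofReal_cos_eq, mul_assoc, mul_assoc, ← Complex.exp_add, ← Complex.exp_add,
    ← mul_add]
  push_cast
  congr 3 <;> ring

/-- The two exponentials are separated by evaluating at y = 0 and y = π/2. -/
theorem edgeFunction_coefficients {x : Torus E} {a : E × Bool → ℂ} {d : E × Bool} {c θ : ℝ}
    (h : ∀ y : ℝ, edgeFunction x a d y = ((c * Real.cos (y - θ) : ℝ) : ℂ)) :
    a (rev d) = c / 2 * Complex.exp (Complex.I * θ) ∧
      phase (-(x d.1)) * a d = c / 2 * Complex.exp (-(Complex.I * θ)) := by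
  have h3 : ∀ y : ℝ, edgeFunction x a d y =
      (phase (-(x d.1)) * a d) * Complex.exp (Complex.I * y) +
      a (rev d) * Complex.exp (-(Complex.I * y)) := fun y => by
    rw [edgeFunction]
    ring
  have h4 : ∀ y : ℝ, ((c * Real.cos (y - θ) : ℝ) : ℂ) =
      (c / 2 * Complex.exp (-(Complex.I * θ))) * Complex.exp (Complex.I * y) +
      (c / 2 * Complex.exp (Complex.I * θ)) * Complex.exp (-(Complex.I * y)) := fun y => by
    rw [ofReal_cos_eq, mul_assoc, mul_assoc, ← Complex.exp_add, ← Complex.exp_add, ← mul_add]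
    push_cast
    congr 3 <;> ring
  have h5 := (h3 0).symm.trans ((h 0).trans (h4 0))
  have h6 := (h3 (π / 2)).symm.trans ((h (π / 2)).trans (h4 (π / 2)))
  have e1 : Complex.exp (Complex.I * ((π / 2 : ℝ) : ℂ)) = Complex.I := by
    rw [mul_comm]; push_cast; exact Complex.exp_pi_div_two_mul_I
  have e2 : Complex.exp (-(Complex.I * ((π / 2 : ℝ) : ℂ))) = -Complex.I := by
    rw [Complex.exp_neg, e1, Complex.inv_I]
  rw [e1, e2] at h6
  simp only [Complex.ofReal_zero, mul_zero, neg_zero, Complex.exp_zero, mul_one] at h5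
  have h7 : ∀ z w z' w' : ℂ, z + w = z' + w' → z * Complex.I + w * -Complex.I =
      z' * Complex.I + w' * -Complex.I → w = w' ∧ z = z' := by
    intro z w z' w' p q
    have q' : z - w = z' - w' := mul_right_cancel₀ Complex.I_ne_zero (by linear_combination q)
    exact ⟨by linear_combination (p - q') / 2, by linear_combination (p + q') / 2⟩
  exact h7 _ _ _ _ h5 h6

/-- Existence of the phase function of a bridge. -/
theorem exists_isBridgePhase (hG : G.IsNontrivialStandard) {W : Finset V} {d : E × Bool}
    (hd : G.IsCutEdge W d) {H : G.Subgraph} (hH : EdgesIn H W) :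
    ∃ θ, IsBridgePhase H d θ := by
  classical
  have hD := hG.dirichlet_degree
  choose! A hA using fun x (hx : x ∈ G.genericSet) => exists_isGenericVec hD hx
  let P : (H.edges → AddCircle (2 * π)) → Prop := fun y =>
    ∃ x ∈ G.genericSet, y = fun e : H.edges => x (e : E)
  -- The phase is read off at an arbitrary generic point x₀ with the given near coordinates;
  -- proportionality on the cut edge makes it correct for all others. The value 0 applies only where
  -- no such generic point exists, and is never used.
  refine ⟨fun y => if h : P y then Complex.arg (A h.choose (rev d)) else 0, fun x hx => ?_⟩
  have hP : P fun e : H.edges => x (e : E) := ⟨x, hx, rfl⟩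
  beta_reduce
  rw [dif_pos hP]
  obtain ⟨hx₀, hxe⟩ := hP.choose_spec
  set x₀ := hP.choose with hx₀def
  have ha₀ := hA x₀ hx₀
  have ha := hA x hx
  set a₀ := A x₀
  set a := A x
  have h1 := hd.proportional hD (x := x₀) (x' := x) (fun d' ho ht =>
      (congrFun hxe ⟨d'.1, (hH _).mpr (edgeIn_of_mem ho ht)⟩).symm)
    (fun d' _ => bondScattering_mulVec_of_fixed ha₀.fixed d') (ha₀.apply_ne_zero hG _)
    (ha₀.phase_neg_mul d) (fun d' _ => bondScattering_mulVec_of_fixed ha.fixed d')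
  have hne₀ := ha₀.apply_ne_zero hG (rev d)
  have hne := ha.apply_ne_zero hG (rev d)
  refine ⟨(a₀ (rev d) / a (rev d)) • a, isCanonical_smul ha.isCanonical (div_ne_zero hne₀ hne),
    2 * ‖a₀ (rev d)‖, mul_pos two_pos (norm_pos_iff.mpr hne₀), edgeFunction_eq_cos ?_ ?_⟩
  · rw [Pi.smul_apply, smul_eq_mul, div_mul_cancel₀ _ hne]
    have := Complex.norm_mul_exp_arg_mul_I (a₀ (rev d))
    rw [mul_comm Complex.I]
    push_cast
    rw [mul_div_cancel_left₀ _ two_ne_zero, this]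
  · have h2 : phase (-(x d.1)) * ((a₀ (rev d) / a (rev d)) • a) d = conj (a₀ (rev d)) := by
      rw [Pi.smul_apply, smul_eq_mul, mul_left_comm, h1, ha₀.phase_neg_mul d]
      field_simp
    rw [h2]
    have := congrArg conj (Complex.norm_mul_exp_arg_mul_I (a₀ (rev d)))
    rw [map_mul, Complex.conj_ofReal, ← Complex.exp_conj, map_mul, Complex.conj_ofReal,
      Complex.conj_I] at this
    rw [← this]
    push_cast
    rw [mul_div_cancel_left₀ _ two_ne_zero]
    congr 2
    ring

/-- Only e^{2iθ} enters the bridge map, and it is determined by any time reversal invariant vector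
as the quotient of an amplitude by its conjugate. This frees later arguments from the choice of θ.
-/
theorem IsBridgePhase.phase_mul {H : G.Subgraph} {d : E × Bool}
    {θ : (H.edges → AddCircle (2 * π)) → ℝ} (hθ : IsBridgePhase H d θ) {x : Torus E}
    (hx : x ∈ G.genericSet) {a : E × Bool → ℂ} (ha : G.IsRealSimple x a) :
    phase ((2 * θ fun e => x e : ℝ) : AddCircle (2 * π)) * conj (a (rev d)) = a (rev d) := by
  obtain ⟨b, hb, c, hc, hcos⟩ := hθ x hx
  obtain ⟨h1, h2⟩ := edgeFunction_coefficients hcos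
  obtain ⟨s, hs⟩ := exists_smul_of_mem_regularSet hx.1 ha.isCanonical b hb.2
  set t := θ fun e => x e
  have hs0 : s ≠ 0 := by
    rintro rfl
    exact hb.1 (by rw [hs, zero_smul])
  rw [hs, Pi.smul_apply, smul_eq_mul] at h1 h2
  rw [mul_left_comm, ha.phase_neg_mul] at h2
  have h3 : phase ((2 * t : ℝ) : AddCircle (2 * π)) =
      Complex.exp (Complex.I * t) * Complex.exp (Complex.I * t) := by
    rw [phase_coe, ← Complex.exp_add]
    push_cast
    congr 1
    ring
  have h4 : Complex.exp (Complex.I * t) * Complex.exp (-(Complex.I * t)) = 1 := by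
    rw [← Complex.exp_add, add_neg_cancel, Complex.exp_zero]
  refine mul_left_cancel₀ hs0 ?_
  rw [h3, h1]
  linear_combination (Complex.exp (Complex.I * t) * Complex.exp (Complex.I * t)) * h2 +
    (c / 2 * Complex.exp (Complex.I * t)) * h4

theorem isMirror_bridgeMap {W : Finset V} {d : E × Bool} (hd : G.IsCutEdge W d) {H : G.Subgraph}
    (hH : EdgesIn H W) {θ : (H.edges → AddCircle (2 * π)) → ℝ} (hθ : IsBridgePhase H d θ)
    {x : Torus E} (hx : x ∈ G.genericSet) {a : E × Bool → ℂ} (ha : G.IsRealSimple x a) :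
    G.IsMirror W a x (bridgeMap H d.1 θ x) where
  near d' ho ht := by
    have : d'.1 ∈ H.edges := (hH _).mpr (edgeIn_of_mem ho ht)
    simp [bridgeMap, this]
  far d' ho ht := by
    have h1 : d'.1 ∉ H.edges := fun h => ho ((hH _).mp h d' rfl).1
    have h2 : d'.1 ≠ d.1 := fun h => by
      rcases eq_or_eq_rev_of_fst_eq h with rfl | rfl
      · exact ho hd.origin_mem
      · exact ht (by simpa using hd.origin_mem)
    simp [bridgeMap, h1, h2]
  cross d' ho ht := by
    have h0 := hd.eq_of_leaves d' ho ht
    subst h0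
    have h1 : d'.1 ∉ H.edges := fun h => hd.not_edgeIn ((hH _).mp h)
    have h2 : bridgeMap H d'.1 θ x d'.1 =
        -x d'.1 + ((2 * θ (fun e => x e) : ℝ) : AddCircle (2 * π)) := by
      simp [bridgeMap, h1]
    rw [h2, phase_add, mul_assoc, hθ.phase_mul hx ha]

theorem bridgeMap_mem {W : Finset V} {d : E × Bool} (hG : G.IsNontrivialStandard)
    (hd : G.IsCutEdge W d) {H : G.Subgraph} (hH : EdgesIn H W)
    {θ : (H.edges → AddCircle (2 * π)) → ℝ} (hθ : IsBridgePhase H d θ) {x : Torus E}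
    (hx : x ∈ G.genericSet) : bridgeMap H d.1 θ x ∈ G.genericSet := by
  obtain ⟨a, ha⟩ := exists_isGenericVec hG.dirichlet_degree hx
  exact ((isMirror_bridgeMap hd hH hθ hx ha.toIsRealSimple).isGenericVec hG ha hd).mem_genericSet
    hG.dirichlet_degree

theorem bridgeMap_bridgeMap {e₀ : E} {H : G.Subgraph} (θ : (H.edges → AddCircle (2 * π)) → ℝ)
    (x : Torus E) : bridgeMap H e₀ θ (bridgeMap H e₀ θ x) = x := by
  have h1 : (fun e : H.edges => bridgeMap H e₀ θ x (e : E)) = fun e : H.edges => x (e : E) := by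
    funext e
    simp [bridgeMap]
  ext e
  change (if e ∈ H.edges then bridgeMap H e₀ θ x e else if e = e₀ then
    -bridgeMap H e₀ θ x e + ((2 * θ (fun e => bridgeMap H e₀ θ x e) : ℝ) : AddCircle (2 * π))
    else -bridgeMap H e₀ θ x e) = x e
  rw [h1]
  split_ifs with h2 h3
  · simp [bridgeMap, h2]
  · subst h3
    simp [bridgeMap, h2]
  · simp [bridgeMap, h2, h3]

theorem continuous_phase : Continuous phase :=
  continuous_subtype_val.comp AddCircle.continuous_toCircle

theorem isClosedEmbedding_phase : Topology.IsClosedEmbedding phase := by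
  have : Fact (0 < 2 * π) := ⟨Real.two_pi_pos⟩
  exact continuous_phase.isClosedEmbedding phase_injective

theorem continuous_torus_apply (e : E) : Continuous fun x : Torus E => x e :=
  PiLp.continuous_apply 2 _ e

theorem continuous_adjugate (G : MetricGraph V E) (i j : E × Bool) : Continuous fun x : Torus E =>
    (1 - torusPhase x * G.bondScattering).adjugate i j := by
  have h1 : Continuous fun x : Torus E => 1 - torusPhase x * G.bondScattering := by
    refine continuous_const.sub (Continuous.matrix_mul ?_ continuous_const)
    exact Continuous.matrix_diagonal
      (continuous_pi fun d => continuous_phase.comp (continuous_torus_apply d.1))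
  exact h1.matrix_adjugate.matrix_elem i j

/-- An arbitrary phase function need not be continuous, but e^{2iθ} is, up to a phase, a quotient of
two cofactors of 1 − U. The unknown constant c of the adjugate cancels in the quotient. -/
theorem IsBridgePhase.continuous (hG : G.IsNontrivialStandard) {H : G.Subgraph} {d : E × Bool}
    {θ : (H.edges → AddCircle (2 * π)) → ℝ} (hθ : IsBridgePhase H d θ) :
    Continuous fun x : G.genericSet =>
      ((2 * θ (fun e => (x : Torus E) e) : ℝ) : AddCircle (2 * π)) := by
  have hD := hG.dirichlet_degree
  rw [isClosedEmbedding_phase.isEmbedding.continuous_iff]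
  have h1 : ∀ x : G.genericSet,
      (1 - torusPhase (x : Torus E) * G.bondScattering).adjugate d (rev d) ≠ 0 ∧
      phase ((2 * θ (fun e => (x : Torus E) e) : ℝ) : AddCircle (2 * π)) =
      phase ((x : Torus E) d.1) *
        (1 - torusPhase (x : Torus E) * G.bondScattering).adjugate (rev d) (rev d) /
        (1 - torusPhase (x : Torus E) * G.bondScattering).adjugate d (rev d) := by
    intro x
    obtain ⟨a, ha⟩ := exists_isGenericVec hD x.2
    obtain ⟨c, hc, hadj⟩ := ha.exists_adjugate hD
    have h2 := hθ.phase_mul x.2 ha.toIsRealSimple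
    have h3 : conj (a (rev d)) ≠ 0 := by simpa using ha.apply_ne_zero hG (rev d)
    have h4 : (1 - torusPhase (x : Torus E) * G.bondScattering).adjugate d (rev d) ≠ 0 := by
      rw [hadj]
      exact mul_ne_zero (mul_ne_zero hc (ha.apply_ne_zero hG d)) h3
    refine ⟨h4, ?_⟩
    rw [eq_div_iff h4, hadj, hadj]
    have h5 := ha.apply_eq d
    linear_combination (phase ((2 * θ (fun e => (x : Torus E) e) : ℝ) : AddCircle (2 * π)) * c *
      conj (a (rev d))) * h5 + (phase ((x : Torus E) d.1) * c * conj (a (rev d))) * h2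
  have h2 : phase ∘ (fun x : G.genericSet =>
      ((2 * θ (fun e => (x : Torus E) e) : ℝ) : AddCircle (2 * π))) = fun x : G.genericSet =>
      phase ((x : Torus E) d.1) *
        (1 - torusPhase (x : Torus E) * G.bondScattering).adjugate (rev d) (rev d) /
        (1 - torusPhase (x : Torus E) * G.bondScattering).adjugate d (rev d) :=
    funext fun x => (h1 x).2
  rw [h2]
  refine Continuous.div ?_ ((G.continuous_adjugate d (rev d)).comp continuous_subtype_val)
    fun x => (h1 x).1
  exact ((continuous_phase.comp (continuous_torus_apply d.1)).comp continuous_subtype_val).mul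
    ((G.continuous_adjugate (rev d) (rev d)).comp continuous_subtype_val)

/-- The bridge map as a homeomorphism of the generic part of the secular manifold. -/
def bridgeHomeomorph (hG : G.IsNontrivialStandard) {W : Finset V} {d : E × Bool}
    (hd : G.IsCutEdge W d) {H : G.Subgraph} (hH : EdgesIn H W)
    {θ : (H.edges → AddCircle (2 * π)) → ℝ} (hθ : IsBridgePhase H d θ) :
    G.genericSet ≃ₜ G.genericSet :=
  have hcont : Continuous fun x : G.genericSet =>
      (⟨bridgeMap H d.1 θ x, bridgeMap_mem hG hd hH hθ x.2⟩ : G.genericSet) := by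
    refine Continuous.subtype_mk ?_ _
    refine (PiLp.continuous_toLp 2 _).comp (continuous_pi fun e => ?_)
    have h1 := (continuous_torus_apply e).comp (continuous_subtype_val (p := (· ∈ G.genericSet)))
    split_ifs
    · exact h1
    · exact h1.neg.add (hθ.continuous hG)
    · exact h1.neg
  { toFun := fun x => ⟨bridgeMap H d.1 θ x, bridgeMap_mem hG hd hH hθ x.2⟩
    invFun := fun x => ⟨bridgeMap H d.1 θ x, bridgeMap_mem hG hd hH hθ x.2⟩
    left_inv := fun x => Subtype.ext (bridgeMap_bridgeMap θ x)
    right_inv := fun x => Subtype.ext (bridgeMap_bridgeMap θ x)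
    continuous_toFun := hcont
    continuous_invFun := hcont }

theorem coe_bridgeHomeomorph (hG : G.IsNontrivialStandard) {W : Finset V} {d : E × Bool}
    (hd : G.IsCutEdge W d) {H : G.Subgraph} (hH : EdgesIn H W)
    {θ : (H.edges → AddCircle (2 * π)) → ℝ} (hθ : IsBridgePhase H d θ) (x : G.genericSet) :
    (bridgeHomeomorph hG hd hH hθ x : Torus E) = bridgeMap H d.1 θ x := rfl

theorem neg_mem_genericSet (hG : G.IsNontrivialStandard) {x : Torus E} (hx : x ∈ G.genericSet) :
    -x ∈ G.genericSet := by
  obtain ⟨a, ha⟩ := exists_isGenericVec hG.dirichlet_degree hx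
  exact (ha.neg hG).mem_genericSet hG.dirichlet_degree

theorem continuous_torus_neg : Continuous fun x : Torus E => -x :=
  (PiLp.continuous_toLp 2 _).comp (continuous_pi fun e => (continuous_torus_apply e).neg)

/-- The inversion of the generic part of the secular manifold. -/
def inversion (hG : G.IsNontrivialStandard) : G.genericSet ≃ₜ G.genericSet where
  toFun x := ⟨-x, neg_mem_genericSet hG x.2⟩
  invFun x := ⟨-x, neg_mem_genericSet hG x.2⟩
  left_inv x := Subtype.ext (neg_neg (x : Torus E))
  right_inv x := Subtype.ext (neg_neg (x : Torus E))
  continuous_toFun := (continuous_torus_neg.comp continuous_subtype_val).subtype_mk _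
  continuous_invFun := (continuous_torus_neg.comp continuous_subtype_val).subtype_mk _

end Bridge

end MetricGraph

end

noncomputable section

/-! ### Hausdorff measure under maps that are nearly linear involutions -/

section HausdorffComparison

open Filter Topology
open scoped ENNReal NNReal

theorem measure_image_of_involution {H : Type*} [NormedAddCommGroup H] [NormedSpace ℝ H]
    [MeasurableSpace H] [BorelSpace H] [FiniteDimensional ℝ H] (μ : Measure H)
    [μ.IsAddHaarMeasure] {T : H →ₗ[ℝ] H} (hT : ∀ w, T (T w) = w) (s : Set H) :
    μ (T '' s) = μ s := by
  have h1 : LinearMap.det T * LinearMap.det T = 1 := by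
    rw [← LinearMap.det_comp, show T ∘ₗ T = LinearMap.id from LinearMap.ext hT, LinearMap.det_id]
  have h2 : |LinearMap.det T| = 1 := by
    rcases mul_self_eq_one_iff.mp h1 with h | h <;> simp [h]
  rw [Measure.addHaar_image_linearMap, h2, ENNReal.ofReal_one, one_mul]

/-- A map which becomes a linear involution in charts with small distortion changes the Hausdorff
measure only by a factor close to one. -/
theorem hausdorffMeasure_image_le_of_charts {X Y H : Type*} [MetricSpace X] [MeasurableSpace X]
    [BorelSpace X] [MetricSpace Y] [MeasurableSpace Y] [BorelSpace Y] [NormedAddCommGroup H]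
    [NormedSpace ℝ H] [MeasurableSpace H] [BorelSpace H] [FiniteDimensional ℝ H]
    {f : X → Y} {q : X → H} {q' : Y → H} {T : H →ₗ[ℝ] H} (hT : ∀ w, T (T w) = w) {K K' : ℝ≥0}
    {A : Set X} (hf : ∀ x ∈ A, q' (f x) = T (q x)) (hq : LipschitzOnWith K q A)
    (hq' : ∀ x ∈ A, ∀ y ∈ A, dist (f x) (f y) ≤ K' * dist (q' (f x)) (q' (f y)))
    {d : ℕ} (hd : Module.finrank ℝ H = d) :
    μH[d] (f '' A) ≤ ((K' * K : ℝ≥0) : ℝ≥0∞) ^ d * μH[d] A := by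
  rcases A.eq_empty_or_nonempty with rfl | ⟨x₀, hx₀⟩
  · simp
  have : Nonempty Y := ⟨f x₀⟩
  have hdd : (0 : ℝ) ≤ d := Nat.cast_nonneg d
  have hinj : Set.InjOn q' (f '' A) := by
    rintro _ ⟨x, hx, rfl⟩ _ ⟨y, hy, rfl⟩ h
    have := hq' x hx y hy
    rw [h, dist_self, mul_zero] at this
    exact dist_le_zero.mp this
  have h1 : LipschitzOnWith K' (Function.invFunOn q' (f '' A)) (q' '' (f '' A)) := by
    refine LipschitzOnWith.of_dist_le_mul ?_
    rintro _ ⟨_, ⟨x, hx, rfl⟩, rfl⟩ _ ⟨_, ⟨y, hy, rfl⟩, rfl⟩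
    rw [hinj.leftInvOn_invFunOn ⟨x, hx, rfl⟩, hinj.leftInvOn_invFunOn ⟨y, hy, rfl⟩]
    exact hq' x hx y hy
  have h2 := h1.hausdorffMeasure_image_le hdd
  rw [hinj.leftInvOn_invFunOn.image_image] at h2
  have h3 : q' '' (f '' A) = T '' (q '' A) := by
    rw [Set.image_image, Set.image_image]
    exact Set.image_congr hf
  -- In the dimension of H the Hausdorff measure is a Haar measure, so the linear involution
  -- preserves it.
  subst hd
  have h4 : μH[(Module.finrank ℝ H : ℕ)] (T '' (q '' A)) = μH[(Module.finrank ℝ H : ℕ)] (q '' A) :=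
    measure_image_of_involution _ hT _
  rw [h3, h4] at h2
  refine h2.trans ((mul_le_mul_right (hq.hausdorffMeasure_image_le hdd) _).trans ?_)
  rw [← mul_assoc, ENNReal.rpow_natCast, ENNReal.rpow_natCast, ← mul_pow, ENNReal.coe_mul]

/-- A homeomorphism which locally does not increase a measure by more than an arbitrarily small
factor does not increase it. -/
theorem measure_image_le_of_locally {X : Type*} [TopologicalSpace X] [SecondCountableTopology X]
    [MeasurableSpace X] [BorelSpace X] {μ : Measure X} (Φ : X ≃ₜ X)
    (h : ∀ ε : ℝ≥0, 0 < ε → ∀ x, ∃ U ∈ 𝓝 x, ∀ A ⊆ U, μ (Φ '' A) ≤ (1 + ε : ℝ≥0) * μ A)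
    {A : Set X} (hA : MeasurableSet A) : μ (Φ '' A) ≤ μ A := by
  have key : ∀ ε : ℝ≥0, 0 < ε → μ (Φ '' A) ≤ (1 + ε : ℝ≥0) * μ A := by
    intro ε hε
    rcases isEmpty_or_nonempty X with hX | ⟨⟨x₀⟩⟩
    · simp [Set.eq_empty_of_isEmpty A]
    choose U hU hUA using h ε hε
    obtain ⟨s, hs, hcover⟩ := TopologicalSpace.countable_cover_nhds
      fun x => interior_mem_nhds.mpr (hU x)
    have hsne : s.Nonempty := by
      by_contra hne
      rw [Set.not_nonempty_iff_eq_empty] at hne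
      rw [hne, Set.biUnion_empty] at hcover
      exact Set.notMem_empty x₀ (hcover.symm ▸ Set.mem_univ x₀)
    -- The countable cover is made disjoint so that the local estimates add up without overcounting
    -- the measure of A.
    obtain ⟨u, hu⟩ := hs.exists_eq_range hsne
    let D : ℕ → Set X := disjointed fun n => interior (U (u n))
    have hDm : ∀ n, MeasurableSet (D n) :=
      MeasurableSet.disjointed fun n => isOpen_interior.measurableSet
    have hDu : ⋃ n, D n = Set.univ := by
      rw [iUnion_disjointed, ← hcover, hu, Set.biUnion_range]
    have hAD : A = ⋃ n, A ∩ D n := by rw [← Set.inter_iUnion, hDu, Set.inter_univ]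
    have hsum : μ A = ∑' n, μ (A ∩ D n) := by
      conv_lhs => rw [hAD]
      exact measure_iUnion (fun i j hij => (disjoint_disjointed _ hij).mono
        Set.inter_subset_right Set.inter_subset_right) fun n => hA.inter (hDm n)
    calc μ (Φ '' A) = μ (⋃ n, Φ '' (A ∩ D n)) := by rw [← Set.image_iUnion, ← hAD]
      _ ≤ ∑' n, μ (Φ '' (A ∩ D n)) := measure_iUnion_le _
      _ ≤ ∑' n, (1 + ε : ℝ≥0) * μ (A ∩ D n) := ENNReal.tsum_le_tsum fun n =>
          hUA (u n) _ (Set.inter_subset_right.trans ((disjointed_subset _ n).trans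
            interior_subset))
      _ = (1 + ε : ℝ≥0) * μ A := by rw [ENNReal.tsum_mul_left, ← hsum]
  have hlim : Tendsto (fun ε : ℝ≥0 => ((1 + ε : ℝ≥0) : ℝ≥0∞) * μ A) (𝓝[>] 0) (𝓝 (1 * μ A)) := by
    refine ENNReal.Tendsto.mul_const ?_ (Or.inl one_ne_zero)
    refine (ENNReal.tendsto_coe.mpr (Tendsto.mono_left ?_ nhdsWithin_le_nhds))
    simpa using (tendsto_const_nhds (x := (1 : ℝ≥0))).add (tendsto_id (x := 𝓝 (0 : ℝ≥0)))
  rw [one_mul] at hlim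
  exact ge_of_tendsto hlim (eventually_nhdsWithin_of_forall fun ε hε => key ε hε)

/-- The factor is the product of the Lipschitz constants of a chart and of an inverse chart. The
bound δ < 1 keeps the truncated subtraction genuine. -/
theorem exists_distortion_le (d : ℕ) {ε : ℝ≥0} (hε : 0 < ε) :
    ∃ δ : ℝ≥0, 0 < δ ∧ δ < 1 ∧ ((1 - δ)⁻¹ * (1 + δ)) ^ d ≤ 1 + ε := by
  have h : Tendsto (fun δ : ℝ≥0 => ((1 - δ)⁻¹ * (1 + δ)) ^ d) (𝓝 0)
      (𝓝 (((1 - 0)⁻¹ * (1 + 0)) ^ d)) := by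
    have h1 : Tendsto (fun δ : ℝ≥0 => 1 - δ) (𝓝 0) (𝓝 (1 - 0)) :=
      (continuous_const.sub continuous_id).tendsto _
    exact ((h1.inv₀ (by simp)).mul (tendsto_const_nhds.add tendsto_id)).pow d
  have h2 : ∀ᶠ δ : ℝ≥0 in 𝓝[>] 0, ((1 - δ)⁻¹ * (1 + δ)) ^ d ≤ 1 + ε := by
    refine (h.mono_left nhdsWithin_le_nhds).eventually_le_const ?_
    simpa using hε
  have h3 : ∀ᶠ δ : ℝ≥0 in 𝓝[>] 0, δ < 1 :=
    nhdsWithin_le_nhds (gt_mem_nhds one_pos)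
  have h4 : ∀ᶠ δ : ℝ≥0 in 𝓝[>] 0, 0 < δ := eventually_mem_nhdsWithin
  obtain ⟨δ, h5, h6, h7⟩ := (h2.and (h3.and h4)).exists
  exact ⟨δ, h7, h6, h5⟩

end HausdorffComparison

end

noncomputable section

namespace MetricGraph

variable {V E : Type*} [Fintype V] [Fintype E] [DecidableEq V] [DecidableEq E]

/-! ### The real secular function and its normal vector -/

section Normal

open Matrix ComplexConjugate Filter Topology
open scoped InnerProductSpace

/-- The projection of the Euclidean space onto the torus. -/
def Torus.mk (v : EuclideanSpace ℝ E) : Torus E :=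
  WithLp.toLp 2 fun e => ((v e : ℝ) : AddCircle (2 * π))

theorem Torus.mk_apply (v : EuclideanSpace ℝ E) (e : E) :
    Torus.mk v e = ((v e : ℝ) : AddCircle (2 * π)) := rfl

theorem Torus.mk_zero : Torus.mk (0 : EuclideanSpace ℝ E) = 0 := by
  ext e
  simp [Torus.mk_apply]

theorem Torus.mk_smul_single (e : E) (t : ℝ) :
    Torus.mk (t • EuclideanSpace.single e (1 : ℝ)) = Torus.single e t := by
  ext e'
  rw [Torus.mk_apply, Torus.single_apply]
  by_cases h : e' = e <;> simp [h]

variable {G : MetricGraph V E}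

theorem conjTranspose_evolution_mul (hD : ∀ v ∈ G.dirichlet, G.degree v = 1) (x : Torus E) :
    (torusPhase x * G.bondScattering)ᴴ * (torusPhase x * G.bondScattering) = 1 := by
  ext i j
  have h := star_evolution_dotProduct hD x (Pi.single i 1) (Pi.single j 1)
  rw [Matrix.mulVec_single_one, Matrix.mulVec_single_one] at h
  generalize torusPhase x * G.bondScattering = U at h ⊢
  simp only [Matrix.mul_apply, Matrix.conjTranspose_apply, Matrix.one_apply]
  simpa [dotProduct, Pi.single_apply, Matrix.col_apply, apply_ite, eq_comm] using h

theorem det_torusPhase (x : Torus E) : (torusPhase x).det = phase (∑ e, x e) * phase (∑ e, x e) := by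
  have h : ∀ s : Finset E, phase (∑ e ∈ s, x e) = ∏ e ∈ s, phase (x e) := fun s => by
    induction s using Finset.induction_on with
    | empty => simp [phase_zero]
    | insert e s he ih => rw [Finset.sum_insert he, Finset.prod_insert he, phase_add, ih]
  rw [torusPhase, Matrix.det_diagonal, Fintype.prod_prod_type, h]
  simp only [Fintype.prod_bool, Finset.prod_mul_distrib]

theorem star_det_mul_det (hD : ∀ v ∈ G.dirichlet, G.degree v = 1) (x : Torus E) :
    conj (torusPhase x * G.bondScattering).det * (torusPhase x * G.bondScattering).det = 1 := by
  have h := congrArg Matrix.det (conjTranspose_evolution_mul hD x)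
  rwa [Matrix.det_mul, Matrix.det_conjTranspose, Matrix.det_one] at h

/-- Follows from (1 − U)* = −U*(1 − U). The sign disappears in the determinant because the number of
directed edges is even. -/
theorem conj_secular (hD : ∀ v ∈ G.dirichlet, G.degree v = 1) (x : Torus E) :
    conj (G.secular x 0) = conj (torusPhase x * G.bondScattering).det * G.secular x 0 := by
  have h1 : (1 - torusPhase x * G.bondScattering)ᴴ =
      (torusPhase x * G.bondScattering)ᴴ * (-(1 - torusPhase x * G.bondScattering)) := by
    rw [mul_neg, mul_sub, conjTranspose_evolution_mul hD, mul_one, neg_sub,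
      Matrix.conjTranspose_sub, Matrix.conjTranspose_one]
  have h2 := congrArg Matrix.det h1
  rw [Matrix.det_conjTranspose, Matrix.det_mul, Matrix.det_conjTranspose, Matrix.det_neg,
    Fintype.card_prod, Fintype.card_bool, mul_comm (Fintype.card E), pow_mul, neg_one_sq, one_pow,
    one_mul] at h2
  rw [secular_zero]
  exact h2

/-- The factor which makes the secular function real. -/
def secularFactor (G : MetricGraph V E) (x : Torus E) : ℂ :=
  phase (-∑ e, x e) / G.bondScattering.det ^ (1 / 2 : ℂ)

theorem realSecular_eq (x : Torus E) :
    G.realSecular x = (G.secularFactor x * G.secular x 0).re := rfl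

theorem det_bondScattering_ne_zero (hD : ∀ v ∈ G.dirichlet, G.degree v = 1) :
    G.bondScattering.det ≠ 0 := by
  intro h
  have := star_det_mul_det hD (0 : Torus E)
  rw [Matrix.det_mul, h] at this
  simp at this

theorem secularFactor_ne_zero (hD : ∀ v ∈ G.dirichlet, G.degree v = 1) (x : Torus E) :
    G.secularFactor x ≠ 0 :=
  div_ne_zero (phase_ne_zero _) (by simp [Complex.cpow_eq_zero_iff, det_bondScattering_ne_zero hD])

theorem secularFactor_sq_mul_det (hD : ∀ v ∈ G.dirichlet, G.degree v = 1) (x : Torus E) :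
    G.secularFactor x * G.secularFactor x * (torusPhase x * G.bondScattering).det = 1 := by
  have h0 := det_bondScattering_ne_zero hD
  have h1 : G.bondScattering.det ^ (1 / 2 : ℂ) * G.bondScattering.det ^ (1 / 2 : ℂ) =
      G.bondScattering.det := by
    rw [← Complex.cpow_add _ _ h0]
    norm_num
  have h2 : G.bondScattering.det ^ (1 / 2 : ℂ) ≠ 0 := fun h => h0 (by rw [← h1, h, zero_mul])
  have h3 := phase_neg_mul_phase (∑ e, x e)
  rw [secularFactor, Matrix.det_mul, det_torusPhase]
  generalize G.bondScattering.det ^ (1 / 2 : ℂ) = q at h1 h2 ⊢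
  rw [← h1]
  field_simp
  linear_combination (phase (-∑ e, x e) * phase (∑ e, x e) + 1) * h3

/-- The factor has modulus one and its square is the inverse of det U, which exactly compensates the
factor in `conj_secular`. -/
theorem conj_secularFactor_mul_secular (hD : ∀ v ∈ G.dirichlet, G.degree v = 1) (x : Torus E) :
    conj (G.secularFactor x * G.secular x 0) = G.secularFactor x * G.secular x 0 := by
  have h0 := secularFactor_ne_zero hD x
  have h1 := secularFactor_sq_mul_det hD x
  have h2 := star_det_mul_det hD x
  have hn : conj (G.secularFactor x) * G.secularFactor x = 1 := by
    have h3 : (‖G.secularFactor x‖ ^ 2) ^ 2 = 1 := by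
      have h4 := congrArg norm h1
      have h5 := congrArg norm h2
      rw [norm_mul, norm_mul, norm_one] at h4
      rw [norm_mul, RCLike.norm_conj, norm_one] at h5
      have h6 : ‖(torusPhase x * G.bondScattering).det‖ = 1 := by
        nlinarith [norm_nonneg (torusPhase x * G.bondScattering).det]
      rw [h6, mul_one] at h4
      rw [sq ‖_‖, h4, one_pow]
    have h4 : ‖G.secularFactor x‖ ^ 2 = 1 := by
      nlinarith [sq_nonneg ‖G.secularFactor x‖]
    rw [Complex.conj_mul', ← Complex.ofReal_pow, h4, Complex.ofReal_one]
  rw [map_mul, conj_secular hD]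
  linear_combination -(conj (G.secularFactor x) * conj (torusPhase x * G.bondScattering).det *
      G.secular x 0) * h1 + (conj (torusPhase x * G.bondScattering).det *
      (torusPhase x * G.bondScattering).det * G.secularFactor x * G.secular x 0) * hn +
      (G.secularFactor x * G.secular x 0) * h2

/-- The secular function in coordinates on the universal cover of the torus. -/
def localSecular (G : MetricGraph V E) (x : Torus E) (v : EuclideanSpace ℝ E) : ℂ :=
  G.secularFactor (x + Torus.mk v) * G.secular (x + Torus.mk v) 0

theorem ofReal_realSecular (hD : ∀ v ∈ G.dirichlet, G.degree v = 1) (x : Torus E)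
    (v : EuclideanSpace ℝ E) : (G.realSecular (x + Torus.mk v) : ℂ) = G.localSecular x v :=
  Complex.conj_eq_iff_re.mp (conj_secularFactor_mul_secular hD _)

theorem phase_add_mk (x : Torus E) (v : EuclideanSpace ℝ E) (e : E) :
    phase ((x + Torus.mk v) e) = phase (x e) * Complex.exp (Complex.I * v e) := by
  rw [PiLp.add_apply, phase_add, Torus.mk_apply, phase_coe]

theorem secularFactor_add_mk (x : Torus E) (v : EuclideanSpace ℝ E) :
    G.secularFactor (x + Torus.mk v) =
      G.secularFactor x * Complex.exp (Complex.I * ((-∑ e, v e : ℝ) : ℂ)) := by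
  have h : -∑ e, (x + Torus.mk v) e = -∑ e, x e + ((-∑ e, v e : ℝ) : AddCircle (2 * π)) := by
    simp only [PiLp.add_apply, Torus.mk_apply, Finset.sum_add_distrib]
    rw [neg_add, AddCircle.coe_neg]
    congr 2
    exact (map_sum (QuotientAddGroup.mk' (AddSubgroup.zmultiples (2 * π))) _ _).symm
  rw [secularFactor, h, phase_add, phase_coe, secularFactor]
  ring

theorem contDiff_coord (e : E) : ContDiff ℝ 1 fun v : EuclideanSpace ℝ E => ((v e : ℝ) : ℂ) :=
  Complex.ofRealCLM.contDiff.comp (EuclideanSpace.proj (𝕜 := ℝ) e).contDiff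

theorem contDiff_localSecular (x : Torus E) : ContDiff ℝ 1 (G.localSecular x) := by
  unfold localSecular
  simp only [secularFactor_add_mk, secular_zero]
  refine ContDiff.mul (contDiff_const.mul (contDiff_const.mul ?_).cexp) ?_
  · simp only [Complex.ofReal_neg, Complex.ofReal_sum]
    exact (ContDiff.sum fun e _ => contDiff_coord e).neg
  · refine ContDiff.matrix_det fun i j => ?_
    simp only [Matrix.sub_apply, torusPhase, Matrix.diagonal_mul, phase_add_mk]
    exact contDiff_const.sub ((contDiff_const.mul
      (contDiff_const.mul (contDiff_coord _)).cexp).mul contDiff_const)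

theorem differentiable_secular_add_single (x : Torus E) (e : E) :
    Differentiable ℝ fun t : ℝ => G.secular (x + Torus.single e t) 0 := by
  simp only [secular_zero]
  refine (ContDiff.matrix_det (k := 1) fun i j => ?_).differentiable one_ne_zero
  simp only [Matrix.sub_apply, torusPhase, Matrix.diagonal_mul, phase_add_single]
  exact contDiff_const.sub ((contDiff_const.mul
    (contDiff_const.mul (contDiff_ofReal_mul _ _)).cexp).mul contDiff_const)

theorem hasDerivAt_localSecular {x : Torus E} (hx : G.secular x 0 = 0) (e : E) :
    HasDerivAt (fun t : ℝ => G.localSecular x (t • EuclideanSpace.single e (1 : ℝ)))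
      (G.secularFactor x * G.secularGrad x e) 0 := by
  have h1 := (G.differentiable_secular_add_single x e 0).hasDerivAt
  have h2 : DifferentiableAt ℝ (fun t : ℝ => G.secularFactor (x + Torus.single e t)) 0 := by
    simp only [← Torus.mk_smul_single, secularFactor_add_mk]
    refine DifferentiableAt.const_mul (DifferentiableAt.cexp (DifferentiableAt.const_mul ?_ _)) _
    simp only [PiLp.smul_apply, smul_eq_mul, ← Finset.mul_sum]
    exact Complex.ofRealCLM.differentiableAt.comp _
      (differentiableAt_id.mul_const _).neg
  have h3 := h2.hasDerivAt.mul h1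
  have h0 : x + Torus.single e 0 = x := by
    rw [← Torus.mk_smul_single, zero_smul, Torus.mk_zero, add_zero]
  simp only [h0, hx, mul_zero, zero_add] at h3
  unfold localSecular
  simp only [Torus.mk_smul_single]
  exact h3

/-- The gradient of the real secular function is a nonzero multiple of the edge weights. -/
theorem IsRealSimple.hasStrictFDerivAt (hD : ∀ v ∈ G.dirichlet, G.degree v = 1) {x : Torus E}
    {a : E × Bool → ℂ} (ha : G.IsRealSimple x a) : ∃ r : ℝ, r ≠ 0 ∧
    HasStrictFDerivAt (fun v => G.realSecular (x + Torus.mk v))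
      (r • innerSL ℝ (WithLp.toLp 2 (edgeWeight a) : EuclideanSpace ℝ E)) 0 := by
  obtain ⟨c, hc, hadj⟩ := ha.exists_adjugate hD
  have hx : G.secular x 0 = 0 := (ha.mem_regularSet hD).1
  have h1 : (fun v => G.realSecular (x + Torus.mk v)) = fun v => (G.localSecular x v).re := rfl
  set z := G.secularFactor x * -(Complex.I * c) with hz
  have hderiv : ∀ e, HasDerivAt
      (fun t : ℝ => G.localSecular x (t • EuclideanSpace.single e (1 : ℝ))) (z * edgeWeight a e) 0 :=
    fun e => (hasDerivAt_localSecular hx e).congr_deriv (by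
      rw [secularGrad_eq ha.ne_zero ha.fixed hadj, hz]
      ring)
  have hz0 : z ≠ 0 := mul_ne_zero (secularFactor_ne_zero hD x)
    (neg_ne_zero.mpr (mul_ne_zero Complex.I_ne_zero hc))
  have him : ∀ v, (G.localSecular x v).im = 0 := fun v => by
    rw [← ofReal_realSecular hD, Complex.ofReal_im]
  -- The function is real, so its derivative z·(weight) along an edge with nonzero weight is real.
  -- This replaces any computation of the argument of c.
  have hzim : z.im = 0 := by
    obtain ⟨d, hd⟩ := exists_ne_zero ha.ne_zero
    have h2 := Complex.imCLM.hasFDerivAt.comp_hasDerivAt (0 : ℝ) (hderiv d.1)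
    have h3 : (Complex.imCLM ∘ fun t : ℝ =>
        G.localSecular x (t • EuclideanSpace.single d.1 (1 : ℝ))) = fun _ => (0 : ℝ) :=
      funext fun t => him _
    rw [h3] at h2
    have h4 := h2.unique (hasDerivAt_const _ _)
    rw [Complex.imCLM_apply, Complex.im_mul_ofReal] at h4
    exact (mul_eq_zero.mp h4).resolve_right (edgeWeight_pos hd).ne'
  refine ⟨z.re, fun h => hz0 (Complex.ext h hzim), ?_⟩
  have h4 : HasStrictFDerivAt (fun v => G.realSecular (x + Torus.mk v))
      (fderiv ℝ (fun v => G.realSecular (x + Torus.mk v)) 0) 0 := by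
    rw [h1]
    exact (Complex.reCLM.contDiff.comp (G.contDiff_localSecular x)).contDiffAt.hasStrictFDerivAt
      one_ne_zero
  suffices h9 : z.re • innerSL ℝ (WithLp.toLp 2 (edgeWeight a) : EuclideanSpace ℝ E) =
      fderiv ℝ (fun v => G.realSecular (x + Torus.mk v)) 0 by rw [h9]; exact h4
  apply ContinuousLinearMap.coe_injective
  refine (EuclideanSpace.basisFun E ℝ).toBasis.ext fun e => ?_
  have h5 := Complex.reCLM.hasFDerivAt.comp_hasDerivAt (0 : ℝ) (hderiv e)
  have h6 : HasDerivAt (fun t : ℝ => t • EuclideanSpace.single e (1 : ℝ))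
      (EuclideanSpace.single e (1 : ℝ)) 0 := by
    simpa using (hasDerivAt_id (0 : ℝ)).smul_const (EuclideanSpace.single e (1 : ℝ))
  have h7 := HasFDerivAt.comp_hasDerivAt (0 : ℝ) (by rw [zero_smul]; exact h4.hasFDerivAt) h6
  have h8 := h5.unique h7
  rw [Complex.reCLM_apply, Complex.re_mul_ofReal] at h8
  simp only [OrthonormalBasis.coe_toBasis, EuclideanSpace.basisFun_apply,
    ContinuousLinearMap.coe_coe, _root_.smul_apply, innerSL_apply_apply, smul_eq_mul]
  rw [← h8, EuclideanSpace.inner_single_right]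
  simp

/-- The unit normal vector is the normalization of the vector of edge weights, up to sign. -/
theorem IsRealSimple.exists_unitNormal_eq (hD : ∀ v ∈ G.dirichlet, G.degree v = 1) {x : Torus E}
    {a : E × Bool → ℂ} (ha : G.IsRealSimple x a) : ∃ s : ℝ, |s| = 1 ∧ G.unitNormal x =
    s • (‖(WithLp.toLp 2 (edgeWeight a) : EuclideanSpace ℝ E)‖⁻¹ •
      (WithLp.toLp 2 (edgeWeight a) : EuclideanSpace ℝ E)) := by
  obtain ⟨r, hr, h⟩ := ha.hasStrictFDerivAt hD
  have h1 : ∀ e, deriv (fun t : ℝ => G.realSecular (x + Torus.single e t)) 0 =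
      r * edgeWeight a e := fun e => by
    have h6 : HasDerivAt (fun t : ℝ => t • EuclideanSpace.single e (1 : ℝ))
        (EuclideanSpace.single e (1 : ℝ)) 0 := by
      simpa using (hasDerivAt_id (0 : ℝ)).smul_const (EuclideanSpace.single e (1 : ℝ))
    have h7 := HasFDerivAt.comp_hasDerivAt (0 : ℝ) (by rw [zero_smul]; exact h.hasFDerivAt) h6
    have h8 : ((fun v => G.realSecular (x + Torus.mk v)) ∘
        fun t : ℝ => t • EuclideanSpace.single e (1 : ℝ)) =
        fun t : ℝ => G.realSecular (x + Torus.single e t) := by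
      funext t
      rw [Function.comp_apply, Torus.mk_smul_single]
    rw [h8] at h7
    rw [h7.deriv]
    simp [EuclideanSpace.inner_single_right]
  have h2 : (WithLp.toLp 2 fun e => deriv (fun t : ℝ => G.realSecular (x + Torus.single e t)) 0 :
      EuclideanSpace ℝ E) = r • (WithLp.toLp 2 (edgeWeight a) : EuclideanSpace ℝ E) := by
    ext e
    simp [h1]
  refine ⟨|r|⁻¹ * r, by rw [abs_mul, abs_inv, abs_abs, inv_mul_cancel₀ (abs_ne_zero.mpr hr)], ?_⟩
  rw [unitNormal]
  simp only [h2, norm_smul, Real.norm_eq_abs, mul_inv, smul_smul]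
  congr 1
  ring

end Normal

end MetricGraph

end

noncomputable section

namespace MetricGraph

variable {V E : Type*} [Fintype V] [Fintype E] [DecidableEq V] [DecidableEq E]

/-! ### Isometric lifts from the torus to Euclidean space -/

section Charts

open Filter Topology
open scoped InnerProductSpace NNReal

theorem exists_coe_eq_and_abs_eq (θ : AddCircle (2 * π)) :
    ∃ t : ℝ, (t : AddCircle (2 * π)) = θ ∧ |t| = ‖θ‖ := by
  obtain ⟨s, rfl⟩ := QuotientAddGroup.mk_surjective θ
  refine ⟨s - round ((2 * π)⁻¹ * s) * (2 * π), ?_, (AddCircle.norm_eq (2 * π)).symm⟩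
  rw [AddCircle.coe_sub, ← zsmul_eq_mul, AddCircle.coe_zsmul, AddCircle.coe_period, smul_zero,
    sub_zero]

/-- The representative of smallest absolute value. -/
def realRep (θ : AddCircle (2 * π)) : ℝ := (exists_coe_eq_and_abs_eq θ).choose

theorem coe_realRep (θ : AddCircle (2 * π)) : (realRep θ : AddCircle (2 * π)) = θ :=
  (exists_coe_eq_and_abs_eq θ).choose_spec.1

theorem abs_realRep (θ : AddCircle (2 * π)) : |realRep θ| = ‖θ‖ :=
  (exists_coe_eq_and_abs_eq θ).choose_spec.2

theorem norm_coe_eq_abs {t : ℝ} (h : |t| ≤ π) : ‖(t : AddCircle (2 * π))‖ = |t| := by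
  rw [AddCircle.norm_coe_eq_abs_iff _ (by positivity), abs_of_pos Real.two_pi_pos]
  linarith

/-- Below π/2 the differences of representatives stay at most π, so the lift preserves distances
exactly and later distortion comes only from the projection to the hyperplane. -/
theorem abs_realRep_sub {θ η : AddCircle (2 * π)} (hθ : ‖θ‖ < π / 2) (hη : ‖η‖ < π / 2) :
    |realRep θ - realRep η| = ‖θ - η‖ := by
  rw [← abs_realRep] at hθ hη
  have h : |realRep θ - realRep η| ≤ π := (abs_sub _ _).trans (by linarith)
  rw [← norm_coe_eq_abs h, AddCircle.coe_sub, coe_realRep, coe_realRep]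

theorem realRep_neg {θ : AddCircle (2 * π)} (hθ : ‖θ‖ < π / 2) : realRep (-θ) = -realRep θ := by
  have h1 := abs_realRep θ
  have h2 := abs_realRep (-θ)
  rw [norm_neg] at h2
  have h : |realRep (-θ) + realRep θ| ≤ π := (abs_add_le _ _).trans (by linarith)
  have h3 := norm_coe_eq_abs h
  rw [AddCircle.coe_add, coe_realRep, coe_realRep, neg_add_cancel, norm_zero] at h3
  linarith [abs_eq_zero.mp h3.symm]

/-- The smallest lift of a point of the torus to the Euclidean space. -/
def Torus.lift (x : Torus E) : EuclideanSpace ℝ E := WithLp.toLp 2 fun e => realRep (x e)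

theorem Torus.mk_lift (x : Torus E) : Torus.mk (Torus.lift x) = x := by
  ext e
  exact coe_realRep (x e)

theorem Torus.norm_lift_sub (x y : Torus E) : ‖Torus.lift (x - y)‖ = dist x y := by
  rw [EuclideanSpace.norm_eq, PiLp.dist_eq_of_L2]
  refine congrArg _ (Finset.sum_congr rfl fun e _ => ?_)
  rw [Real.norm_eq_abs, dist_eq_norm]
  exact congrArg (· ^ 2) (abs_realRep _)

theorem Torus.norm_lift_sub_lift {x y z : Torus E} (hx : ∀ e, ‖x e - z e‖ < π / 2)
    (hy : ∀ e, ‖y e - z e‖ < π / 2) :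
    ‖Torus.lift (x - z) - Torus.lift (y - z)‖ = dist x y := by
  rw [EuclideanSpace.norm_eq, PiLp.dist_eq_of_L2]
  refine congrArg _ (Finset.sum_congr rfl fun e _ => ?_)
  rw [Real.norm_eq_abs, dist_eq_norm]
  refine congrArg (· ^ 2) ((abs_realRep_sub (hx e) (hy e)).trans ?_)
  rw [sub_sub_sub_cancel_right]

theorem Torus.tendsto_lift_sub (x : Torus E) :
    Tendsto (fun y : Torus E => Torus.lift (y - x)) (𝓝 x) (𝓝 0) := by
  rw [tendsto_zero_iff_norm_tendsto_zero]
  simp only [Torus.norm_lift_sub]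
  exact (continuous_id.dist continuous_const).tendsto' _ _ (dist_self x)

variable {G : MetricGraph V E}

/-- Near a regular point the secular manifold is almost orthogonal to the vector of edge weights. -/
theorem IsRealSimple.eventually_inner_le (hD : ∀ v ∈ G.dirichlet, G.degree v = 1) {x : Torus E}
    {a : E × Bool → ℂ} (ha : G.IsRealSimple x a) {δ : ℝ} (hδ : 0 < δ) :
    ∃ U ∈ 𝓝 x, ∀ y ∈ U, (∀ e, ‖y e - x e‖ < π / 2) ∧ ∀ z ∈ U,
      G.secular y 0 = 0 → G.secular z 0 = 0 →
      |⟪(WithLp.toLp 2 (edgeWeight a) : EuclideanSpace ℝ E),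
        Torus.lift (y - x) - Torus.lift (z - x)⟫_ℝ| ≤ δ * dist y z := by
  obtain ⟨r, hr, h⟩ := ha.hasStrictFDerivAt hD
  have h1 := h.isLittleO.def (mul_pos (abs_pos.mpr hr) hδ)
  have h2 : Tendsto (fun y : Torus E × Torus E => (Torus.lift (y.1 - x), Torus.lift (y.2 - x)))
      (𝓝 x ×ˢ 𝓝 x) (𝓝 ((0 : EuclideanSpace ℝ E), (0 : EuclideanSpace ℝ E))) := by
    rw [nhds_prod_eq]
    exact ((Torus.tendsto_lift_sub x).comp tendsto_fst).prodMk
      ((Torus.tendsto_lift_sub x).comp tendsto_snd)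
  obtain ⟨U, hU, hUU⟩ := eventually_prod_self_iff
    (r := fun y z => ‖G.realSecular (x + Torus.mk (Torus.lift (y - x))) -
      G.realSecular (x + Torus.mk (Torus.lift (z - x))) -
      (r • innerSL ℝ (WithLp.toLp 2 (edgeWeight a) : EuclideanSpace ℝ E))
        (Torus.lift (y - x) - Torus.lift (z - x))‖ ≤
      |r| * δ * ‖Torus.lift (y - x) - Torus.lift (z - x)‖) |>.mp (h2.eventually h1)
  have h3 : ∀ᶠ y in 𝓝 x, ∀ e, ‖y e - x e‖ < π / 2 := by
    rw [eventually_all]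
    intro e
    have h4 : Tendsto (fun y : Torus E => ‖y e - x e‖) (𝓝 x) (𝓝 0) :=
      (((continuous_torus_apply e).sub continuous_const).norm).tendsto' _ _ (by simp)
    exact h4.eventually_lt_const (by positivity)
  refine ⟨U ∩ {y | ∀ e, ‖y e - x e‖ < π / 2}, inter_mem hU h3, fun y hy =>
    ⟨hy.2, fun z hz hy0 hz0 => ?_⟩⟩
  have h5 := hUU y hy.1 z hz.1
  have h6 : ∀ w, x + Torus.mk (Torus.lift (w - x)) = w := fun w => by
    rw [Torus.mk_lift, add_sub_cancel]
  have h7 : ∀ w, G.secular w 0 = 0 → G.realSecular w = 0 := fun w hw => by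
    rw [realSecular_eq, hw, mul_zero, Complex.zero_re]
  -- The real secular function vanishes at both points, so the strict derivative estimate bounds the
  -- linear term itself.
  simp only [h6, h7 y hy0, h7 z hz0, sub_zero, zero_sub, norm_neg] at h5
  rw [Torus.norm_lift_sub_lift hy.2 hz.2, _root_.smul_apply, innerSL_apply_apply, norm_smul,
    Real.norm_eq_abs, Real.norm_eq_abs, mul_assoc] at h5
  exact le_of_mul_le_mul_left h5 (abs_pos.mpr hr)

end Charts

/-! ### Projection to the tangent hyperplane along a coordinate -/

section Hyperplane

open scoped InnerProductSpace

variable (p : EuclideanSpace ℝ E)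

/-- The hyperplane orthogonal to `p`. -/
abbrev hyperplane : Submodule ℝ (EuclideanSpace ℝ E) := LinearMap.ker (innerₛₗ ℝ p)

theorem mem_hyperplane {p u : EuclideanSpace ℝ E} : u ∈ hyperplane p ↔ ⟪p, u⟫_ℝ = 0 := by
  rw [LinearMap.mem_ker, innerₛₗ_apply_apply]

variable {p} {e₀ : E}

theorem finrank_hyperplane (hp : p e₀ ≠ 0) : Module.finrank ℝ (hyperplane p) = Fintype.card E - 1 := by
  have h : (innerₛₗ ℝ p : Module.Dual ℝ (EuclideanSpace ℝ E)) ≠ 0 := fun h => by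
    have h1 := LinearMap.congr_fun h (EuclideanSpace.single e₀ 1)
    rw [innerₛₗ_apply_apply, EuclideanSpace.inner_single_right] at h1
    simp [hp] at h1
  have h2 := Module.Dual.finrank_ker_add_one_of_ne_zero h
  rw [finrank_euclideanSpace] at h2
  exact Nat.eq_sub_of_add_eq h2

/-- As p has a nonzero e₀-entry, orthogonality to p determines the remaining coordinate. This is why
the coordinate of the bridge never has to be controlled. -/
theorem hyperplane_ext (hp : p e₀ ≠ 0) {u w : hyperplane p}
    (h : ∀ e, e ≠ e₀ → (u : EuclideanSpace ℝ E) e = (w : EuclideanSpace ℝ E) e) : u = w := by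
  have h1 : ⟪p, (u - w : EuclideanSpace ℝ E)⟫_ℝ = 0 :=
    mem_hyperplane.mp (u - w).2
  rw [PiLp.inner_apply, Finset.sum_eq_single e₀ (fun e _ he => by simp [h e he]) (by simp)] at h1
  refine Subtype.ext (PiLp.ext fun e => ?_)
  by_cases he : e = e₀
  · subst he
    simpa [hp, sub_eq_zero] using h1
  · exact h e he

/-- The projection to the hyperplane along a coordinate direction. -/
def shear (hp : p e₀ ≠ 0) : EuclideanSpace ℝ E →ₗ[ℝ] hyperplane p :=
  LinearMap.codRestrict _
    (LinearMap.id - (LinearMap.toSpanSingleton ℝ _ (EuclideanSpace.single e₀ (p e₀)⁻¹)).comp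
      (innerₛₗ ℝ p)) fun u => by
    rw [mem_hyperplane]
    simp [inner_sub_right, inner_smul_right, EuclideanSpace.inner_single_right, hp]

theorem coe_shear (hp : p e₀ ≠ 0) (u : EuclideanSpace ℝ E) : (shear hp u : EuclideanSpace ℝ E) =
    u - ⟪p, u⟫_ℝ • EuclideanSpace.single e₀ (p e₀)⁻¹ := rfl

theorem shear_apply (hp : p e₀ ≠ 0) {u : EuclideanSpace ℝ E} {e : E} (he : e ≠ e₀) :
    (shear hp u : EuclideanSpace ℝ E) e = u e := by
  rw [coe_shear]
  simp [he]

theorem norm_shear_sub_le (hp : p e₀ ≠ 0) {u : EuclideanSpace ℝ E} {δ : ℝ} (hu : |⟪p, u⟫_ℝ| ≤ δ * |p e₀| * ‖u‖) :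
    ‖(shear hp u : EuclideanSpace ℝ E) - u‖ ≤ δ * ‖u‖ := by
  have h : 0 < |p e₀| := abs_pos.mpr hp
  rw [coe_shear, sub_sub_cancel_left, norm_neg, norm_smul, PiLp.norm_single, norm_inv,
    Real.norm_eq_abs, Real.norm_eq_abs, ← div_eq_mul_inv, div_le_iff₀ h]
  linarith

/-- Multiplication of the coordinates off `e₀` by given factors, as a map of the hyperplane. -/
def signMap (hp : p e₀ ≠ 0) (s : E → ℝ) : hyperplane p →ₗ[ℝ] hyperplane p :=
  (shear hp).comp ((WithLp.linearEquiv 2 ℝ (E → ℝ)).symm.toLinearMap.comp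
    ((LinearMap.pi fun e => s e • LinearMap.proj e).comp
      ((WithLp.linearEquiv 2 ℝ (E → ℝ)).toLinearMap.comp (hyperplane p).subtype)))

theorem signMap_apply (hp : p e₀ ≠ 0) (s : E → ℝ) (w : hyperplane p) {e : E} (he : e ≠ e₀) :
    (signMap hp s w : EuclideanSpace ℝ E) e = s e * (w : EuclideanSpace ℝ E) e :=
  shear_apply hp he

theorem signMap_signMap (hp : p e₀ ≠ 0) {s : E → ℝ} (hs : ∀ e, s e * s e = 1) (w : hyperplane p) :
    signMap hp s (signMap hp s w) = w := by
  refine hyperplane_ext hp fun e he => ?_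
  rw [signMap_apply hp s _ he, signMap_apply hp s _ he, ← mul_assoc, hs, one_mul]

end Hyperplane

/-! ### Invariance of the Barra–Gaspard measure -/

section Invariance

open Filter Topology
open scoped InnerProductSpace NNReal ENNReal

variable {G : MetricGraph V E}

theorem realRep_mul {s : ℝ} (hs : s = 1 ∨ s = -1) {θ η : AddCircle (2 * π)} (hθ : ‖θ‖ < π / 2)
    (h : s = 1 ∧ η = θ ∨ s = -1 ∧ η = -θ) : realRep η = s * realRep θ := by
  rcases h with ⟨rfl, rfl⟩ | ⟨rfl, rfl⟩
  · rw [one_mul]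
  · rw [realRep_neg hθ, neg_one_mul]

/-- A homeomorphism of the generic part of the secular manifold is a sign reflection over `e₀` if
it acts by signs on all coordinates but the one of `e₀` and preserves the edge weights. -/
structure IsSignReflection (Φ : G.genericSet ≃ₜ G.genericSet) (e₀ : E) : Prop where
  sign : ∀ e, e ≠ e₀ → (∀ x, (Φ x : Torus E) e = (x : Torus E) e) ∨
    ∀ x, (Φ x : Torus E) e = -(x : Torus E) e
  weight : ∀ x : G.genericSet, ∃ a a', G.IsGenericVec x a ∧ G.IsGenericVec (Φ x) a' ∧
    edgeWeight a' = edgeWeight a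

theorem IsSignReflection.symm {Φ : G.genericSet ≃ₜ G.genericSet} {e₀ : E}
    (h : IsSignReflection Φ e₀) : IsSignReflection Φ.symm e₀ where
  sign e he := by
    refine (h.sign e he).imp (fun h x => ?_) fun h x => ?_
    · rw [← h, Φ.apply_symm_apply]
    · have := h (Φ.symm x)
      rw [Φ.apply_symm_apply] at this
      rw [this, neg_neg]
  weight x := by
    obtain ⟨a, a', ha, ha', h⟩ := h.weight (Φ.symm x)
    rw [Φ.apply_symm_apply] at ha'
    exact ⟨a', a, ha', ha, h.symm⟩

theorem secular_eq_zero_of_mem (x : G.genericSet) : G.secular (x : Torus E) 0 = 0 := x.2.1.1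

/-- The secular manifold is projected along e₀ to the hyperplane orthogonal to the edge weights,
around x₀ and around its image. In these charts the map is exactly the linear sign map, and the
charts are almost isometric. -/
theorem IsSignReflection.hausdorffMeasure_image_le_of_subset (hG : G.IsNontrivialStandard)
    {Φ : G.genericSet ≃ₜ G.genericSet} {e₀ : E} (h : IsSignReflection Φ e₀) {ε : ℝ≥0} (hε : 0 < ε)
    (x₀ : G.genericSet) : ∃ U ∈ 𝓝 x₀, ∀ A ⊆ U,
    μH[(Fintype.card E - 1 : ℕ)] (Φ '' A) ≤
      (1 + ε : ℝ≥0) * μH[(Fintype.card E - 1 : ℕ)] A := by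
  have hD := hG.dirichlet_degree
  obtain ⟨δ, hδ0, hδ1, hδ⟩ := exists_distortion_le (Fintype.card E - 1) hε
  obtain ⟨a, a', ha, ha', hw⟩ := h.weight x₀
  set p : EuclideanSpace ℝ E := WithLp.toLp 2 (edgeWeight a) with hpdef
  have hp0 : 0 < p e₀ := edgeWeight_pos (d := (e₀, true)) (ha.apply_ne_zero hG _)
  have hp : p e₀ ≠ 0 := hp0.ne'
  have hδp : 0 < (δ : ℝ) * |p e₀| := mul_pos hδ0 (abs_pos.mpr hp)
  obtain ⟨U, hU, hUU⟩ := ha.toIsRealSimple.eventually_inner_le hD hδp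
  obtain ⟨U', hU', hUU'⟩ := ha'.toIsRealSimple.eventually_inner_le hD hδp
  -- Equal weights make the same hyperplane serve as target of both charts.
  rw [hw] at hUU'
  -- The value at e₀ has no effect, since the projection kills that direction.
  let s : E → ℝ := fun e => open Classical in
    if ∀ x, (Φ x : Torus E) e = (x : Torus E) e then 1 else -1
  have hs : ∀ e, s e * s e = 1 := fun e => by
    simp only [s]
    split_ifs <;> norm_num
  have hsΦ : ∀ e, e ≠ e₀ → ∀ x : G.genericSet, s e = 1 ∧ (Φ x : Torus E) e = (x : Torus E) e ∨
      s e = -1 ∧ (Φ x : Torus E) e = -(x : Torus E) e := fun e he x => by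
    simp only [s]
    split_ifs with h1
    · exact Or.inl ⟨rfl, h1 x⟩
    · exact Or.inr ⟨rfl, (h.sign e he).resolve_left h1 x⟩
  let q : G.genericSet → hyperplane p := fun x => shear hp (Torus.lift ((x : Torus E) - x₀))
  let q' : G.genericSet → hyperplane p := fun x => shear hp (Torus.lift ((x : Torus E) - Φ x₀))
  refine ⟨(Subtype.val ⁻¹' U) ∩ Φ ⁻¹' (Subtype.val ⁻¹' U'),
    inter_mem (continuous_subtype_val.continuousAt hU)
      (Φ.continuous.continuousAt (continuous_subtype_val.continuousAt hU')), fun A hA => ?_⟩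
  have hclose : ∀ {x₁ : G.genericSet} {W : Set (Torus E)},
      (∀ y ∈ W, (∀ e, ‖y e - (x₁ : Torus E) e‖ < π / 2) ∧ ∀ z ∈ W,
      G.secular y 0 = 0 → G.secular z 0 = 0 →
      |⟪p, Torus.lift (y - (x₁ : Torus E)) - Torus.lift (z - (x₁ : Torus E))⟫_ℝ| ≤ δ * |p e₀| * dist y z) →
      ∀ x y : G.genericSet, (x : Torus E) ∈ W → (y : Torus E) ∈ W →
      |dist (shear hp (Torus.lift ((x : Torus E) - x₁))) (shear hp (Torus.lift ((y : Torus E) - x₁)))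
        - dist x y| ≤ δ * dist x y := by
    intro x₁ W hW x y hx hy
    have h1 := (hW x hx).2 y hy (secular_eq_zero_of_mem x) (secular_eq_zero_of_mem y)
    have h2 := Torus.norm_lift_sub_lift (hW x hx).1 (hW y hy).1
    rw [← h2] at h1
    have h3 := norm_shear_sub_le hp h1
    rw [Subtype.dist_eq x y, ← h2, dist_eq_norm, ← map_sub, Submodule.coe_norm]
    exact (abs_norm_sub_norm_le _ _).trans h3
  have key := hausdorffMeasure_image_le_of_charts (f := Φ) (q := q) (q' := q')
    (T := signMap hp s) (signMap_signMap hp hs) (K := 1 + δ) (K' := (1 - δ)⁻¹) (A := A)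
    ?_ ?_ ?_ (finrank_hyperplane hp)
  · refine key.trans (mul_le_mul_left ?_ _)
    rw [← ENNReal.coe_pow]
    exact ENNReal.coe_le_coe.mpr hδ
  · intro x hx
    refine hyperplane_ext hp fun e he => ?_
    rw [signMap_apply hp s _ he, shear_apply hp he, shear_apply hp he]
    have h1 := (hUU x (hA hx).1).1 e
    refine realRep_mul ((hsΦ e he x).imp And.left And.left) h1 ?_
    rcases hsΦ e he x with ⟨h2, h3⟩ | ⟨h2, h3⟩ <;>
    rcases hsΦ e he x₀ with ⟨h4, h5⟩ | ⟨h4, h5⟩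
    · exact Or.inl ⟨h2, by rw [PiLp.sub_apply, PiLp.sub_apply, h3, h5]⟩
    · rw [h2] at h4
      norm_num at h4
    · rw [h2] at h4
      norm_num at h4
    · exact Or.inr ⟨h2, by rw [PiLp.sub_apply, PiLp.sub_apply, h3, h5]; abel⟩
  · refine LipschitzOnWith.of_dist_le_mul fun x hx y hy => ?_
    have h1 := abs_le.mp (hclose hUU x y (hA hx).1 (hA hy).1)
    rw [NNReal.coe_add, NNReal.coe_one, add_mul, one_mul]
    linarith [h1.2]
  · intro x hx y hy
    have h1 := abs_le.mp (hclose hUU' (Φ x) (Φ y) (hA hx).2 (hA hy).2)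
    have h2 : (0 : ℝ) < 1 - δ := sub_pos.mpr (by exact_mod_cast hδ1)
    rw [NNReal.coe_inv, NNReal.coe_sub hδ1.le, NNReal.coe_one, ← div_eq_inv_mul, le_div_iff₀ h2]
    linarith [h1.1]

theorem IsSignReflection.hausdorffMeasure_image (hG : G.IsNontrivialStandard)
    {Φ : G.genericSet ≃ₜ G.genericSet} {e₀ : E} (h : IsSignReflection Φ e₀) {A : Set G.genericSet}
    (hA : MeasurableSet A) :
    μH[(Fintype.card E - 1 : ℕ)] (Φ '' A) = μH[(Fintype.card E - 1 : ℕ)] A := by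
  refine le_antisymm (measure_image_le_of_locally Φ
    (fun ε hε x => h.hausdorffMeasure_image_le_of_subset hG hε x) hA) ?_
  have hΦA : MeasurableSet (Φ '' A) :=
    Φ.toMeasurableEquiv.measurableEmbedding.measurableSet_image.mpr hA
  have h1 := measure_image_le_of_locally (μ := μH[(Fintype.card E - 1 : ℕ)]) Φ.symm
    (fun ε hε x => h.symm.hausdorffMeasure_image_le_of_subset hG hε x) hΦA
  rwa [← Set.image_comp, show (Φ.symm ∘ Φ : G.genericSet → G.genericSet) = id from
    funext Φ.symm_apply_apply, Set.image_id] at h1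

theorem IsSignReflection.measurePreserving_euclideanHausdorffMeasure (hG : G.IsNontrivialStandard)
    {Φ : G.genericSet ≃ₜ G.genericSet} {e₀ : E} (h : IsSignReflection Φ e₀) :
    MeasurePreserving Φ (Measure.euclideanHausdorffMeasure (Fintype.card E - 1))
      (Measure.euclideanHausdorffMeasure (Fintype.card E - 1)) := by
  have h1 : MeasurePreserving Φ (μH[(Fintype.card E - 1 : ℕ)] : Measure G.genericSet)
      μH[(Fintype.card E - 1 : ℕ)] := by
    refine ⟨Φ.continuous.measurable, Measure.ext fun A hA => ?_⟩
    rw [Measure.map_apply Φ.continuous.measurable hA,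
      ← h.hausdorffMeasure_image hG (Φ.continuous.measurable hA), Φ.image_preimage]
  exact h1.smul_measure _

/-- Up to sign the normal is the normalized weight vector, so the density depends on the weights
only. -/
theorem abs_sum_unitNormal_eq (hD : ∀ v ∈ G.dirichlet, G.degree v = 1) {x x' : Torus E}
    {a a' : E × Bool → ℂ} (ha : G.IsRealSimple x a) (ha' : G.IsRealSimple x' a')
    (hw : edgeWeight a' = edgeWeight a) :
    |∑ e, G.unitNormal x' e * G.length e| = |∑ e, G.unitNormal x e * G.length e| := by
  obtain ⟨s, hs, h⟩ := ha.exists_unitNormal_eq hD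
  obtain ⟨s', hs', h'⟩ := ha'.exists_unitNormal_eq hD
  rw [h, h', hw]
  simp only [PiLp.smul_apply, smul_eq_mul, mul_assoc]
  simp only [← Finset.mul_sum, abs_mul, hs, hs']

theorem IsSignReflection.measurePreserving_fluxMeasure (hG : G.IsNontrivialStandard)
    {Φ : G.genericSet ≃ₜ G.genericSet} {e₀ : E} (h : IsSignReflection Φ e₀) :
    MeasurePreserving Φ G.fluxMeasure G.fluxMeasure := by
  refine ⟨Φ.continuous.measurable, Measure.ext fun A hA => ?_⟩
  have h1 : ∀ x : G.genericSet, |∑ e, G.unitNormal (Φ x : Torus E) e * G.length e| =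
      |∑ e, G.unitNormal (x : Torus E) e * G.length e| := fun x => by
    obtain ⟨a, a', ha, ha', hw⟩ := h.weight x
    exact abs_sum_unitNormal_eq hG.dirichlet_degree ha.toIsRealSimple ha'.toIsRealSimple hw
  have h2 := (h.measurePreserving_euclideanHausdorffMeasure hG).setLIntegral_comp_preimage_emb
    Φ.toMeasurableEquiv.measurableEmbedding
    (fun x => ENNReal.ofReal |∑ e, G.unitNormal (x : Torus E) e * G.length e|) A
  simp only [h1] at h2
  rw [Measure.map_apply Φ.continuous.measurable hA, fluxMeasure,
    withDensity_apply _ (Φ.continuous.measurable hA), withDensity_apply _ hA]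
  exact h2

theorem IsSignReflection.measurePreserving_barraGaspard (hG : G.IsNontrivialStandard)
    {Φ : G.genericSet ≃ₜ G.genericSet} {e₀ : E} (h : IsSignReflection Φ e₀) :
    MeasurePreserving Φ G.barraGaspard G.barraGaspard :=
  (h.measurePreserving_fluxMeasure hG).smul_measure _

theorem isSignReflection_bridgeHomeomorph (hG : G.IsNontrivialStandard) {W : Finset V}
    {d : E × Bool} (hd : G.IsCutEdge W d) {H : G.Subgraph} (hH : EdgesIn H W)
    {θ : (H.edges → AddCircle (2 * π)) → ℝ} (hθ : IsBridgePhase H d θ) :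
    IsSignReflection (bridgeHomeomorph hG hd hH hθ) d.1 where
  sign e he := by
    simp only [coe_bridgeHomeomorph, bridgeMap, if_neg he]
    by_cases h : e ∈ H.edges
    · exact Or.inl fun x => if_pos h
    · exact Or.inr fun x => if_neg h
  weight x := by
    obtain ⟨a, ha⟩ := exists_isGenericVec hG.dirichlet_degree x.2
    exact ⟨a, G.mirrorVec W a, ha,
      (isMirror_bridgeMap hd hH hθ x.2 ha.toIsRealSimple).isGenericVec hG ha hd,
      funext fun e => edgeWeight_mirrorVec W a e⟩

theorem isSignReflection_inversion (hG : G.IsNontrivialStandard) (e₀ : E) :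
    IsSignReflection (inversion hG) e₀ where
  sign e _ := Or.inr fun x => rfl
  weight x := by
    obtain ⟨a, ha⟩ := exists_isGenericVec hG.dirichlet_degree x.2
    exact ⟨a, G.mirrorVec ∅ a, ha, ha.neg hG, funext fun e => edgeWeight_mirrorVec ∅ a e⟩

theorem measurePreserving_inversion (hG : G.IsNontrivialStandard) :
    MeasurePreserving (inversion hG) G.barraGaspard G.barraGaspard := by
  rcases isEmpty_or_nonempty E with hE | ⟨⟨e₀⟩⟩
  -- Without edges there is no e₀ to project along, but then there are no nonzero amplitudes and no
  -- generic points.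
  · have h : IsEmpty G.genericSet := ⟨fun x => by
      obtain ⟨a, ha⟩ := exists_isGenericVec hG.dirichlet_degree x.2
      exact ha.ne_zero (Subsingleton.elim _ _)⟩
    rw [Measure.eq_zero_of_isEmpty G.barraGaspard]
    exact ⟨(inversion hG).continuous.measurable, by simp⟩
  · exact (isSignReflection_inversion hG e₀).measurePreserving_barraGaspard hG

end Invariance

end MetricGraph

end

noncomputable section

namespace MetricGraph

variable {V E : Type*} [Fintype V] [Fintype E] [DecidableEq V] [DecidableEq E]

/-! ### Every cut edge gives an edge separation into two blocks -/

section CutEdge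

variable {G : MetricGraph V E} {W : Finset V} {d : E × Bool}

theorem IsCutEdge.mem_edges_of_reflTransGen (hd : G.IsCutEdge W d) {T : Finset E} {u v : V}
    (h : Relation.ReflTransGen
      (fun a b => ∃ d : E × Bool, d.1 ∈ T ∧ G.origin d = a ∧ G.terminus d = b) u v)
    (hu : u ∈ W) (hv : v ∉ W) : d.1 ∈ T := by
  induction h with
  | refl => exact absurd hu hv
  | @tail b c _ hbc ih =>
    by_cases hb : b ∈ W
    · obtain ⟨d', hd', rfl, rfl⟩ := hbc
      rwa [← hd.eq_of_leaves d' hb hv]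
    · exact ih hb

/-- A cut edge belongs to every spanning tree and so never carries a flux. Hence the bridge needs no
entry in the surplus matrices. -/
theorem IsCutEdge.notMem_cut (hd : G.IsCutEdge W d) {C : Finset E} (hC : G.IsCut C) : d.1 ∉ C := by
  have h := hd.mem_edges_of_reflTransGen
    (hC.1.2 _ (Finset.mem_univ (G.origin d)) _ (Finset.mem_univ (G.terminus d)))
    hd.origin_mem hd.terminus_notMem
  exact (Finset.mem_sdiff.mp h).2

instance (G : MetricGraph V E) (W : Finset V) : DecidablePred (G.EdgeIn W) := fun e => by
  unfold EdgeIn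
  infer_instance

/-- The subgraph inside of a set of vertices. -/
def insideSubgraph (G : MetricGraph V E) (W : Finset V) : G.Subgraph where
  verts := W
  edges := Finset.univ.filter fun e => G.EdgeIn W e
  src_mem e he := ((Finset.mem_filter.mp he).2 (e, true) rfl).1
  tgt_mem e he := ((Finset.mem_filter.mp he).2 (e, false) rfl).1

theorem edgesIn_insideSubgraph (W : Finset V) : EdgesIn (G.insideSubgraph W) W := fun e => by
  simp [insideSubgraph]

theorem IsCutEdge.origin_mem_of_not_edgeIn (hd : G.IsCutEdge W d) {d' : E × Bool}
    (h : ¬G.EdgeIn W d'.1) : G.origin d' ∈ insert (G.origin d) Wᶜ := by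
  rw [Finset.mem_insert, Finset.mem_compl]
  by_cases ho : G.origin d' ∈ W
  · left
    rw [hd.eq_of_leaves d' ho fun ht => h (edgeIn_of_mem ho ht)]
  · exact Or.inr ho

/-- The subgraph of the edges which are not inside of a set of vertices with one outgoing edge. -/
def IsCutEdge.outsideSubgraph (hd : G.IsCutEdge W d) : G.Subgraph where
  verts := insert (G.origin d) Wᶜ
  edges := Finset.univ.filter fun e => ¬G.EdgeIn W e
  src_mem e he := hd.origin_mem_of_not_edgeIn (d' := (e, true)) (Finset.mem_filter.mp he).2
  tgt_mem e he := hd.origin_mem_of_not_edgeIn (d' := (e, false)) (Finset.mem_filter.mp he).2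

theorem IsCutEdge.mem_outsideSubgraph_edges (hd : G.IsCutEdge W d) (e : E) :
    e ∈ hd.outsideSubgraph.edges ↔ ¬G.EdgeIn W e := by
  simp [outsideSubgraph]

/-- Collapsing the complement of W to the origin of the cut edge turns any path of the graph into a
path inside W. -/
theorem IsCutEdge.connected_insideSubgraph (hd : G.IsCutEdge W d)
    (hG : (G.spanning Finset.univ).Connected) : (G.insideSubgraph W).Connected := by
  refine ⟨⟨_, hd.origin_mem⟩, fun u hu v hv => ?_⟩
  have h := (hG.2 u (Finset.mem_univ u) v (Finset.mem_univ v)).lift'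
    (p := fun a b => ∃ d : E × Bool, d.1 ∈ (G.insideSubgraph W).edges ∧ G.origin d = a ∧
      G.terminus d = b) (fun w => if w ∈ W then w else G.origin d) (by
    rintro _ _ ⟨d', -, rfl, rfl⟩
    by_cases ho : G.origin d' ∈ W <;> by_cases ht : G.terminus d' ∈ W
    · simp only [Function.onFun, ho, ht, if_true]
      exact .single ⟨d', (edgesIn_insideSubgraph W _).mpr (edgeIn_of_mem ho ht), rfl, rfl⟩
    · simp only [Function.onFun, ho, ht, if_true, if_false]
      rw [hd.eq_of_leaves d' ho ht]
    · simp only [Function.onFun, ho, ht, if_true, if_false]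
      rw [← hd.eq_of_leaves (rev d') ht (by simpa using ho)]
      rfl
    · simp only [Function.onFun, ho, ht, if_false]
      rfl)
  have hu' : u ∈ W := hu
  have hv' : v ∈ W := hv
  simpa only [Function.onFun, hu', hv', if_true] using h

theorem IsCutEdge.connected_outsideSubgraph (hd : G.IsCutEdge W d)
    (hG : (G.spanning Finset.univ).Connected) : hd.outsideSubgraph.Connected := by
  refine ⟨⟨_, Finset.mem_insert_self _ _⟩, fun u hu v hv => ?_⟩
  have h := (hG.2 u (Finset.mem_univ u) v (Finset.mem_univ v)).lift'
    (p := fun a b => ∃ d : E × Bool, d.1 ∈ hd.outsideSubgraph.edges ∧ G.origin d = a ∧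
      G.terminus d = b) (fun w => if w ∈ W then G.origin d else w) (by
    rintro _ _ ⟨d', -, rfl, rfl⟩
    by_cases ho : G.origin d' ∈ W <;> by_cases ht : G.terminus d' ∈ W
    · simp only [Function.onFun, ho, ht, if_true]
      rfl
    · simp only [Function.onFun, ho, ht, if_true, if_false]
      rw [hd.eq_of_leaves d' ho ht]
      exact .single ⟨d, (hd.mem_outsideSubgraph_edges _).mpr hd.not_edgeIn, rfl, rfl⟩
    · simp only [Function.onFun, ho, ht, if_true, if_false]
      have h1 := hd.eq_of_leaves (rev d') ht (by simpa using ho)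
      refine .single ⟨d', (hd.mem_outsideSubgraph_edges _).mpr fun h => ho (h d' rfl).1, rfl, ?_⟩
      rw [← h1]
      rfl
    · simp only [Function.onFun, ho, ht, if_false]
      exact .single ⟨d', (hd.mem_outsideSubgraph_edges _).mpr fun h => ho (h d' rfl).1, rfl, rfl⟩)
  have h1 : ∀ w ∈ hd.outsideSubgraph.verts, (if w ∈ W then G.origin d else w) = w := by
    intro w hw
    rcases Finset.mem_insert.mp hw with rfl | hw
    · exact if_pos hd.origin_mem
    · exact if_neg (Finset.mem_compl.mp hw)
  rwa [Function.onFun, h1 u hu, h1 v hv] at h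

/-- The separation of the graph by an edge whose removal disconnects it. -/
def IsCutEdge.separation (hd : G.IsCutEdge W d) : Fin 2 → G.Subgraph :=
  ![G.insideSubgraph W, hd.outsideSubgraph]

theorem IsCutEdge.commonVerts_separation (hd : G.IsCutEdge W d) :
    commonVerts hd.separation 1 = {G.origin d} := by
  ext v
  have h1 : v ∈ commonVerts hd.separation 1 ↔ (v = G.origin d ∨ v ∉ W) ∧ v ∈ W := by
    constructor
    · rintro ⟨h1, i, hi, h2⟩
      obtain rfl : i = 0 := Fin.lt_one_iff i |>.mp hi
      refine ⟨?_, h2⟩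
      have h1' : v ∈ insert (G.origin d) Wᶜ := h1
      simpa using h1'
    · rintro ⟨h1, h2⟩
      refine ⟨?_, 0, Fin.zero_lt_one, h2⟩
      show v ∈ insert (G.origin d) Wᶜ
      simpa using h1
  rw [h1, Set.mem_singleton_iff]
  constructor
  · rintro ⟨h | h, h'⟩
    · exact h
    · exact absurd h' h
  · rintro rfl
    exact ⟨Or.inl rfl, hd.origin_mem⟩

theorem IsCutEdge.isEdgeSeparation (hd : G.IsCutEdge W d)
    (hG : (G.spanning Finset.univ).Connected) : IsEdgeSeparation hd.separation where
  connected j := by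
    fin_cases j
    · exact hd.connected_insideSubgraph hG
    · exact hd.connected_outsideSubgraph hG
  one_common j hj := by
    obtain rfl : j = 1 := by omega
    exact ⟨_, hd.commonVerts_separation⟩
  verts_union v := by
    by_cases h : v ∈ W
    · exact ⟨0, h⟩
    · exact ⟨1, Finset.mem_insert_of_mem (Finset.mem_compl.mpr h)⟩
  edges_union e := by
    by_cases h : G.EdgeIn W e
    · exact ⟨0, (edgesIn_insideSubgraph W e).mpr h⟩
    · exact ⟨1, (hd.mem_outsideSubgraph_edges e).mpr h⟩
  degree_one j hj v hv := by
    obtain rfl : j = 1 := by omega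
    rw [hd.commonVerts_separation, Set.mem_singleton_iff] at hv
    subst hv
    refine Finset.card_eq_one.mpr ⟨d, Finset.ext fun d' => ?_⟩
    simp only [Finset.mem_filter, Finset.mem_univ, true_and, Finset.mem_singleton]
    constructor
    · rintro ⟨h1, h2⟩
      have h3 : ¬G.EdgeIn W d'.1 := (hd.mem_outsideSubgraph_edges _).mp h1
      have h4 : G.origin d' ∈ W := h2 ▸ hd.origin_mem
      exact hd.eq_of_leaves d' h4 fun h5 => h3 (edgeIn_of_mem h4 h5)
    · rintro rfl
      exact ⟨(hd.mem_outsideSubgraph_edges _).mpr hd.not_edgeIn, rfl⟩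

theorem IsCutEdge.isBridge (hd : G.IsCutEdge W d) : IsBridge hd.separation 1 d :=
  ⟨(hd.mem_outsideSubgraph_edges _).mpr hd.not_edgeIn, by rw [hd.commonVerts_separation]; rfl⟩

/-- Holds for any cut edge, so it also applies with the two sides exchanged, where the initial
blocks of a given separation are on the reflected side. -/
theorem IsCutEdge.exists_isBridgeSymmetry (hG : G.IsNontrivialStandard) (hd : G.IsCutEdge W d) :
    ∃ R : G.genericSet ≃ₜ G.genericSet, IsBridgeSymmetry R ∧
      MeasurePreserving R G.barraGaspard G.barraGaspard ∧
      ∀ (x : G.genericSet) a, G.IsGenericVec x a → G.IsMirror W a x (R x) := by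
  have hH : EdgesIn (hd.separation 0) W := G.edgesIn_insideSubgraph W
  obtain ⟨θ, hθ⟩ := exists_isBridgePhase hG hd hH
  exact ⟨bridgeHomeomorph hG hd hH hθ,
    ⟨hd.separation, d, θ, hd.isEdgeSeparation hG.connected, hd.isBridge, hθ, fun _ => rfl⟩,
    (isSignReflection_bridgeHomeomorph hG hd hH hθ).measurePreserving_barraGaspard hG,
    fun x a ha => isMirror_bridgeMap hd hH hθ x.2 ha.toIsRealSimple⟩

end CutEdge

end MetricGraph

end

noncomputable section

namespace MetricGraph

variable {V E : Type*} [Fintype V] [Fintype E] [DecidableEq V] [DecidableEq E]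

/-! ### The tree of blocks of an edge separation -/

section Separation

variable {G : MetricGraph V E} {n : ℕ} {Γ : Fin n → G.Subgraph}

theorem Subgraph.origin_mem (H : G.Subgraph) {d : E × Bool} (hd : d.1 ∈ H.edges) :
    G.origin d ∈ H.verts := by
  unfold origin
  split_ifs
  · exact H.src_mem _ hd
  · exact H.tgt_mem _ hd

theorem Subgraph.terminus_mem (H : G.Subgraph) {d : E × Bool} (hd : d.1 ∈ H.edges) :
    G.terminus d ∈ H.verts :=
  H.origin_mem (d := rev d) hd

theorem IsVertexSeparation.exists_first (h : IsVertexSeparation Γ) (v : V) :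
    ∃ i, v ∈ (Γ i).verts ∧ ∀ j < i, v ∉ (Γ j).verts := by
  obtain ⟨i, hi⟩ := h.verts_union v
  induction i using WellFoundedLT.induction with
  | ind i ih =>
    by_cases h1 : ∃ j < i, v ∈ (Γ j).verts
    · obtain ⟨j, hj, hvj⟩ := h1
      exact ih j hj hvj
    · push Not at h1
      exact ⟨i, hi, h1⟩

/-- The first block which contains a vertex. -/
def IsVertexSeparation.block (h : IsVertexSeparation Γ) (v : V) : Fin n := (h.exists_first v).choose

theorem IsVertexSeparation.mem_block (h : IsVertexSeparation Γ) (v : V) :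
    v ∈ (Γ (h.block v)).verts := (h.exists_first v).choose_spec.1

theorem IsVertexSeparation.block_le (h : IsVertexSeparation Γ) {v : V} {i : Fin n}
    (hv : v ∈ (Γ i).verts) : h.block v ≤ i :=
  not_lt.mp fun hi => (h.exists_first v).choose_spec.2 i hi hv

theorem IsVertexSeparation.mem_commonVerts_iff (h : IsVertexSeparation Γ) {v : V} {i : Fin n}
    (hv : v ∈ (Γ i).verts) : v ∈ commonVerts Γ i ↔ h.block v < i := by
  constructor
  · rintro ⟨-, j, hj, hvj⟩
    exact (h.block_le hvj).trans_lt hj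
  · exact fun hi => ⟨hv, _, hi, h.mem_block v⟩

theorem pos_of_mem_commonVerts {v : V} {i : Fin n} (hv : v ∈ commonVerts Γ i) : 0 < (i : ℕ) := by
  obtain ⟨-, j, hj, -⟩ := hv
  exact Nat.zero_lt_of_lt hj

theorem IsVertexSeparation.eq_of_mem_commonVerts (h : IsVertexSeparation Γ) {u v : V} {i : Fin n}
    (hu : u ∈ commonVerts Γ i) (hv : v ∈ commonVerts Γ i) : u = v := by
  obtain ⟨w, hw⟩ := h.one_common i (pos_of_mem_commonVerts hu)
  rw [hw] at hu hv
  exact (Set.mem_singleton_iff.mp hu).trans (Set.mem_singleton_iff.mp hv).symm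

theorem IsVertexSeparation.block_eq_or_mem (h : IsVertexSeparation Γ) {v : V} {i : Fin n}
    (hv : v ∈ (Γ i).verts) : h.block v = i ∨ v ∈ commonVerts Γ i := by
  rw [h.mem_commonVerts_iff hv]
  exact (h.block_le hv).eq_or_lt

theorem IsEdgeSeparation.eq_of_origin_mem (h : IsEdgeSeparation Γ) {j : Fin n} {d d' : E × Bool}
    (hd : IsBridge Γ j d) (hd' : IsBridge Γ j d') : d' = d := by
  have h1 := h.degree_one j (pos_of_mem_commonVerts hd.2) _ hd.2
  obtain ⟨d₀, hd₀⟩ := Finset.card_eq_one.mp h1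
  have h2 : d ∈ ({d₀} : Finset (E × Bool)) := by
    rw [← hd₀]
    simp [hd.1]
  have h3 : d' ∈ ({d₀} : Finset (E × Bool)) := by
    rw [← hd₀]
    simp [hd'.1, h.eq_of_mem_commonVerts hd'.2 hd.2]
  rw [Finset.mem_singleton.mp h2, Finset.mem_singleton.mp h3]

theorem IsEdgeSeparation.exists_isBridge (h : IsEdgeSeparation Γ) {j : Fin n} (hj : 0 < (j : ℕ)) :
    ∃ d, IsBridge Γ j d := by
  obtain ⟨v, hv⟩ := h.one_common j hj
  have hvm : v ∈ commonVerts Γ j := by rw [hv]; rfl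
  obtain ⟨d, hd⟩ := Finset.card_eq_one.mp (h.degree_one j hj v hvm)
  have h1 : d ∈ ({d} : Finset (E × Bool)) := Finset.mem_singleton_self d
  rw [← hd, Finset.mem_filter] at h1
  exact ⟨d, h1.2.1, h1.2.2 ▸ hvm⟩

/-- Were the far end of the bridge shared with an earlier block, the reversed edge would be a second
bridge at the same vertex. -/
theorem IsEdgeSeparation.block_terminus (h : IsEdgeSeparation Γ) {j : Fin n} {d : E × Bool}
    (hd : IsBridge Γ j d) : h.block (G.terminus d) = j := by
  refine (h.block_eq_or_mem ((Γ j).terminus_mem hd.1)).resolve_right fun h1 => ?_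
  exact rev_ne d (h.eq_of_origin_mem hd ⟨hd.1, h1⟩)

/-- The block `k` is the parent of the block `i`: it is the first block which contains the vertex
shared by the block `i` with the previous ones. -/
def IsVertexSeparation.Parent (h : IsVertexSeparation Γ) (i k : Fin n) : Prop :=
  ∃ v ∈ commonVerts Γ i, h.block v = k

/-- The descendants of a block. -/
def IsVertexSeparation.descendants (h : IsVertexSeparation Γ) (j : Fin n) : Set (Fin n) :=
  {i | Relation.ReflTransGen h.Parent i j}

theorem IsVertexSeparation.Parent.lt {h : IsVertexSeparation Γ} {i k : Fin n} (hp : h.Parent i k) :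
    k < i := by
  obtain ⟨v, hv, rfl⟩ := hp
  exact (h.mem_commonVerts_iff hv.1).mp hv

theorem IsVertexSeparation.self_mem_descendants (h : IsVertexSeparation Γ) (j : Fin n) :
    j ∈ h.descendants j := Relation.ReflTransGen.refl

theorem IsVertexSeparation.le_of_mem_descendants (h : IsVertexSeparation Γ) {i j : Fin n}
    (hi : i ∈ h.descendants j) : j ≤ i := by
  have hi' : Relation.ReflTransGen h.Parent i j := hi
  induction hi' using Relation.ReflTransGen.head_induction_on with
  | refl => exact le_rfl
  | head hp h2 ih => exact (ih h2).trans hp.lt.le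

/-- A vertex of block i first occurs in i or in the parent of i, and for i ≠ j both are descendants
of j or neither is. Hence edges outside block j never cross the split. -/
theorem IsVertexSeparation.block_mem_descendants_iff (h : IsVertexSeparation Γ) {i j : Fin n}
    (hij : i ≠ j) {v : V} (hv : v ∈ (Γ i).verts) :
    h.block v ∈ h.descendants j ↔ i ∈ h.descendants j := by
  rcases h.block_eq_or_mem hv with h1 | h1
  · rw [h1]
  · constructor
    · exact fun h2 => Relation.ReflTransGen.head ⟨v, h1, rfl⟩ h2
    · intro h2
      rcases Relation.ReflTransGen.cases_head h2 with h3 | ⟨k, ⟨w, hw, rfl⟩, h4⟩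
      · exact absurd h3 hij
      · rwa [h.eq_of_mem_commonVerts h1 hw]

open Classical in
/-- The vertices which are not in the block `j` and its descendants, except for the vertex shared
with the previous blocks. -/
def IsVertexSeparation.side (h : IsVertexSeparation Γ) (j : Fin n) : Finset V :=
  Finset.univ.filter fun v => h.block v ∉ h.descendants j

theorem IsVertexSeparation.mem_side (h : IsVertexSeparation Γ) {j : Fin n} {v : V} :
    v ∈ h.side j ↔ h.block v ∉ h.descendants j := by
  simp [side]

theorem IsVertexSeparation.mem_side_of_mem_commonVerts (h : IsVertexSeparation Γ) {j : Fin n}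
    {v : V} (hv : v ∈ commonVerts Γ j) : v ∈ h.side j := by
  rw [h.mem_side]
  exact fun h1 => ((h.le_of_mem_descendants h1).trans_lt
    ((h.mem_commonVerts_iff hv.1).mp hv)).false

theorem IsEdgeSeparation.isCutEdge (h : IsEdgeSeparation Γ) {j : Fin n} {d : E × Bool}
    (hd : IsBridge Γ j d) : G.IsCutEdge (h.side j) d where
  origin_mem := h.mem_side_of_mem_commonVerts hd.2
  terminus_notMem := by
    rw [h.mem_side, h.block_terminus hd, not_not]
    exact h.self_mem_descendants j
  eq_of_leaves d' ho ht := by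
    obtain ⟨i, hi⟩ := h.edges_union d'.1
    rw [h.mem_side] at ho ht
    rw [not_not] at ht
    by_cases hij : i = j
    · subst hij
      rcases h.block_eq_or_mem ((Γ i).origin_mem hi) with h1 | h1
      · exact absurd (h1 ▸ h.self_mem_descendants i) ho
      · exact h.eq_of_origin_mem hd ⟨hi, h1⟩
    · rw [h.block_mem_descendants_iff hij ((Γ i).origin_mem hi)] at ho
      rw [h.block_mem_descendants_iff hij ((Γ i).terminus_mem hi)] at ht
      exact absurd ht ho

theorem IsVertexSeparation.edgeIn_side (h : IsVertexSeparation Γ) {i j : Fin n}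
    (hi : i ∉ h.descendants j) {e : E} (he : e ∈ (Γ i).edges) : G.EdgeIn (h.side j) e := by
  have hij : i ≠ j := fun hij => hi (hij ▸ h.self_mem_descendants j)
  rintro d rfl
  rw [h.mem_side, h.mem_side, h.block_mem_descendants_iff hij ((Γ i).origin_mem he),
    h.block_mem_descendants_iff hij ((Γ i).terminus_mem he)]
  exact ⟨hi, hi⟩

theorem IsEdgeSeparation.origin_notMem_side (h : IsEdgeSeparation Γ) {j : Fin n} {d : E × Bool}
    (hd : IsBridge Γ j d) {i : Fin n} (hi : i ∈ h.descendants j) {d' : E × Bool}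
    (hd' : d'.1 ∈ (Γ i).edges) (hne : d'.1 ≠ d.1) : G.origin d' ∉ h.side j := by
  rw [h.mem_side, not_not]
  by_cases hij : i = j
  · subst hij
    rcases h.block_eq_or_mem ((Γ i).origin_mem hd') with h1 | h1
    · rwa [h1]
    · exact absurd (congrArg Prod.fst (h.eq_of_origin_mem hd ⟨hd', h1⟩)) hne
  · rwa [h.block_mem_descendants_iff hij ((Γ i).origin_mem hd')]

theorem IsEdgeSeparation.edgeIn_compl_side (h : IsEdgeSeparation Γ) {j : Fin n} {d : E × Bool}
    (hd : IsBridge Γ j d) {i : Fin n} (hi : i ∈ h.descendants j) {e : E}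
    (he : e ∈ (Γ i).edges) (hne : e ≠ d.1) : G.EdgeIn (h.side j)ᶜ e := by
  rintro d' rfl
  rw [Finset.mem_compl, Finset.mem_compl]
  exact ⟨h.origin_notMem_side hd hi he hne, h.origin_notMem_side hd hi (d' := rev d') he hne⟩

theorem not_edgeIn_compl {W : Finset V} {e : E} (h : G.EdgeIn W e) : ¬G.EdgeIn Wᶜ e := fun h' =>
  Finset.mem_compl.mp (h' (e, true) rfl).1 (h (e, true) rfl).1

theorem IsEdgeSeparation.edgesIn_side {Γ : Fin 2 → G.Subgraph} (h : IsEdgeSeparation Γ)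
    {d : E × Bool} (hd : IsBridge Γ 1 d) : EdgesIn (Γ 0) (h.side 1) := by
  intro e
  constructor
  · exact h.edgeIn_side fun h1 => absurd (h.le_of_mem_descendants h1) (by decide)
  · intro he
    obtain ⟨i, hi⟩ := h.edges_union e
    rcases (Fin.exists_fin_two (p := fun i => e ∈ (Γ i).edges)).mp ⟨i, hi⟩ with h1 | h1
    · exact h1
    · refine absurd (h.edgeIn_compl_side hd (h.self_mem_descendants 1) h1 ?_)
        (not_edgeIn_compl he)
      rintro rfl
      exact (h.isCutEdge hd).not_edgeIn he

/-- Disjointness is not part of the definition. Edges of an earlier block lie inside the side of j,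
whereas those of block j lie outside it or are the bridge. -/
theorem IsEdgeSeparation.disjoint_edges (h : IsEdgeSeparation Γ) {i j : Fin n} (hij : i ≠ j) :
    Disjoint (Γ i).edges (Γ j).edges := by
  wlog hlt : i < j generalizing i j
  · exact (this hij.symm (lt_of_le_of_ne (not_lt.mp hlt) hij.symm)).symm
  rw [Finset.disjoint_left]
  intro e hi hj
  obtain ⟨d, hd⟩ := h.exists_isBridge (Nat.zero_lt_of_lt hlt)
  have h1 : G.EdgeIn (h.side j) e :=
    h.edgeIn_side (fun h1 => (h.le_of_mem_descendants h1).not_gt hlt) hi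
  refine not_edgeIn_compl h1 (h.edgeIn_compl_side hd (h.self_mem_descendants j) hj ?_)
  rintro rfl
  exact (h.isCutEdge hd).not_edgeIn h1

theorem IsEdgeSeparation.surplusEntry_eq_zero (hG : G.IsNontrivialStandard)
    (h : IsEdgeSeparation Γ) {C : Finset E} (hC : G.IsCut C) {x : Torus E} {a : E × Bool → ℂ}
    (ha : G.IsGenericVec x a) {i j : Fin n} (hij : i ≠ j) {e f : E} (heC : e ∈ C) (hfC : f ∈ C)
    (he : e ∈ (Γ i).edges) (hf : f ∈ (Γ j).edges) : G.surplusEntry x e f = 0 := by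
  wlog hlt : i < j generalizing i j e f
  · rw [ha.toIsRealSimple.surplusEntry_comm hG.dirichlet_degree]
    exact this hij.symm hfC heC hf he (lt_of_le_of_ne (not_lt.mp hlt) hij.symm)
  obtain ⟨d, hd⟩ := h.exists_isBridge (Nat.zero_lt_of_lt hlt)
  have hcut := h.isCutEdge hd
  refine ha.surplusEntry_eq_zero hG hcut
    (h.edgeIn_side (fun h1 => (h.le_of_mem_descendants h1).not_gt hlt) he)
    (h.edgeIn_compl_side hd (h.self_mem_descendants j) hf ?_)
  rintro rfl
  exact hcut.notMem_cut hC hfC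

theorem IsEdgeSeparation.det_surplusMatrix_ne_zero (hG : G.IsNontrivialStandard)
    (h : IsEdgeSeparation Γ) {C : Finset E} (hC : G.IsCut C) {x : Torus E} {a : E × Bool → ℂ}
    (ha : G.IsGenericVec x a) (j : Fin n) :
    (G.surplusMatrix x (C ∩ (Γ j).edges)).det ≠ 0 := by
  refine ha.det_surplusMatrix_ne_zero hG hC Finset.inter_subset_left fun e he hej f hf => ?_
  obtain ⟨i, hi⟩ := h.edges_union e
  have hij : i ≠ j := by
    rintro rfl
    exact hej (Finset.mem_inter.mpr ⟨he, hi⟩)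
  exact h.surplusEntry_eq_zero hG hC ha hij he (Finset.mem_inter.mp hf).1 hi
    (Finset.mem_inter.mp hf).2

end Separation

/-! ### Counting fluxes in a block -/

section Betti

variable {G : MetricGraph V E} {n : ℕ} {Γ : Fin n → G.Subgraph}

/-- The tree edges in H form a forest: any prescribed differences along them are realized by a
function on its vertices, and constants lie in the kernel. -/
theorem card_inter_add_one_le {T : Finset E} (hT : (G.spanning T).Connected)
    (hcard : (T.card : ℤ) + 1 = Fintype.card V) {H : G.Subgraph} (hH : H.verts.Nonempty) :
    (T ∩ H.edges).card + 1 ≤ H.verts.card := by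
  let ψ : (H.verts → ℝ) →ₗ[ℝ] (↥(T ∩ H.edges) → ℝ) :=
    LinearMap.pi fun e =>
      LinearMap.proj (R := ℝ) (φ := fun _ => ℝ) (⟨G.tgt e, H.tgt_mem _ (Finset.mem_inter.mp e.2).2⟩ : H.verts) -
        LinearMap.proj (⟨G.src e, H.src_mem _ (Finset.mem_inter.mp e.2).2⟩ : H.verts)
  have hψ : Function.Surjective ψ := by
    intro g
    obtain ⟨f, hf⟩ := coboundary_surjective hT hcard
      fun e => if he : (e : E) ∈ T ∩ H.edges then g ⟨e, he⟩ else 0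
    refine ⟨fun v => f v, funext fun e => ?_⟩
    have h1 := congrFun hf ⟨e, (Finset.mem_inter.mp e.2).1⟩
    simp only [e.2, dif_pos] at h1
    exact h1
  have hker : LinearMap.ker ψ ≠ ⊥ := by
    obtain ⟨v, hv⟩ := hH
    intro h
    have h1 : (fun _ => 1 : H.verts → ℝ) ∈ LinearMap.ker ψ := by
      rw [LinearMap.mem_ker]
      funext e
      simp [ψ]
    rw [h, Submodule.mem_bot] at h1
    exact one_ne_zero (congrFun h1 ⟨v, hv⟩)
  have h1 := LinearMap.finrank_range_add_finrank_ker ψ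
  rw [LinearMap.range_eq_top.mpr hψ, finrank_top, Module.finrank_pi, Module.finrank_pi,
    Fintype.card_coe, Fintype.card_coe] at h1
  have h2 := Submodule.one_le_finrank_iff.mpr hker
  omega

/-- Vertices are counted at their first block, and each block after the initial one has one further
vertex, the shared one. -/
theorem IsVertexSeparation.card_verts (h : IsVertexSeparation Γ) (i : Fin n) :
    (Γ i).verts.card = (Finset.univ.filter fun v => h.block v = i).card +
      if 0 < (i : ℕ) then 1 else 0 := by
  have h1 : (Γ i).verts.filter (fun v => h.block v = i) =
      Finset.univ.filter fun v => h.block v = i := by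
    ext v
    simp only [Finset.mem_filter, Finset.mem_univ, true_and, and_iff_right_iff_imp]
    rintro rfl
    exact h.mem_block v
  rw [← Finset.card_filter_add_card_filter_not (s := (Γ i).verts) (fun v => h.block v = i), h1]
  congr 1
  split_ifs with hi
  · obtain ⟨w, hw⟩ := h.one_common i hi
    refine Finset.card_eq_one.mpr ⟨w, Finset.ext fun v => ?_⟩
    have hv : v = w ↔ v ∈ commonVerts Γ i := by rw [hw]; rfl
    rw [Finset.mem_filter, Finset.mem_singleton, hv]
    constructor
    · exact fun h2 => (h.block_eq_or_mem h2.1).resolve_left h2.2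
    · exact fun h2 => ⟨h2.1, ((h.mem_commonVerts_iff h2.1).mp h2).ne⟩
  · rw [Finset.card_eq_zero, Finset.filter_eq_empty_iff]
    intro v hv
    rw [not_not]
    exact (h.block_eq_or_mem hv).resolve_right fun h2 => hi (pos_of_mem_commonVerts h2)

theorem IsVertexSeparation.sum_card_verts (h : IsVertexSeparation Γ) (hn : 0 < n) :
    ∑ i, (Γ i).verts.card + 1 = Fintype.card V + n := by
  simp only [h.card_verts, Finset.sum_add_distrib]
  rw [← Finset.card_eq_sum_card_fiberwise (fun v _ => Finset.mem_univ (h.block v)),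
    Finset.card_univ, add_assoc]
  congr 1
  obtain ⟨m, rfl⟩ := Nat.exists_eq_succ_of_ne_zero hn.ne'
  rw [Fin.sum_univ_succ]
  simp

theorem IsEdgeSeparation.sum_card_inter (h : IsEdgeSeparation Γ) (T : Finset E) :
    ∑ i, (T ∩ (Γ i).edges).card = T.card := by
  rw [← Finset.card_biUnion fun i _ j _ hij => (h.disjoint_edges hij).mono
    Finset.inter_subset_right Finset.inter_subset_right]
  congr 1
  ext e
  simp only [Finset.mem_biUnion, Finset.mem_univ, true_and, Finset.mem_inter]
  exact ⟨fun ⟨_, h, _⟩ => h, fun he => ⟨_, he, (h.edges_union e).choose_spec⟩⟩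

/-- The forest bounds of the blocks add up exactly to the number of edges of the spanning tree, so
each is an equality, and the complement in each block has Betti number many edges. -/
theorem IsEdgeSeparation.card_cut_inter (h : IsEdgeSeparation Γ) {C : Finset E} (hC : G.IsCut C)
    (i : Fin n) : ((C ∩ (Γ i).edges).card : ℤ) = (Γ i).betti := by
  have hle : ∀ i ∈ Finset.univ, ((Finset.univ \ C) ∩ (Γ i).edges).card + 1 ≤ (Γ i).verts.card :=
    fun i _ => card_inter_add_one_le hC.1 hC.card_compl (h.connected i).1
  have hsum : ∑ i, (((Finset.univ \ C) ∩ (Γ i).edges).card + 1) = ∑ i, (Γ i).verts.card := by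
    have h1 := h.sum_card_verts (Fin.pos i)
    have h2 := hC.card_compl
    rw [Finset.sum_add_distrib, h.sum_card_inter]
    simp only [Finset.sum_const, Finset.card_univ, Fintype.card_fin, smul_eq_mul, mul_one]
    omega
  have h1 := (Finset.sum_eq_sum_iff_of_le hle).mp hsum i (Finset.mem_univ i)
  have h2 := Finset.card_sdiff_add_card_inter (Γ i).edges C
  have h3 : (Γ i).edges \ C = (Finset.univ \ C) ∩ (Γ i).edges := by
    ext e
    simp [and_comm]
  rw [h3, Finset.inter_comm (Γ i).edges] at h2
  rw [Subgraph.betti]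
  omega

end Betti

end MetricGraph

end

noncomputable section

namespace MetricGraph

variable {V E : Type*} [Fintype V] [Fintype E] [DecidableEq V] [DecidableEq E]

/-! ### Composing bridge maps to flip a prescribed set of blocks -/

section Flips

variable {G : MetricGraph V E} {n : ℕ} {Γ : Fin n → G.Subgraph}

/-- A map flips a set of blocks if it reflects the local surplus of these blocks and preserves the
local surplus of the other blocks. -/
def Flips (Γ : Fin n → G.Subgraph) (R : G.genericSet → G.genericSet) (X : Set (Fin n)) : Prop :=
  ∀ C, G.IsCut C → ∀ (x : G.genericSet) (j : Fin n),
    (j ∈ X → (localSurplus C (Γ j) (R x : Torus E) : ℤ) =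
      (Γ j).betti - localSurplus C (Γ j) (x : Torus E)) ∧
    (j ∉ X → localSurplus C (Γ j) (R x : Torus E) = localSurplus C (Γ j) (x : Torus E))

theorem flips_id : Flips Γ id ∅ := fun _ _ _ _ =>
  ⟨fun h => absurd h (Set.notMem_empty _), fun _ => rfl⟩

/-- Reflecting a surplus twice restores it, so flipped sets combine as in characteristic two. -/
theorem Flips.comp {R S : G.genericSet → G.genericSet} {X Y : Set (Fin n)} (hR : Flips Γ R X)
    (hS : Flips Γ S Y) : Flips Γ (R ∘ S) (symmDiff X Y) := by
  intro C hC x j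
  have h1 := hR C hC (S x) j
  have h2 := hS C hC x j
  rw [Set.mem_symmDiff, Function.comp_apply]
  generalize localSurplus C (Γ j) (R (S x) : Torus E) = r at h1 ⊢
  generalize localSurplus C (Γ j) (S x : Torus E) = s at h1 h2
  generalize localSurplus C (Γ j) (x : Torus E) = t at h2 ⊢
  by_cases hX : j ∈ X <;> by_cases hY : j ∈ Y
  · have h3 := h1.1 hX
    have h4 := h2.1 hY
    exact ⟨by tauto, fun _ => by omega⟩
  · have h3 := h1.1 hX
    have h4 := h2.2 hY
    exact ⟨fun _ => by omega, by tauto⟩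
  · have h3 := h1.2 hX
    have h4 := h2.1 hY
    exact ⟨fun _ => by omega, by tauto⟩
  · have h3 := h1.2 hX
    have h4 := h2.2 hY
    exact ⟨by tauto, fun _ => by omega⟩

theorem IsEdgeSeparation.localSurplus_of_neg (hG : G.IsNontrivialStandard)
    (h : IsEdgeSeparation Γ) {C : Finset E} (hC : G.IsCut C) {x x' : Torus E} {a : E × Bool → ℂ}
    (ha : G.IsGenericVec x a) {j : Fin n}
    (hneg : ∀ e ∈ C ∩ (Γ j).edges, ∀ f ∈ C ∩ (Γ j).edges,
      G.surplusEntry x' e f = -G.surplusEntry x e f) :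
    (localSurplus C (Γ j) x' : ℤ) = (Γ j).betti - localSurplus C (Γ j) x := by
  have h1 := localSurplus_add_of_neg (ha.toIsRealSimple.isHermitian hG.dirichlet_degree _)
    (h.det_surplusMatrix_ne_zero hG hC ha j) hneg
  rw [← h.card_cut_inter hC, ← h1]
  push_cast
  ring

theorem IsEdgeSeparation.flips_of_isMirror (hG : G.IsNontrivialStandard) (h : IsEdgeSeparation Γ)
    {W : Finset V} {d : E × Bool} (hd : G.IsCutEdge W d) {R : G.genericSet → G.genericSet}
    (hR : ∀ (x : G.genericSet) a, G.IsGenericVec x a → G.IsMirror W a x (R x)) {X : Set (Fin n)}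
    (hfar : ∀ j ∈ X, ∀ e ∈ (Γ j).edges, e ≠ d.1 → G.EdgeIn Wᶜ e)
    (hnear : ∀ j ∉ X, ∀ e ∈ (Γ j).edges, e ≠ d.1 → G.EdgeIn W e) : Flips Γ R X := by
  intro C hC x j
  obtain ⟨a, ha⟩ := exists_isGenericVec hG.dirichlet_degree x.2
  have hm := hR x a ha
  have hne : ∀ e ∈ C ∩ (Γ j).edges, e ≠ d.1 := by
    rintro e he rfl
    exact hd.notMem_cut hC (Finset.mem_inter.mp he).1
  constructor
  · intro hj
    refine h.localSurplus_of_neg hG hC ha fun e he f hf => ?_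
    exact hm.surplusEntry_far hG ha hd (hfar j hj e (Finset.mem_inter.mp he).2 (hne e he))
      (hfar j hj f (Finset.mem_inter.mp hf).2 (hne f hf))
  · intro hj
    refine localSurplus_congr fun e he f hf => ?_
    exact hm.surplusEntry_near hG ha hd (hnear j hj e (Finset.mem_inter.mp he).2 (hne e he))
      (hnear j hj f (Finset.mem_inter.mp hf).2 (hne f hf))

theorem IsEdgeSeparation.flips_descendants (hG : G.IsNontrivialStandard) (h : IsEdgeSeparation Γ)
    {j : Fin n} {d : E × Bool} (hd : IsBridge Γ j d) {R : G.genericSet → G.genericSet}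
    (hR : ∀ (x : G.genericSet) a, G.IsGenericVec x a → G.IsMirror (h.side j) a x (R x)) :
    Flips Γ R (h.descendants j) :=
  h.flips_of_isMirror hG (h.isCutEdge hd) hR
    (fun _ hi _ he hne => h.edgeIn_compl_side hd hi he hne) fun _ hi _ he _ => h.edgeIn_side hi he

theorem IsEdgeSeparation.flips_compl_descendants (hG : G.IsNontrivialStandard)
    (h : IsEdgeSeparation Γ) {j : Fin n} {d : E × Bool} (hd : IsBridge Γ j d)
    {R : G.genericSet → G.genericSet}
    (hR : ∀ (x : G.genericSet) a, G.IsGenericVec x a → G.IsMirror (h.side j)ᶜ a x (R x)) :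
    Flips Γ R (h.descendants j)ᶜ := by
  refine h.flips_of_isMirror hG (h.isCutEdge hd).compl hR (fun i hi e he _ => ?_)
    fun i hi e he hne => h.edgeIn_compl_side hd (not_not.mp hi) he hne
  rw [compl_compl]
  exact h.edgeIn_side hi he

theorem IsEdgeSeparation.flips_inversion (hG : G.IsNontrivialStandard) (h : IsEdgeSeparation Γ) :
    Flips Γ (inversion hG) Set.univ := by
  intro C hC x j
  obtain ⟨a, ha⟩ := exists_isGenericVec hG.dirichlet_degree x.2
  exact ⟨fun _ => h.localSurplus_of_neg hG hC ha fun e _ f _ => ha.surplusEntry_neg hG e f,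
    fun hj => absurd (Set.mem_univ j) hj⟩

/-- The set of blocks `X` is flipped by a composition of bridge maps. -/
def Flippable (Γ : Fin n → G.Subgraph) (X : Set (Fin n)) : Prop :=
  ∃ L : List (G.genericSet ≃ₜ G.genericSet), (∀ R ∈ L, IsBridgeSymmetry R) ∧
    MeasurePreserving L.prod G.barraGaspard G.barraGaspard ∧ Flips Γ L.prod X

theorem flippable_empty : Flippable Γ ∅ :=
  ⟨[], by simp, MeasurePreserving.id _, flips_id⟩

theorem Flippable.symmDiff {X Y : Set (Fin n)} (hX : Flippable Γ X) (hY : Flippable Γ Y) :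
    Flippable Γ (symmDiff X Y) := by
  obtain ⟨L, hL, hLm, hLX⟩ := hX
  obtain ⟨M, hM, hMm, hMY⟩ := hY
  refine ⟨L ++ M, fun R hR => (List.mem_append.mp hR).elim (hL R) (hM R), ?_, ?_⟩
  · rw [List.prod_append]
    exact hLm.comp hMm
  · rw [List.prod_append]
    exact hLX.comp hMY

theorem IsCutEdge.flippable (hG : G.IsNontrivialStandard) {W : Finset V} {d : E × Bool}
    (hd : G.IsCutEdge W d) {X : Set (Fin n)}
    (hX : ∀ R : G.genericSet → G.genericSet,
      (∀ (x : G.genericSet) a, G.IsGenericVec x a → G.IsMirror W a x (R x)) → Flips Γ R X) :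
    Flippable Γ X := by
  obtain ⟨R, hR, hRm, hRx⟩ := hd.exists_isBridgeSymmetry hG
  refine ⟨[R], by simpa using hR, ?_, ?_⟩
  · rw [List.prod_singleton]
    exact hRm
  · rw [List.prod_singleton]
    exact hX R hRx

theorem flippable_of_singletons {X : Set (Fin n)} (h : ∀ i ∈ X, Flippable Γ {i}) :
    Flippable Γ X := by
  induction X, X.toFinite using Set.Finite.induction_on with
  | empty => exact flippable_empty
  | @insert i s hi _ ih =>
    have h1 := (h i (Set.mem_insert _ _)).symmDiff (ih fun j hj => h j (Set.mem_insert_of_mem _ hj))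
    rwa [(Set.disjoint_singleton_left.mpr hi).symmDiff_eq_sup,
      show {i} ⊔ s = {i} ∪ s from rfl, ← Set.insert_eq] at h1

/-- Reflection at the bridge of b flips b with all its descendants. The proper descendants have
larger indices, so they are flipped back one by one. -/
theorem IsEdgeSeparation.flippable_singleton (hG : G.IsNontrivialStandard)
    (h : IsEdgeSeparation Γ) {b : Fin n} (hb : 0 < (b : ℕ)) : Flippable Γ {b} := by
  induction b using WellFoundedGT.induction with
  | ind b ih =>
    obtain ⟨d, hd⟩ := h.exists_isBridge hb
    have h1 : Flippable Γ (h.descendants b) :=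
      (h.isCutEdge hd).flippable hG fun R hR => h.flips_descendants hG hd hR
    have h2 : Flippable Γ (h.descendants b \ {b}) := flippable_of_singletons fun i hi => by
      have hbi : b < i := lt_of_le_of_ne (h.le_of_mem_descendants hi.1) (Ne.symm hi.2)
      exact ih i hbi (hb.trans hbi)
    have h3 := h1.symmDiff h2
    rwa [show symmDiff (h.descendants b) (h.descendants b \ {b}) = {b} by
      ext i
      have := h.self_mem_descendants b
      simp only [Set.mem_symmDiff, Set.mem_sdiff, Set.mem_singleton_iff]
      by_cases hi : i = b
      · subst hi
        tauto
      · tauto] at h3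

/-- The initial block has no bridge of its own, so the singletons alone do not suffice for b > 0.
There the bridge of b is used in the opposite direction, which flips all blocks except b and its
descendants. -/
theorem IsEdgeSeparation.flippable_compl_singleton (hG : G.IsNontrivialStandard)
    (h : IsEdgeSeparation Γ) (b : Fin n) : Flippable Γ {b}ᶜ := by
  rcases Nat.eq_zero_or_pos (b : ℕ) with hb | hb
  · refine flippable_of_singletons fun i hi => h.flippable_singleton hG ?_
    have : (i : ℕ) ≠ b := fun h' => hi (Fin.ext h')
    omega
  · obtain ⟨d, hd⟩ := h.exists_isBridge hb
    have h1 : Flippable Γ (h.descendants b)ᶜ :=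
      (h.isCutEdge hd).compl.flippable hG fun R hR => h.flips_compl_descendants hG hd hR
    have h2 : Flippable Γ (h.descendants b \ {b}) := flippable_of_singletons fun i hi => by
      have hbi : b < i := lt_of_le_of_ne (h.le_of_mem_descendants hi.1) (Ne.symm hi.2)
      exact h.flippable_singleton hG (hb.trans hbi)
    have h3 := h1.symmDiff h2
    rwa [show symmDiff (h.descendants b)ᶜ (h.descendants b \ {b}) = {b}ᶜ by
      ext i
      have := h.self_mem_descendants b
      simp only [Set.mem_symmDiff, Set.mem_sdiff, Set.mem_singleton_iff, Set.mem_compl_iff]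
      by_cases hi : i = b
      · subst hi
        tauto
      · tauto] at h3

end Flips

end MetricGraph

end

theorem mainTheorem4 {V E : Type*} [Fintype V] [Fintype E] [DecidableEq V] [DecidableEq E]
    (G : MetricGraph V E) (hG : G.IsNontrivialStandard) :
    (∀ (Γ : Fin 2 → G.Subgraph), MetricGraph.IsEdgeSeparation Γ →
      ∀ d : E × Bool, MetricGraph.IsBridge Γ 1 d →
        (∃ θ, MetricGraph.IsBridgePhase (Γ 0) d θ) ∧
        ∀ θ, MetricGraph.IsBridgePhase (Γ 0) d θ →
          ∃ R : G.genericSet ≃ₜ G.genericSet,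
            (∀ x : G.genericSet, (R x : Torus E) = MetricGraph.bridgeMap (Γ 0) d.1 θ x) ∧
            MeasurePreserving R G.barraGaspard G.barraGaspard ∧
            ∀ C, G.IsCut C → ∀ x : G.genericSet,
              MetricGraph.localSurplus C (Γ 0) (R x : Torus E) =
                MetricGraph.localSurplus C (Γ 0) (x : Torus E) ∧
              (MetricGraph.localSurplus C (Γ 1) (R x : Torus E) : ℤ) =
                (Γ 1).betti - MetricGraph.localSurplus C (Γ 1) (x : Torus E)) ∧
    (∀ (n : ℕ) (Γ : Fin n → G.Subgraph), MetricGraph.IsEdgeSeparation Γ → ∀ b : Fin n,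
      ∃ (inv T : G.genericSet ≃ₜ G.genericSet) (L : List (G.genericSet ≃ₜ G.genericSet)),
        (∀ x : G.genericSet, (inv x : Torus E) = -(x : Torus E)) ∧
        (∀ R ∈ L, MetricGraph.IsBridgeSymmetry R) ∧
        T = L.prod * inv ∧
        MeasurePreserving T G.barraGaspard G.barraGaspard ∧
        ∀ C, G.IsCut C → ∀ x : G.genericSet,
          (MetricGraph.localSurplus C (Γ b) (T x : Torus E) : ℤ) =
            (Γ b).betti - MetricGraph.localSurplus C (Γ b) (x : Torus E) ∧
          ∀ j, j ≠ b →
            MetricGraph.localSurplus C (Γ j) (T x : Torus E) =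
              MetricGraph.localSurplus C (Γ j) (x : Torus E)) := by
  constructor
  · intro Γ hΓ d hd
    have hcut := hΓ.isCutEdge hd
    have hH := hΓ.edgesIn_side hd
    refine ⟨MetricGraph.exists_isBridgePhase hG hcut hH, fun θ hθ =>
      ⟨MetricGraph.bridgeHomeomorph hG hcut hH hθ, fun _ => rfl,
        (MetricGraph.isSignReflection_bridgeHomeomorph hG hcut hH hθ).measurePreserving_barraGaspard
          hG, fun C hC x => ?_⟩⟩
    have hflip := hΓ.flips_descendants hG hd
      (R := MetricGraph.bridgeHomeomorph hG hcut hH hθ) fun x a ha =>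
      MetricGraph.isMirror_bridgeMap hcut hH hθ x.2 ha.toIsRealSimple
    exact ⟨(hflip C hC x 0).2 fun h => absurd (hΓ.le_of_mem_descendants h) (by decide),
      (hflip C hC x 1).1 (hΓ.self_mem_descendants 1)⟩
  · intro n Γ hΓ b
    obtain ⟨L, hL, hLm, hLb⟩ := hΓ.flippable_compl_singleton hG b
    refine ⟨MetricGraph.inversion hG, L.prod * MetricGraph.inversion hG, L, fun _ => rfl, hL, rfl,
      hLm.comp (MetricGraph.measurePreserving_inversion hG), fun C hC x => ?_⟩
    -- Inversion reflects every block and the bridge maps reflect all blocks except b a second time,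
    -- so only b stays reflected.
    have hflip := hLb.comp (hΓ.flips_inversion hG)
    have hset : symmDiff ({b}ᶜ : Set (Fin n)) Set.univ = {b} := by
      ext i
      simp [Set.mem_symmDiff]
    rw [hset] at hflip
    exact ⟨(hflip C hC x b).1 rfl, fun j hj => (hflip C hC x j).2 hj⟩
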